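/- **Conventions.** Locally compact groups are Hausdorff, brackets $\langle\cdot|\cdot\rangle$ are linear in the first variable, and a set is precompact if its closure is compact. For a locally compact second countable group $G$: * $C_0(G)$ is the space of continuous functions $G\to\mathbb C$ tending to $0$ at infinity. * $G$ has the *Haagerup property* if there is a sequence $(u_n)$ of positive definite functions in $C_0(G)$ with $u_n(1)=1$ and $u_n\to 1$ uniformly on compact subsets of $G$. * $B_2(G)$ is the set of Herz–Schur multipliers: continuous functions $u:G\to\mathbb C$ for which there are a separable complex Hilbert space $\mathcal H$ and bounded continuous maps $\xi,\eta:G\to\mathcal H$ with $u(h^{-1}g)=\langle\xi(g)|\eta(h)\rangle$ for all $g,h\in G$; $\|u\|_{B_2}$ is the infimum of $\|\xi\|_\infty\|\eta\|_\infty$ over all such representations of $u$. * $A(G)\subset B_2(G)$ is the Fourier algebra, i.e. the set of coefficient functions $g\mapsto\langle\lambda(g)\xi|\eta\rangle$, $\xi,\eta\in L^2(G)$, of the left regular representation $\lambda$. * $\Lambda_{\mathrm{WA}}(G)\in[1,\infty]$ (resp. $\Lambda_{\mathrm{WH}}(G)\in[1,\infty]$) is the infimum of all real $C\ge 1$ for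 which there is a sequence $(u_n)$ in $A(G)$ (resp. in $B_2(G)\cap C_0(G)$) with $\|u_n\|_{B_2}\le C$ for all $n$ and $u_n\to1$ uniformly on compact sets ($\inf\emptyset=\infty$). $G$ is *weakly amenable* if $\Lambda_{\mathrm{WA}}(G)<\infty$ and has the *weak Haagerup property* if $\Lambda_{\mathrm{WH}}(G)<\infty$. **Theorem.** Let $G$ and $H$ be locally compact second countable groups. Let $G$ act in a Borel way on a standard probability space $(X,\mu)$, preserving the measure class of $\mu$, and suppose that $L^\infty(X,\mu)$ has a $G$-invariant state. Let $\alpha:G\times X\to H$ be a Borel cocycle, i.e. a Borel map such that for all $g,h\in G$ one has $\alpha(gh,x)=\alpha(g,hx)\alpha(h,x)$ for $\mu$-almost every $x$. Assume that $\alpha$ is proper, that is: 1. for every Borel set $A\subset X$, every $\varepsilon>0$ and every compact set $K\subset G$ there is a Borel set $A_{\varepsilon,K}\subset A$ such that $\mu(A\setminus A_{\varepsilon,K})<\varepsilon$ and $\alpha(K\times A_{\varepsilon,K})$ is precompact; 2. for every compact set $L\subset H$ and every $\varepsilon>0$ there is a Borel set $A\subset X$ such that $\mu(X\setminus A)\le\varepsilon$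 and the set $$K(A,L)=\{g\in G:\ \mu(\{x\in A\cap g^{-1}A:\ \alpha(g,x)\in L\})>0\}$$ is precompact. Then: * (a) If $H$ has the Haagerup property, then so does $G$. * (b) If $H$ is weakly amenable, then so is $G$, and $\Lambda_{\mathrm{WA}}(G)\le\Lambda_{\mathrm{WA}}(H)$. * (c) If $H$ has the weak Haagerup property, then so does $G$, and $\Lambda_{\mathrm{WH}}(G)\le\Lambda_{\mathrm{WH}}(H)$. -/

import Mathlib

open MeasureTheory Filter Topology
open scoped ENNReal NNReal ComplexConjugate ComplexOrder BoundedContinuousFunction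

namespace ProperCocycle

noncomputable section

section Groups

variable {G : Type*} [Group G] [TopologicalSpace G]

/-- `u n → 1` uniformly on compact subsets of `G`. -/
def TendstoOneOnCompacts (u : ℕ → G → ℂ) : Prop :=
  ∀ K : Set G, IsCompact K → TendstoUniformlyOn u (fun _ => (1 : ℂ)) atTop K

/-- `u ∈ C₀(G)`: a continuous function that tends to `0` at infinity. -/
def IsC0 {G : Type*} [TopologicalSpace G] (u : G → ℂ) : Prop :=
  Continuous u ∧ Tendsto u (cocompact G) (𝓝 0)

/-- Positive definite functions: `∑ i j, conj (c i) * c j * u (gᵢ⁻¹ gⱼ) ≥ 0` (that is, real and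
nonnegative) for all finite families of group elements `g i` and scalars `c i`. -/
def IsPosDefFun {G : Type*} [Group G] (u : G → ℂ) : Prop :=
  ∀ (n : ℕ) (g : Fin n → G) (c : Fin n → ℂ),
    (0 : ℂ) ≤ ∑ i, ∑ j, conj (c i) * c j * u ((g i)⁻¹ * g j)

/-- The Haagerup property: there is a sequence of normalized positive definite `C₀`-functions
converging to `1` uniformly on compact sets. -/
def HaagerupProperty (G : Type*) [Group G] [TopologicalSpace G] : Prop :=
  ∃ u : ℕ → G → ℂ,
    (∀ n, IsPosDefFun (u n) ∧ u n 1 = 1 ∧ IsC0 (u n)) ∧ TendstoOneOnCompacts u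

/-- The set of all products `‖ξ‖_∞ ‖η‖_∞`, where `ξ, η : G → E` are bounded continuous functions
into a separable complex Hilbert space `E` such that `u (h⁻¹ g) = ⟨ξ(g) | η(h)⟩` for all `g, h`.
(The bracket `⟨· | ·⟩` is linear in its first argument, Mathlib's `inner ℂ` in its second.
Letting `E` range over `Type` is no restriction, as every separable Hilbert space is
isometrically isomorphic to one that lives in `Type`.) -/
def herzSchurBounds (u : G → ℂ) : Set ℝ :=
  {c | ∃ (E : Type) (_ : NormedAddCommGroup E) (_ : InnerProductSpace ℂ E)
      (_ : CompleteSpace E) (_ : TopologicalSpace.SeparableSpace E) (ξ η : G →ᵇ E),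
      (∀ g h : G, u (h⁻¹ * g) = inner ℂ (η h) (ξ g)) ∧ c = ‖ξ‖ * ‖η‖}

/-- `u ∈ B₂(G)`: `u` is a Herz–Schur multiplier of `G`. -/
def IsHerzSchurMultiplier (u : G → ℂ) : Prop :=
  Continuous u ∧ (herzSchurBounds u).Nonempty

/-- The norm `‖u‖_{B₂}`, the infimum of `‖ξ‖_∞ ‖η‖_∞` over all representations of `u`; it is `∞`
if `u` has no such representation. -/
def herzSchurNorm (u : G → ℂ) : ℝ≥0∞ :=
  ⨅ c ∈ herzSchurBounds u, ENNReal.ofReal c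

/-- The weak Haagerup constant `Λ_WH(G) ∈ [1, ∞]`. -/
def weakHaagerupConstant (G : Type*) [Group G] [TopologicalSpace G] : ℝ≥0∞ :=
  ⨅ (C : ℝ≥0) (_ : 1 ≤ C ∧ ∃ u : ℕ → G → ℂ,
      (∀ n, IsHerzSchurMultiplier (u n) ∧ IsC0 (u n) ∧ herzSchurNorm (u n) ≤ C) ∧
      TendstoOneOnCompacts u), (C : ℝ≥0∞)

/-- The weak Haagerup property. -/
def WeakHaagerupProperty (G : Type*) [Group G] [TopologicalSpace G] : Prop := weakHaagerupConstant G < ∞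

variable [IsTopologicalGroup G] [LocallyCompactSpace G] [MeasurableSpace G] [BorelSpace G]

/-- `u ∈ A(G)`, the Fourier algebra: `u` is a coefficient function `g ↦ ⟨λ(g)ξ | η⟩` of the left
regular representation `(λ(g)ξ)(t) = ξ (g⁻¹ t)` on `L²(G)`, taken with respect to left Haar
measure. The bracket is written out as an integral. -/
def IsFourierAlgebra (u : G → ℂ) : Prop :=
  ∃ ξ η : G → ℂ, MemLp ξ 2 (Measure.haar : Measure G) ∧ MemLp η 2 (Measure.haar : Measure G) ∧
    ∀ g : G, u g = ∫ t, ξ (g⁻¹ * t) * conj (η t) ∂(Measure.haar : Measure G)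

/-- The Cowling–Haagerup constant `Λ_WA(G) ∈ [1, ∞]`. -/
def cowlingHaagerupConstant (G : Type*) [Group G] [TopologicalSpace G] [IsTopologicalGroup G]
    [LocallyCompactSpace G] [MeasurableSpace G] [BorelSpace G] : ℝ≥0∞ :=
  ⨅ (C : ℝ≥0) (_ : 1 ≤ C ∧ ∃ u : ℕ → G → ℂ,
      (∀ n, IsFourierAlgebra (u n) ∧ herzSchurNorm (u n) ≤ C) ∧
      TendstoOneOnCompacts u), (C : ℝ≥0∞)

/-- Weak amenability. -/
def WeaklyAmenable (G : Type*) [Group G] [TopologicalSpace G] [IsTopologicalGroup G]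
    [LocallyCompactSpace G] [MeasurableSpace G] [BorelSpace G] : Prop := cowlingHaagerupConstant G < ∞

end Groups

section Actions

variable {G H X : Type*} [Group G] [MulAction G X] [MeasurableSpace X]

/-- `(G, X)` is an amenable pair: there is a `G`-invariant state `m` on `L^∞(X, μ)`, that is, a
positive unital linear functional with `m (g • f) = m f`, where `(g • f)(x) = f (g⁻¹ x)`. (For a
measure class preserving action `g • f` exists in `L^∞(X, μ)` and is unique; below it is `f'`.) -/
def IsAmenablePair (G : Type*) {X : Type*} [Group G] [MulAction G X] [MeasurableSpace X]
    (μ : Measure X) : Prop :=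
  ∃ m : Lp ℂ ∞ μ →L[ℂ] ℂ,
    (∀ f : Lp ℂ ∞ μ, (∀ᵐ x ∂μ, 0 ≤ f x) → 0 ≤ m f) ∧
    (∀ f : Lp ℂ ∞ μ, (∀ᵐ x ∂μ, f x = 1) → m f = 1) ∧
    (∀ (g : G) (f f' : Lp ℂ ∞ μ), (∀ᵐ x ∂μ, f' x = f (g⁻¹ • x)) → m f' = m f)

/-- The action of `G` on `(X, μ)` preserves the class of `μ`. -/
def IsMeasureClassPreserving (G : Type*) {X : Type*} [Group G] [MulAction G X]
    [MeasurableSpace X] (μ : Measure X) : Prop :=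
  ∀ g : G, μ.map (fun x => g • x) ≪ μ ∧ μ ≪ μ.map (fun x => g • x)

/-- Borel cocycles `α : G × X → H`; for fixed `g, h` the cocycle identity is required almost
everywhere. -/
structure IsBorelCocycle [MeasurableSpace G] [Group H] [MeasurableSpace H]
    (μ : Measure X) (α : G × X → H) : Prop where
  measurable : Measurable α
  cocycle : ∀ g h : G, ∀ᵐ x ∂μ, α (g * h, x) = α (g, h • x) * α (h, x)

/-- The set `K(A, L)` of all `g` with `μ {x ∈ A ∩ g⁻¹A : α (g, x) ∈ L} > 0`. -/
def returnSet (μ : Measure X) (α : G × X → H) (A : Set X) (L : Set H) : Set G :=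
  {g | 0 < μ {x | x ∈ A ∧ g • x ∈ A ∧ α (g, x) ∈ L}}

/-- Proper cocycles. A set is precompact when its closure is compact. -/
structure IsProperCocycle [TopologicalSpace G] [MeasurableSpace G]
    [Group H] [TopologicalSpace H] [MeasurableSpace H]
    (μ : Measure X) (α : G × X → H) : Prop extends IsBorelCocycle μ α where
  precompact_image : ∀ A : Set X, MeasurableSet A → ∀ ε : ℝ, 0 < ε → ∀ K : Set G, IsCompact K →
    ∃ A' : Set X, MeasurableSet A' ∧ A' ⊆ A ∧ μ (A \ A') < ENNReal.ofReal ε ∧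
      IsCompact (closure (α '' (K ×ˢ A')))
  precompact_returnSet : ∀ L : Set H, IsCompact L → ∀ ε : ℝ, 0 < ε →
    ∃ A : Set X, MeasurableSet A ∧ μ Aᶜ ≤ ENNReal.ofReal ε ∧
      IsCompact (closure (returnSet μ α A L))

end Actions

end

end ProperCocycle

set_option linter.unusedSectionVars false

/-! Functions on `H` are carried to `G` along the cocycle. For F ≥ 0 on X with integral at most 1,
let s_*F denote the density of s_*(Fμ). A function u on `H` yields the kernel k(s,t) = ∫ √(s_*F ·
t_*F)(y) u(α(t,t⁻¹y)⁻¹ α(s,s⁻¹y)) dμ(y). The cocycle identity and the chain rule for Radon–Nikodym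
derivatives make k invariant under left translation (`twistedKernel_mul_mul`), so it depends only on
t⁻¹s. If u(h'⁻¹h) = ⟨ξ(h)|η(h')⟩, then k(s,t) is the inner product in L²(X,E) of y ↦ √(s_*F(y))
ξ(α(s,s⁻¹y)) with its analogue for η and t, and these vectors have norm at most ‖ξ‖_∞ and ‖η‖_∞.
Averaging s and t against a bump ψ on `G` makes them norm continuous. The transferred function thus
keeps the Schur constant of u (`HasSchurRep.transferredFun`), and it is positive definite if u is.

Decay: by the second condition of properness, applied along an exhaustion of `H`, some large set A
has all its return sets precompact. If F vanishes off A, then for t⁻¹s outside K(A,L) the kernel is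
bounded by the supremum of |u| off L. So C₀-functions go to C₀-functions (`IsC0.transferredFun`) and
compactly supported ones to A(G) (`isFourierAlgebra_transferredFun`). The latter suffices for weak
amenability, since A(H) is approximated in B₂-norm by compactly supported functions.

Convergence to 1: take F = 1_A f with f a density that is almost invariant in L¹ on a compact set.
The first condition of properness confines the cocycle to a compact set, up to small f-mass, and u
is close to 1 on the relevant quotients (`norm_twistedKernel_sub_one_le`). Such f come from the
invariant state: an invariant mean kills averages of null integral
(`InvariantMean.map_orbitAverage_eq_zero`), a Hahn–Banach separation turns this into densities
(`exists_density_smoothDensity_le`), and smoothing over `G` makes the invariance uniform on compact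
sets. All choices are made before u, which is selected last (`IsProperCocycle.exists_transfer`). -/

namespace ProperCocycle

noncomputable section

/-! ### Representations of Herz–Schur multipliers -/

section SchurRepresentations

variable {G : Type*} [Group G] [TopologicalSpace G]

/-- `u (h⁻¹ g) = ⟪η h, ξ g⟫` for continuous maps `ξ`, `η` into a separable Hilbert space with
`‖ξ g‖² ≤ c` and `‖η g‖² ≤ c`. -/
def HasSchurRep (u : G → ℂ) (c : ℝ) : Prop :=
  ∃ (E : Type) (_ : NormedAddCommGroup E) (_ : InnerProductSpace ℂ E)
    (_ : CompleteSpace E) (_ : TopologicalSpace.SeparableSpace E) (ξ η : G → E),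
    Continuous ξ ∧ Continuous η ∧ (∀ g, ‖ξ g‖ ^ 2 ≤ c) ∧ (∀ g, ‖η g‖ ^ 2 ≤ c) ∧
    ∀ g h : G, u (h⁻¹ * g) = inner ℂ (η h) (ξ g)

/-- Distinct orthonormal vectors are at distance √2, so the balls of radius 1/2 around them are
disjoint open sets. -/
theorem countable_of_orthonormal {ι E : Type*} [NormedAddCommGroup E] [InnerProductSpace ℂ E]
    [TopologicalSpace.SeparableSpace E] {b : ι → E} (hb : Orthonormal ℂ b) : Countable ι := by
  refine Pairwise.countable_of_isOpen_disjoint (s := fun i => Metric.ball (b i) (1 / 2))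
    (fun i j hij => ?_) (fun i => Metric.isOpen_ball)
    (fun i => ⟨b i, Metric.mem_ball_self (by norm_num)⟩)
  refine Metric.ball_disjoint_ball ?_
  have h : ‖b i - b j‖ ^ 2 = 2 := by
    rw [@norm_sub_sq ℂ, hb.1, hb.1, hb.2 hij]; norm_num
  rw [dist_eq_norm]
  nlinarith [norm_nonneg (b i - b j)]

/-- Every separable Hilbert space is isometric to one in `Type`. -/
theorem exists_linearIsometryEquiv_type (E : Type*) [NormedAddCommGroup E] [InnerProductSpace ℂ E]
    [CompleteSpace E] [TopologicalSpace.SeparableSpace E] :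
    ∃ (ι : Type), Nonempty (E ≃ₗᵢ[ℂ] lp (fun _ : ι => ℂ) 2) := by
  obtain ⟨w, b, hb⟩ := exists_hilbertBasis ℂ E
  have : Countable w := countable_of_orthonormal b.orthonormal
  -- A countable index set has a copy in `Type`, whatever the universe of E.
  let e : Shrink.{0} w ≃ w := (equivShrink.{0} w).symm
  have hon : Orthonormal ℂ (fun i => b (e i)) := b.orthonormal.comp _ e.injective
  refine ⟨Shrink.{0} w, ⟨(HilbertBasis.mk hon ?_).repr⟩⟩
  have : Set.range (fun i => b (e i)) = Set.range b := e.surjective.range_comp b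
  rw [this]
  exact b.dense_span.ge

/-- Only the closed span of the two ranges matters, and it is separable because `G` is. This admits
Hilbert spaces of any size and universe, such as GNS spaces and L²(X,E). -/
theorem HasSchurRep.of_inner [TopologicalSpace.SeparableSpace G] {u : G → ℂ} {c : ℝ}
    {E : Type*} [NormedAddCommGroup E] [InnerProductSpace ℂ E] [CompleteSpace E] {ξ η : G → E}
    (hξ : Continuous ξ) (hη : Continuous η) (hξc : ∀ g, ‖ξ g‖ ^ 2 ≤ c) (hηc : ∀ g, ‖η g‖ ^ 2 ≤ c)
    (hu : ∀ g h : G, u (h⁻¹ * g) = inner ℂ (η h) (ξ g)) : HasSchurRep u c := by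
  let S : Submodule ℂ E := (Submodule.span ℂ (Set.range ξ ∪ Set.range η)).topologicalClosure
  have hsep : TopologicalSpace.IsSeparable (S : Set E) := by
    rw [Submodule.topologicalClosure_coe]
    exact (((TopologicalSpace.isSeparable_range hξ).union
      (TopologicalSpace.isSeparable_range hη)).span).closure
  have : TopologicalSpace.SeparableSpace S := hsep.separableSpace
  have : CompleteSpace S := Submodule.topologicalClosure.completeSpace _
  have hξS : ∀ g, ξ g ∈ S := fun g =>
    Submodule.le_topologicalClosure _ (Submodule.subset_span (Or.inl ⟨g, rfl⟩))
  have hηS : ∀ g, η g ∈ S := fun g =>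
    Submodule.le_topologicalClosure _ (Submodule.subset_span (Or.inr ⟨g, rfl⟩))
  obtain ⟨ι, ⟨V⟩⟩ := exists_linearIsometryEquiv_type S
  refine ⟨lp (fun _ : ι => ℂ) 2, inferInstance, inferInstance, inferInstance,
    V.toHomeomorph.surjective.denseRange.separableSpace V.continuous, fun g => V ⟨ξ g, hξS g⟩,
    fun g => V ⟨η g, hηS g⟩, V.continuous.comp (hξ.subtype_mk _),
    V.continuous.comp (hη.subtype_mk _), fun g => ?_, fun g => ?_, fun g h => ?_⟩
  · simpa using hξc g
  · simpa using hηc g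
  · rw [V.inner_map_map, hu]; rfl

theorem HasSchurRep.continuous {u : G → ℂ} {c : ℝ} (h : HasSchurRep u c) : Continuous u := by
  obtain ⟨E, _, _, _, _, ξ, η, hξ, hη, -, -, hu⟩ := h
  have : u = fun g => inner ℂ (η 1) (ξ g) := by
    funext g; simpa using hu g 1
  rw [this]
  exact continuous_const.inner hξ

theorem HasSchurRep.norm_le {u : G → ℂ} {c : ℝ} (h : HasSchurRep u c) (g : G) : ‖u g‖ ≤ c := by
  obtain ⟨E, _, _, _, _, ξ, η, hξ, hη, hξc, hηc, hu⟩ := h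
  have h1 : u g = inner ℂ (η 1) (ξ g) := by simpa using hu g 1
  rw [h1]
  refine (norm_inner_le_norm _ _).trans ?_
  nlinarith [hξc g, hηc 1, sq_nonneg (‖η 1‖ - ‖ξ g‖)]

theorem HasSchurRep.mono {u : G → ℂ} {c d : ℝ} (h : HasSchurRep u c) (hcd : c ≤ d) :
    HasSchurRep u d := by
  obtain ⟨E, i1, i2, i3, i4, ξ, η, hξ, hη, hξc, hηc, hu⟩ := h
  exact ⟨E, i1, i2, i3, i4, ξ, η, hξ, hη, fun g => (hξc g).trans hcd,
    fun g => (hηc g).trans hcd, hu⟩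

theorem HasSchurRep.isHerzSchurMultiplier {u : G → ℂ} {c : ℝ} (h : HasSchurRep u c) :
    IsHerzSchurMultiplier u ∧ herzSchurNorm u ≤ ENNReal.ofReal c := by
  have hcont := h.continuous
  obtain ⟨E, i1, i2, i3, i4, ξ, η, hξ, hη, hξc, hηc, hu⟩ := h
  have hc : 0 ≤ c := (sq_nonneg _).trans (hξc 1)
  have hξ' : ∀ g, ‖ξ g‖ ≤ √c := fun g => Real.le_sqrt_of_sq_le (hξc g)
  have hη' : ∀ g, ‖η g‖ ≤ √c := fun g => Real.le_sqrt_of_sq_le (hηc g)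
  let ξ' : G →ᵇ E := BoundedContinuousFunction.ofNormedAddCommGroup ξ hξ (√c) hξ'
  let η' : G →ᵇ E := BoundedContinuousFunction.ofNormedAddCommGroup η hη (√c) hη'
  have hmem : ‖ξ'‖ * ‖η'‖ ∈ herzSchurBounds u := ⟨E, i1, i2, i3, i4, ξ', η', hu, rfl⟩
  refine ⟨⟨hcont, ⟨_, hmem⟩⟩, (iInf₂_le _ hmem).trans (ENNReal.ofReal_le_ofReal ?_)⟩
  calc ‖ξ'‖ * ‖η'‖ ≤ √c * √c := by
        gcongr
        · exact BoundedContinuousFunction.norm_ofNormedAddCommGroup_le _ (Real.sqrt_nonneg _) _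
        · exact BoundedContinuousFunction.norm_ofNormedAddCommGroup_le _ (Real.sqrt_nonneg _) _
    _ = c := Real.mul_self_sqrt hc

/-- A representation with `‖ξ g‖² ≤ a²` and `‖η g‖² ≤ b²` can be rescaled. -/
theorem HasSchurRep.of_mul_le [TopologicalSpace.SeparableSpace G] {u : G → ℂ} {a b c : ℝ}
    {E : Type*} [NormedAddCommGroup E] [InnerProductSpace ℂ E] [CompleteSpace E] {ξ η : G → E}
    (hξ : Continuous ξ) (hη : Continuous η) (hξa : ∀ g, ‖ξ g‖ ≤ a) (hηb : ∀ g, ‖η g‖ ≤ b)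
    (hu : ∀ g h : G, u (h⁻¹ * g) = inner ℂ (η h) (ξ g)) (hc : a * b < c) : HasSchurRep u c := by
  have ha : 0 ≤ a := (norm_nonneg _).trans (hξa 1)
  have hb : 0 ≤ b := (norm_nonneg _).trans (hηb 1)
  -- Since a may be 0, it is enlarged to a positive number that can be divided by; the strict
  -- inequality in `hc` leaves room for this.
  obtain ⟨a', ha', h'⟩ : ∃ a' > a, a' * b ≤ c := by
    have : ∀ᶠ x in 𝓝[>] a, x * b < c :=
      (((continuous_id.mul continuous_const).tendsto a).eventually (gt_mem_nhds hc)).filter_mono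
        nhdsWithin_le_nhds
    obtain ⟨x, hx, hx'⟩ := (this.and self_mem_nhdsWithin).exists
    exact ⟨x, hx', hx.le⟩
  have ha0 : 0 < a' := ha.trans_lt ha'
  have hc0 : 0 < c := (mul_nonneg ha hb).trans_lt hc
  set r : ℝ := √c / a' with hr
  have hr0 : 0 < r := by positivity
  refine HasSchurRep.of_inner (ξ := fun g => (r : ℂ) • ξ g) (η := fun g => ((r⁻¹ : ℝ) : ℂ) • η g)
    (continuous_const.smul hξ) (continuous_const.smul hη) (fun g => ?_) (fun g => ?_)
    (fun g h => ?_)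
  · rw [norm_smul, Complex.norm_real, Real.norm_of_nonneg hr0.le]
    calc (r * ‖ξ g‖) ^ 2 ≤ (r * a') ^ 2 := by
          gcongr; exact (hξa g).trans ha'.le
      _ = c := by
          rw [hr, div_mul_cancel₀ _ ha0.ne', Real.sq_sqrt hc0.le]
  · rw [norm_smul, Complex.norm_real, Real.norm_of_nonneg (inv_pos.2 hr0).le]
    calc (r⁻¹ * ‖η g‖) ^ 2 ≤ (r⁻¹ * b) ^ 2 := by
          gcongr; exact hηb g
      _ = (a' * b) ^ 2 / c := by
          rw [hr, inv_div, div_mul_eq_mul_div, div_pow, Real.sq_sqrt hc0.le]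
      _ ≤ c ^ 2 / c := by gcongr
      _ = c := by field_simp
  · rw [inner_smul_left, inner_smul_right, hu, Complex.conj_ofReal, ← mul_assoc,
      ← Complex.ofReal_mul, inv_mul_cancel₀ hr0.ne', Complex.ofReal_one, one_mul]

/-- The infimum need not be attained, so a strict inequality is needed to select an actual
representation. -/
theorem hasSchurRep_of_herzSchurNorm_lt [TopologicalSpace.SeparableSpace G] {u : G → ℂ} {c : ℝ}
    (h : herzSchurNorm u < ENNReal.ofReal c) : HasSchurRep u c := by
  simp only [herzSchurNorm, iInf_lt_iff] at h
  obtain ⟨d, ⟨E, _, _, _, _, ξ, η, hu, rfl⟩, hd⟩ := h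
  have hd' : ‖ξ‖ * ‖η‖ < c := by
    by_contra hcon
    exact absurd hd (not_lt.2 (ENNReal.ofReal_le_ofReal (not_lt.1 hcon)))
  exact HasSchurRep.of_mul_le ξ.continuous η.continuous ξ.norm_coe_le_norm η.norm_coe_le_norm hu hd'

/-- In the Hilbert direct sum, squared norms add. This is why `HasSchurRep` bounds both squares by
the same constant. -/
theorem HasSchurRep.add [TopologicalSpace.SeparableSpace G] {u v : G → ℂ} {c d : ℝ}
    (hu : HasSchurRep u c) (hv : HasSchurRep v d) : HasSchurRep (fun g => u g + v g) (c + d) := by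
  obtain ⟨E, _, _, _, _, ξ, η, hξ, hη, hξc, hηc, hu⟩ := hu
  obtain ⟨E', _, _, _, _, ξ', η', hξ', hη', hξc', hηc', hu'⟩ := hv
  refine HasSchurRep.of_inner (E := WithLp 2 (E × E')) (ξ := fun g => WithLp.toLp 2 (ξ g, ξ' g))
    (η := fun g => WithLp.toLp 2 (η g, η' g)) ?_ ?_ (fun g => ?_) (fun g => ?_) (fun g h => ?_)
  · exact (WithLp.prod_continuous_toLp 2 E E').comp (hξ.prodMk hξ')
  · exact (WithLp.prod_continuous_toLp 2 E E').comp (hη.prodMk hη')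
  · rw [WithLp.prod_norm_sq_eq_of_L2]; exact add_le_add (hξc g) (hξc' g)
  · rw [WithLp.prod_norm_sq_eq_of_L2]; exact add_le_add (hηc g) (hηc' g)
  · simp [WithLp.prod_inner_apply, hu, hu']

theorem HasSchurRep.neg {u : G → ℂ} {c : ℝ} (h : HasSchurRep u c) :
    HasSchurRep (fun g => - u g) c := by
  obtain ⟨E, i1, i2, i3, i4, ξ, η, hξ, hη, hξc, hηc, hu⟩ := h
  exact ⟨E, i1, i2, i3, i4, fun g => - ξ g, η, hξ.neg, hη, by simpa using hξc, hηc,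
    fun g h => by simp [hu]⟩

end SchurRepresentations

/-! ### Positive definite functions and the GNS construction -/

section PositiveDefinite

universe u

variable {G : Type*} [Group G]

theorem IsPosDefFun.sum_finset_nonneg {u : G → ℂ} (hu : IsPosDefFun u) (s : Finset G)
    (c : G → ℂ) : 0 ≤ ∑ x ∈ s, ∑ y ∈ s, conj (c x) * c y * u (x⁻¹ * y) := by
  let e := s.equivFin.symm
  have h := hu s.card (fun i => e i) (fun i => c (e i))
  have key : ∀ F : G → ℂ, ∑ i, F (e i) = ∑ x ∈ s, F x := fun F => by
    rw [e.sum_comp (fun x : s => F x), Finset.sum_coe_sort s F]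
  rw [key (fun x => ∑ j, conj (c x) * c (e j) * u (x⁻¹ * (e j)))] at h
  convert h using 2 with x
  rw [key (fun y => conj (c x) * c y * u (x⁻¹ * y))]

/-- Positivity on the pair (1, g) with coefficients (1, 1) makes u(g) + u(g⁻¹) real; with
coefficients (1, i) it makes i(u(g) − u(g⁻¹)) real. -/
theorem IsPosDefFun.conj_eq {u : G → ℂ} (hu : IsPosDefFun u) (g : G) : conj (u g) = u g⁻¹ := by
  have h1 := hu 1 (fun _ => 1) (fun _ => 1)
  have h2 := hu 2 ![1, g] ![1, 1]
  have h3 := hu 2 ![1, g] ![1, Complex.I]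
  simp only [Complex.le_def, Fin.sum_univ_two, Fin.sum_univ_one, Matrix.cons_val_zero,
    Matrix.cons_val_one, map_one, inv_one, mul_one, one_mul, inv_mul_cancel, Complex.conj_I,
    Complex.add_im, Complex.zero_im, Complex.mul_im, Complex.I_re, Complex.I_im,
    Complex.neg_re, Complex.neg_im, Complex.mul_re] at h1 h2 h3
  apply Complex.ext
  · simp only [Complex.conj_re]; linarith [h1.2, h2.2, h3.2]
  · simp only [Complex.conj_im]; linarith [h1.2, h2.2, h3.2]

theorem isPosDefFun_of_inner {u : G → ℂ} {E : Type*} [NormedAddCommGroup E]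
    [InnerProductSpace ℂ E] {ξ : G → E} (h : ∀ g h : G, u (h⁻¹ * g) = inner ℂ (ξ h) (ξ g)) :
    IsPosDefFun u := by
  intro n g c
  have : ∑ i, ∑ j, conj (c i) * c j * u ((g i)⁻¹ * g j)
      = inner ℂ (∑ i, c i • ξ (g i)) (∑ j, c j • ξ (g j)) := by
    rw [sum_inner]
    refine Finset.sum_congr rfl fun i _ => ?_
    rw [inner_sum]
    refine Finset.sum_congr rfl fun j _ => ?_
    rw [inner_smul_left, inner_smul_right, h]
    ring
  rw [this, inner_self_eq_norm_sq_to_K]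
  exact pow_nonneg (RCLike.ofReal_nonneg.2 (norm_nonneg _)) 2

/-- The Gelfand–Naimark–Segal construction for continuous positive definite functions. -/
theorem IsPosDefFun.exists_inner {G : Type u} [Group G] [TopologicalSpace G]
    [IsTopologicalGroup G] {u : G → ℂ} (hu : IsPosDefFun u) (hc : Continuous u) :
    ∃ (E : Type u) (_ : NormedAddCommGroup E) (_ : InnerProductSpace ℂ E) (_ : CompleteSpace E)
      (ξ : G → E), Continuous ξ ∧ ∀ g h : G, u (h⁻¹ * g) = inner ℂ (ξ h) (ξ g) := by
  -- The GNS space is realized as the reproducing kernel Hilbert space of the kernel u(g⁻¹h), and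
  -- the orbit of the cyclic vector as its kernel functions.
  let K : Matrix G G (ℂ →L[ℂ] ℂ) := .of fun g h => u (g⁻¹ * h) • ContinuousLinearMap.id ℂ ℂ
  have hK : K.PosSemidef := by
    have htfae := (RKHS.posSemidef_tfae (K := K)).out 0 2
    refine htfae.2 ⟨?_, fun v => ?_⟩
    · ext g h
      refine ext_inner_right ℂ fun w => ?_
      simp [K, ContinuousLinearMap.star_eq_adjoint, ContinuousLinearMap.adjoint_id,
        hu.conj_eq]
    · have h := hu.sum_finset_nonneg v.support v
      have h' := (Complex.le_def.1 h).1
      rw [Complex.zero_re] at h'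
      refine h'.trans_eq ?_
      rw [Finsupp.sum]
      simp only [Finsupp.sum]
      refine congrArg Complex.re (Finset.sum_congr rfl fun x _ => Finset.sum_congr rfl fun y _ => ?_)
      simp [K, hu.conj_eq]
      ring
  have : Fact K.PosSemidef := ⟨hK⟩
  let ξ : G → RKHS.OfKernel K := fun g => RKHS.kerFun (RKHS.OfKernel K) g (1 : ℂ)
  have hξ : ∀ g h : G, u (h⁻¹ * g) = inner ℂ (ξ h) (ξ g) := fun g h => by
    have := RKHS.kernel_inner (H := RKHS.OfKernel K) g h (1 : ℂ) (1 : ℂ)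
    rw [← this, RKHS.OfKernel.kernel_ofKernel]
    simp [K, hu.conj_eq]
  refine ⟨RKHS.OfKernel K, inferInstance, inferInstance, inferInstance, ξ, ?_, hξ⟩
  rw [continuous_iff_continuousAt]
  intro g
  rw [ContinuousAt, tendsto_iff_norm_sub_tendsto_zero]
  -- Norm continuity of ξ reduces to continuity of u at the identity.
  have hsq : ∀ h, ‖ξ h - ξ g‖ = √(2 * (u 1).re - 2 * (u (h⁻¹ * g)).re) := fun h => by
    rw [← Real.sqrt_sq (norm_nonneg (ξ h - ξ g)), @norm_sub_sq ℂ, ← hξ,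
      ← inner_self_eq_norm_sq (𝕜 := ℂ), ← inner_self_eq_norm_sq (𝕜 := ℂ) (ξ g), ← hξ, ← hξ]
    simp
    ring_nf
  simp only [hsq]
  have : Tendsto (fun h => √(2 * (u 1).re - 2 * (u (h⁻¹ * g)).re)) (𝓝 g)
      (𝓝 √(2 * (u 1).re - 2 * (u (g⁻¹ * g)).re)) := by
    apply Continuous.tendsto
    fun_prop
  simpa using this

end PositiveDefinite

/-! ### Compactly supported approximation in the Fourier algebra -/

section FourierAlgebra

variable {G : Type*} [Group G] [TopologicalSpace G] [IsTopologicalGroup G] [LocallyCompactSpace G]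
  [SecondCountableTopology G] [MeasurableSpace G] [BorelSpace G]

/-- The coefficient function `g ↦ ⟨λ(g)ξ | η⟩` of the left regular representation. -/
def regularCoeff (ξ η : G → ℂ) (g : G) : ℂ :=
  ∫ t, ξ (g⁻¹ * t) * conj (η t) ∂(Measure.haar : Measure G)

/-- The left regular representation is isometric and strongly continuous, so the translates of ξ and
η form a representation. -/
theorem HasSchurRep.regularCoeff {ξ η : G → ℂ} (hξ : MemLp ξ 2 (Measure.haar : Measure G))
    (hη : MemLp η 2 (Measure.haar : Measure G)) {c : ℝ}
    (hc : (eLpNorm ξ 2 Measure.haar).toReal * (eLpNorm η 2 Measure.haar).toReal < c) :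
    HasSchurRep (regularCoeff ξ η) c := by
  have : Fact ((2 : ℝ≥0∞) ≠ ∞) := ⟨by norm_num⟩
  -- `DomMulAct` acts by precomposition, so the inverse is what gives f(g⁻¹t).
  let lam : Lp ℂ 2 (Measure.haar : Measure G) → G → Lp ℂ 2 (Measure.haar : Measure G) :=
    fun f g => DomMulAct.mk g⁻¹ • f
  have hlam : ∀ f, Continuous (lam f) := fun f =>
    (DomMulAct.continuous_mk.comp continuous_inv).smul continuous_const
  have hval : ∀ f (hf : MemLp f 2 (Measure.haar : Measure G)) g,
      lam (hf.toLp f) g =ᵐ[Measure.haar] fun t => f (g⁻¹ * t) := fun f hf g => by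
    refine (DomMulAct.smul_Lp_ae_eq _ _).trans ?_
    exact (measurePreserving_mul_left Measure.haar g⁻¹).quasiMeasurePreserving.ae_eq_comp
      hf.coeFn_toLp
  refine HasSchurRep.of_mul_le (hlam (hξ.toLp ξ)) (hlam (hη.toLp η)) (fun g => ?_) (fun g => ?_)
    (fun g h => ?_) hc
  · rw [DomMulAct.norm_smul_Lp, Lp.norm_toLp]
  · rw [DomMulAct.norm_smul_Lp, Lp.norm_toLp]
  · rw [L2.inner_def, ProperCocycle.regularCoeff,
      ← integral_mul_left_eq_self _ h⁻¹]
    refine integral_congr_ae ?_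
    filter_upwards [hval ξ hξ g, hval η hη h] with t h1 h2
    simp [h1, h2, mul_assoc]

theorem hasCompactSupport_regularCoeff {ξ η : G → ℂ} (hξ : HasCompactSupport ξ)
    (hη : HasCompactSupport η) : HasCompactSupport (regularCoeff ξ η) := by
  refine HasCompactSupport.intro (hη.isCompact.mul hξ.isCompact.inv) fun g hg => ?_
  rw [regularCoeff]
  refine integral_eq_zero_of_ae (Eventually.of_forall fun t => ?_)
  by_contra hne
  have hne' := mul_ne_zero_iff.1 hne
  refine hg (Set.mem_mul.2 ⟨t, subset_tsupport _ fun h0 => hne'.2 (by simp [h0]), t⁻¹ * g, ?_,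
    by simp⟩)
  rw [Set.mem_inv]
  simpa using subset_tsupport _ (Function.mem_support.2 hne'.1)

theorem regularCoeff_sub_sub {ξ η ξ' η' : G → ℂ} (hξ : MemLp ξ 2 (Measure.haar : Measure G))
    (hη : MemLp η 2 (Measure.haar : Measure G)) (hξ' : MemLp ξ' 2 (Measure.haar : Measure G))
    (hη' : MemLp η' 2 (Measure.haar : Measure G)) (g : G) :
    regularCoeff ξ η g - regularCoeff ξ' η' g
      = regularCoeff (ξ - ξ') η g + regularCoeff ξ' (η - η') g := by
  have int : ∀ {a b : G → ℂ}, MemLp a 2 (Measure.haar : Measure G) →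
      MemLp b 2 (Measure.haar : Measure G) →
      Integrable (fun t => a (g⁻¹ * t) * conj (b t)) (Measure.haar : Measure G) := by
    intro a b ha hb
    have ha' : MemLp (fun t => a (g⁻¹ * t)) 2 (Measure.haar : Measure G) :=
      ha.comp_measurePreserving (measurePreserving_mul_left Measure.haar g⁻¹)
    exact ha'.integrable_mul hb.star
  simp only [regularCoeff]
  rw [← integral_sub (int hξ hη) (int hξ' hη'), ← integral_add (int (hξ.sub hξ') hη)
    (int hξ' (hη.sub hη'))]
  congr 1
  funext t
  simp
  ring

/-- Elements of the Fourier algebra are approximated, in the norm of `B₂(G)`, by compactly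
supported ones. -/
theorem IsFourierAlgebra.exists_hasCompactSupport {u : G → ℂ} (hu : IsFourierAlgebra u)
    {c δ : ℝ} (hδ : 0 < δ) (hc : HasSchurRep u c) :
    ∃ v : G → ℂ, HasCompactSupport v ∧ HasSchurRep v (c + δ) ∧ ∀ g, ‖v g - u g‖ ≤ δ := by
  obtain ⟨ξ, η, hξ, hη, huv⟩ := hu
  set a := (eLpNorm ξ 2 (Measure.haar : Measure G)).toReal
  set b := (eLpNorm η 2 (Measure.haar : Measure G)).toReal
  have ha : 0 ≤ a := ENNReal.toReal_nonneg
  have hb : 0 ≤ b := ENNReal.toReal_nonneg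
  -- Both error terms, at most r·b and (a + r)·r, must be below δ/2; the cap at 1 gives a + r ≤ a +
  -- 1.
  set r := min 1 (δ / (4 * (a + b + 1)))
  have hr : 0 < r := by positivity
  have hr1 : r ≤ 1 := min_le_left _ _
  have hr2 : r * (4 * (a + b + 1)) ≤ δ := by
    rw [← le_div_iff₀ (by positivity)]; exact min_le_right _ _
  obtain ⟨ξ', hξs, hξd, hξc, hξ'⟩ := hξ.exists_hasCompactSupport_eLpNorm_sub_le (by norm_num)
    (ENNReal.ofReal_pos.2 hr).ne'
  obtain ⟨η', hηs, hηd, hηc, hη'⟩ := hη.exists_hasCompactSupport_eLpNorm_sub_le (by norm_num)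
    (ENNReal.ofReal_pos.2 hr).ne'
  have e1 : (eLpNorm (ξ - ξ') 2 (Measure.haar : Measure G)).toReal ≤ r :=
    ENNReal.toReal_le_of_le_ofReal hr.le hξd
  have e2 : (eLpNorm (η - η') 2 (Measure.haar : Measure G)).toReal ≤ r :=
    ENNReal.toReal_le_of_le_ofReal hr.le hηd
  have e3 : (eLpNorm ξ' 2 (Measure.haar : Measure G)).toReal ≤ a + r := by
    have h : eLpNorm ξ' 2 (Measure.haar : Measure G)
        ≤ eLpNorm ξ 2 Measure.haar + eLpNorm (ξ - ξ') 2 Measure.haar := by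
      simpa using eLpNorm_sub_le hξ.1 (hξ.sub hξ').1 (by norm_num : (1 : ℝ≥0∞) ≤ 2)
    refine (ENNReal.toReal_mono (ENNReal.add_ne_top.2 ⟨hξ.2.ne, (hξ.sub hξ').2.ne⟩) h).trans ?_
    rw [ENNReal.toReal_add hξ.2.ne (hξ.sub hξ').2.ne]
    gcongr
  have h1 : HasSchurRep (regularCoeff (ξ - ξ') η) (δ / 2) := by
    refine HasSchurRep.regularCoeff (hξ.sub hξ') hη ?_
    calc _ ≤ r * b := by gcongr
      _ < δ / 2 := by nlinarith
  have h2 : HasSchurRep (regularCoeff ξ' (η - η')) (δ / 2) := by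
    refine HasSchurRep.regularCoeff hξ' (hη.sub hη') ?_
    calc _ ≤ (a + r) * r := by gcongr
      _ < δ / 2 := by nlinarith
  have hd := (h1.add h2).neg
  rw [add_halves] at hd
  -- Only the difference is estimated through L²-norms. The function u keeps its given
  -- representation, since the product of the L²-norms of ξ and η may exceed c.
  have heq : regularCoeff ξ' η'
      = fun g => u g + -(regularCoeff (ξ - ξ') η g + regularCoeff ξ' (η - η') g) := by
    funext g
    rw [← regularCoeff_sub_sub hξ hη hξ' hη', huv g]
    simp [regularCoeff]
  refine ⟨regularCoeff ξ' η', hasCompactSupport_regularCoeff hξs hηs, ?_, fun g => ?_⟩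
  · rw [heq]; exact hc.add hd
  · have := hd.norm_le g
    rw [heq]; simpa using this

end FourierAlgebra

/-! ### Continuity of translation in L¹(G) -/

section Translation

open scoped Pointwise

variable {G : Type*} [Group G] [TopologicalSpace G] [IsTopologicalGroup G] [LocallyCompactSpace G]
  [SecondCountableTopology G] [MeasurableSpace G] [BorelSpace G]

/-- For s in a compact neighbourhood of 1, all integrands live in one compact set, so the integral
is continuous in s. -/
theorem tendsto_integral_abs_translate_sub {θ : G → ℝ} (hθ : Continuous θ)
    (hs : HasCompactSupport θ) :
    Tendsto (fun s : G => ∫ l, |θ (s * l) - θ l| ∂(Measure.haar : Measure G)) (𝓝 1) (𝓝 0) := by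
  obtain ⟨V, hV, hV1⟩ := exists_compact_mem_nhds (1 : G)
  have hc : ContinuousOn (fun s : G => ∫ l, |θ (s * l) - θ l| ∂(Measure.haar : Measure G)) V := by
    refine continuousOn_integral_of_compact_support
      (k := V⁻¹ * tsupport θ ∪ tsupport θ) ((hV.inv.mul hs.isCompact).union hs.isCompact) ?_ ?_
    · apply Continuous.continuousOn
      simp only [Function.uncurry_def]
      fun_prop
    · intro s l hsV hl
      have h1 : θ l = 0 := image_eq_zero_of_notMem_tsupport fun h => hl (Or.inr h)
      have h2 : θ (s * l) = 0 := image_eq_zero_of_notMem_tsupport fun h =>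
        hl (Or.inl ⟨s⁻¹, Set.inv_mem_inv.2 hsV, s * l, h, by simp⟩)
      simp [h1, h2]
  have := (hc.continuousAt hV1).tendsto
  simpa using this

theorem integral_abs_translate_sub_translate (θ : G → ℝ) (s t : G) :
    ∫ l, |θ (s * l) - θ (t * l)| ∂(Measure.haar : Measure G)
      = ∫ l, |θ (s * t⁻¹ * l) - θ l| ∂(Measure.haar : Measure G) := by
  rw [← integral_mul_left_eq_self _ t⁻¹]
  simp [mul_assoc]

theorem eventually_integral_abs_translate_sub_lt {θ : G → ℝ} (hθ : Continuous θ)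
    (hs : HasCompactSupport θ) (t : G) {ε : ℝ} (hε : 0 < ε) :
    ∀ᶠ s in 𝓝 t, ∫ l, |θ (s * l) - θ (t * l)| ∂(Measure.haar : Measure G) < ε := by
  have h1 : Tendsto (fun s : G => s * t⁻¹) (𝓝 t) (𝓝 1) := by
    have : Continuous (fun s : G => s * t⁻¹) := by fun_prop
    simpa using this.tendsto t
  have := ((tendsto_integral_abs_translate_sub hθ hs).comp h1).eventually (gt_mem_nhds hε)
  filter_upwards [this] with s hs
  rw [integral_abs_translate_sub_translate]
  exact hs

/-- Continuous compactly supported probability densities concentrated near the identity. -/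
theorem exists_density_near_one {V : Set G} (hV : V ∈ 𝓝 (1 : G)) :
    ∃ κ : G → ℝ, Continuous κ ∧ HasCompactSupport κ ∧ (∀ k, 0 ≤ κ k) ∧
      ∫ k, κ k ∂(Measure.haar : Measure G) = 1 ∧ ∀ k, κ k ≠ 0 → k ∈ V := by
  obtain ⟨f, hf1, hf0, hfs, hf⟩ := exists_continuous_one_zero_of_isCompact
    (isCompact_singleton (x := (1 : G))) (isOpen_interior (s := V)).isClosed_compl
    (Set.disjoint_singleton_left.2 fun h => h (mem_interior_iff_mem_nhds.2 hV))
  have hpos : 0 < ∫ k, f k ∂(Measure.haar : Measure G) :=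
    f.continuous.integral_pos_of_hasCompactSupport_nonneg_nonzero hfs (fun k => (hf k).1)
      (x := 1) (by rw [hf1 rfl]; exact one_ne_zero)
  refine ⟨fun k => (∫ k, f k ∂(Measure.haar : Measure G))⁻¹ * f k, by fun_prop,
    hfs.mul_left, fun k => mul_nonneg (inv_pos.2 hpos).le (hf k).1, ?_, fun k hk => ?_⟩
  · rw [integral_const_mul, inv_mul_cancel₀ hpos.ne']
  · by_contra hkV
    have h0 : f k = 0 := hf0 fun h => hkV (interior_subset h)
    exact hk (by simp [h0])

end Translation

/-! ### Invariant means on bounded measurable functions -/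

section InvariantMeans

variable {G X : Type*} [Group G] [MulAction G X] [MeasurableSpace X]

/-- Bounded measurable real functions. -/
def IsBddMeasurable (f : X → ℝ) : Prop := Measurable f ∧ ∃ C, ∀ x, |f x| ≤ C

theorem IsBddMeasurable.add {f g : X → ℝ} (hf : IsBddMeasurable f) (hg : IsBddMeasurable g) :
    IsBddMeasurable (fun x => f x + g x) := by
  obtain ⟨hf, C, hC⟩ := hf
  obtain ⟨hg, D, hD⟩ := hg
  exact ⟨hf.add hg, C + D, fun _ => (abs_add_le _ _).trans (add_le_add (hC _) (hD _))⟩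

theorem IsBddMeasurable.const_mul {f : X → ℝ} (hf : IsBddMeasurable f) (c : ℝ) :
    IsBddMeasurable (fun x => c * f x) := by
  obtain ⟨hf, C, hC⟩ := hf
  exact ⟨hf.const_mul c, |c| * C, fun x => by
    rw [abs_mul]; exact mul_le_mul_of_nonneg_left (hC x) (abs_nonneg c)⟩

theorem isBddMeasurable_const (c : ℝ) : IsBddMeasurable (fun _ : X => c) :=
  ⟨measurable_const, |c|, fun _ => le_rfl⟩

theorem IsBddMeasurable.translate [MeasurableSpace G] [MeasurableSMul G X] {f : X → ℝ}
    (hf : IsBddMeasurable f) (g : G) : IsBddMeasurable (fun x => f (g • x)) :=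
  ⟨hf.1.comp (measurable_const_smul g), hf.2.imp fun _ h _ => h _⟩

/-- A `G`-invariant mean on the bounded measurable functions modulo `μ`-null sets. -/
structure InvariantMean (G : Type*) {X : Type*} [Group G] [MulAction G X] [MeasurableSpace X]
    (μ : Measure X) where
  /-- The mean of a bounded measurable function. -/
  toFun : (X → ℝ) → ℝ
  map_add : ∀ {f g : X → ℝ}, IsBddMeasurable f → IsBddMeasurable g →
    toFun (fun x => f x + g x) = toFun f + toFun g
  map_const_mul : ∀ {f : X → ℝ} (c : ℝ), IsBddMeasurable f →
    toFun (fun x => c * f x) = c * toFun f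
  mono : ∀ {f g : X → ℝ}, IsBddMeasurable f → IsBddMeasurable g → f ≤ᵐ[μ] g → toFun f ≤ toFun g
  map_const : ∀ c : ℝ, toFun (fun _ => c) = c
  map_translate : ∀ (g : G) {f : X → ℝ}, IsBddMeasurable f → toFun (fun x => f (g • x)) = toFun f

theorem quasiMeasurePreserving_smul [MeasurableSpace G] [MeasurableSMul G X] {μ : Measure X}
    (hμ : IsMeasureClassPreserving G μ) (g : G) :
    Measure.QuasiMeasurePreserving (fun x : X => g • x) μ μ :=
  ⟨measurable_const_smul g, (hμ g).1⟩

theorem IsAmenablePair.nonempty_invariantMean [MeasurableSpace G] [MeasurableSMul G X]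
    {μ : Measure X} (hμ : IsMeasureClassPreserving G μ) (h : IsAmenablePair G μ) :
    Nonempty (InvariantMean G μ) := by
  classical
  obtain ⟨m, hpos, hone, hinv⟩ := h
  have hmem : ∀ {f : X → ℝ}, IsBddMeasurable f → MemLp (fun x => (f x : ℂ)) ∞ μ := by
    rintro f ⟨hf, C, hC⟩
    exact memLp_top_of_bound (Complex.measurable_ofReal.comp hf).aestronglyMeasurable C
      (Eventually.of_forall fun x => by simpa using hC x)
  let M : (X → ℝ) → ℝ := fun f => if hf : IsBddMeasurable f then (m ((hmem hf).toLp _)).re else 0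
  have hM : ∀ {f : X → ℝ} (hf : IsBddMeasurable f), M f = (m ((hmem hf).toLp _)).re :=
    fun hf => dif_pos hf
  have hadd : ∀ {f g : X → ℝ}, IsBddMeasurable f → IsBddMeasurable g →
      M (fun x => f x + g x) = M f + M g := by
    intro f g hf hg
    rw [hM hf, hM hg, hM (hf.add hg), ← Complex.add_re, ← _root_.map_add, ← MemLp.toLp_add]
    simp only [Complex.ofReal_add]
    rfl
  have hsmul : ∀ {f : X → ℝ} (c : ℝ), IsBddMeasurable f → M (fun x => c * f x) = c * M f := by
    intro f c hf
    rw [hM hf, hM (hf.const_mul c), ← Complex.re_ofReal_mul, ← smul_eq_mul (c : ℂ),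
      ← _root_.map_smul, ← MemLp.toLp_const_smul]
    simp only [Complex.ofReal_mul]
    rfl
  refine ⟨M, hadd, hsmul, ?_, ?_, ?_⟩
  · intro f g hf hg hfg
    have hd := hg.add (hf.const_mul (-1))
    have h0 : 0 ≤ M (fun x => g x + -1 * f x) := by
      rw [hM hd]
      refine (Complex.le_def.1 (hpos _ ?_)).1
      filter_upwards [(hmem hd).coeFn_toLp, hfg] with x hx hx'
      rw [hx, Complex.zero_le_real]
      linarith
    rw [hadd hg (hf.const_mul (-1)), hsmul (-1) hf] at h0
    linarith
  · intro c
    have h1 : M (fun _ => 1) = 1 := by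
      rw [hM (isBddMeasurable_const 1), hone]
      · rfl
      · filter_upwards [(hmem (isBddMeasurable_const 1)).coeFn_toLp] with x hx
        rw [hx]; simp
    have := hsmul c (isBddMeasurable_const (X := X) 1)
    simpa [h1] using this
  · intro g f hf
    rw [hM hf, hM (hf.translate g)]
    congr 1
    refine hinv g⁻¹ _ _ ?_
    filter_upwards [(hmem (hf.translate g)).coeFn_toLp,
      (quasiMeasurePreserving_smul hμ g).ae_eq_comp (hmem hf).coeFn_toLp] with x h1 h2
    rw [h1, inv_inv]
    exact h2.symm

namespace InvariantMean

variable {μ : Measure X} (M : InvariantMean G μ)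

/-- Positivity and normalization make a mean 1-Lipschitz for the supremum norm. -/
theorem abs_sub_le {f g : X → ℝ} (hf : IsBddMeasurable f) (hg : IsBddMeasurable g) {c : ℝ}
    (h : ∀ x, |f x - g x| ≤ c) : |M.toFun f - M.toFun g| ≤ c := by
  have h1 := M.mono hf (hg.add (isBddMeasurable_const c))
    (Eventually.of_forall fun x => by linarith [(abs_le.1 (h x)).2])
  have h2 := M.mono hg (hf.add (isBddMeasurable_const c))
    (Eventually.of_forall fun x => by linarith [(abs_le.1 (h x)).1])
  rw [M.map_add hg (isBddMeasurable_const c), M.map_const] at h1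
  rw [M.map_add hf (isBddMeasurable_const c), M.map_const] at h2
  rw [abs_le]
  constructor <;> linarith

theorem map_sum {ι : Type*} (s : Finset ι) {f : ι → X → ℝ} (hf : ∀ i, IsBddMeasurable (f i)) :
    IsBddMeasurable (fun x => ∑ i ∈ s, f i x) ∧
      M.toFun (fun x => ∑ i ∈ s, f i x) = ∑ i ∈ s, M.toFun (f i) := by
  classical
  induction s using Finset.induction_on with
  | empty => simpa using ⟨isBddMeasurable_const 0, M.map_const 0⟩
  | insert a s ha ih =>
    simp only [Finset.sum_insert ha]
    exact ⟨(hf a).add ih.1, by rw [M.map_add (hf a) ih.1, ih.2]⟩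

end InvariantMean

end InvariantMeans

/-! ### Topological invariance of invariant means -/

section Averages

variable {G X : Type*} [Group G] [TopologicalSpace G] [IsTopologicalGroup G] [LocallyCompactSpace G]
  [SecondCountableTopology G] [MeasurableSpace G] [BorelSpace G]
  [MulAction G X] [MeasurableSpace X] [MeasurableSMul₂ G X]

/-- The average `x ↦ ∫ θ(k) w(k x) dk` of translates of `w`. -/
def orbitAverage (θ : G → ℝ) (w : X → ℝ) (x : X) : ℝ :=
  ∫ k, θ k * w (k • x) ∂(Measure.haar : Measure G)

theorem IsBddMeasurable.integrable_mul_smul {w : X → ℝ} (hw : IsBddMeasurable w) {θ : G → ℝ}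
    (hθ : Integrable θ (Measure.haar : Measure G)) (x : X) :
    Integrable (fun k => θ k * w (k • x)) (Measure.haar : Measure G) := by
  obtain ⟨hm, C, hC⟩ := hw
  exact hθ.mul_bdd (hm.comp (measurable_smul_const x)).aestronglyMeasurable
    (Eventually.of_forall fun k => hC _)

theorem abs_integral_mul_le {Y : Type*} [MeasurableSpace Y] {ν : Measure Y} {θ w : Y → ℝ} {C : ℝ}
    (hθ : Integrable θ ν) (hw : ∀ y, |w y| ≤ C) : |∫ y, θ y * w y ∂ν| ≤ (∫ y, |θ y| ∂ν) * C := by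
  rw [← integral_mul_const]
  refine (abs_integral_le_integral_abs).trans ?_
  refine integral_mono_of_nonneg (Eventually.of_forall fun y => abs_nonneg _)
    (hθ.abs.mul_const C) (Eventually.of_forall fun y => ?_)
  simp only [abs_mul]
  exact mul_le_mul_of_nonneg_left (hw y) (abs_nonneg _)

theorem abs_orbitAverage_le {θ : G → ℝ} (hθ : Integrable θ (Measure.haar : Measure G)) {w : X → ℝ}
    {C : ℝ} (hC : ∀ x, |w x| ≤ C) (x : X) :
    |orbitAverage θ w x| ≤ (∫ k, |θ k| ∂(Measure.haar : Measure G)) * C :=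
  abs_integral_mul_le hθ fun _ => hC _

theorem isBddMeasurable_orbitAverage {θ : G → ℝ} (hθm : Measurable θ)
    (hθ : Integrable θ (Measure.haar : Measure G)) {w : X → ℝ} (hw : IsBddMeasurable w) :
    IsBddMeasurable (orbitAverage θ w) := by
  refine ⟨?_, ?_⟩
  · have : Measurable fun p : X × G => θ p.2 * w (p.2 • p.1) :=
      (hθm.comp measurable_snd).mul (hw.1.comp (measurable_snd.smul measurable_fst))
    exact (this.stronglyMeasurable.integral_prod_right
      (ν := (Measure.haar : Measure G))).measurable
  · obtain ⟨C, hC⟩ := hw.2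
    exact ⟨_, abs_orbitAverage_le hθ hC⟩

variable {μ : Measure X} (M : InvariantMean G μ)

/-- An invariant mean commutes with averaging over translates that depend continuously, in the
supremum norm, on the group element. -/
theorem InvariantMean.map_orbitAverage_of_continuous {B : X → ℝ} (hB : IsBddMeasurable B)
    (hcont : ∀ ε : ℝ, 0 < ε → ∀ t : G, ∀ᶠ l in 𝓝 t, ∀ x, |B (l • x) - B (t • x)| ≤ ε)
    {θ : G → ℝ} (hθ : Continuous θ) (hs : HasCompactSupport θ) :
    M.toFun (orbitAverage θ B) = (∫ k, θ k ∂(Measure.haar : Measure G)) * M.toFun B := by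
  -- The integral is localized by compact induction on the support. Near t, the translates of B are
  -- uniformly close to B(t·), whose mean is that of B. Weights are merely measurable and vanish off
  -- T, because gluing two pieces cuts the weight by indicators.
  have key : ∀ ε : ℝ, 0 < ε → ∃ T : Set G, MeasurableSet T ∧ tsupport θ ⊆ T ∧
      ∀ ψ : G → ℝ, Measurable ψ → Integrable ψ (Measure.haar : Measure G) → (∀ k ∉ T, ψ k = 0) →
      |M.toFun (orbitAverage ψ B) - (∫ k, ψ k ∂(Measure.haar : Measure G)) * M.toFun B|
        ≤ (∫ k, |ψ k| ∂(Measure.haar : Measure G)) * ε := by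
    intro ε hε
    refine hs.isCompact.induction_on (p := fun S => ∃ T : Set G, MeasurableSet T ∧ S ⊆ T ∧
      ∀ ψ : G → ℝ, Measurable ψ → Integrable ψ (Measure.haar : Measure G) → (∀ k ∉ T, ψ k = 0) →
      |M.toFun (orbitAverage ψ B) - (∫ k, ψ k ∂(Measure.haar : Measure G)) * M.toFun B|
        ≤ (∫ k, |ψ k| ∂(Measure.haar : Measure G)) * ε) ?_ ?_ ?_ ?_
    · refine ⟨∅, MeasurableSet.empty, le_rfl, fun ψ _ _ h0 => ?_⟩
      have : ψ = fun _ => 0 := funext fun k => h0 k (Set.notMem_empty k)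
      have h2 : orbitAverage ψ B = fun _ => 0 := by
        funext x; simp [orbitAverage, this]
      rw [h2, M.map_const, this]
      simp
    · rintro s t hst ⟨T, hT, htT, h⟩
      exact ⟨T, hT, hst.trans htT, h⟩
    · rintro s s' ⟨T, hT, hsT, h⟩ ⟨T', hT', hsT', h'⟩
      refine ⟨T ∪ T', hT.union hT', Set.union_subset_union hsT hsT', fun ψ hψm hψ h0 => ?_⟩
      have i1 := hψ.indicator hT
      have i2 := hψ.indicator hT.compl
      have m1 := hψm.indicator hT
      have m2 := hψm.indicator hT.compl
      have e1 := h _ m1 i1 fun k hk => Set.indicator_of_notMem hk _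
      have e2 := h' _ m2 i2 fun k hk => by
        by_cases hkT : k ∈ T
        · exact Set.indicator_of_notMem (by simpa using hkT) _
        · rw [Set.indicator_of_mem (by simpa using hkT)]
          exact h0 k (by simp [hkT, hk])
      have hsplit : ∀ k, ψ k = T.indicator ψ k + Tᶜ.indicator ψ k := fun k =>
        (congrFun (Set.indicator_self_add_compl T ψ) k).symm
      have habs : ∀ k, |ψ k| = |T.indicator ψ k| + |Tᶜ.indicator ψ k| := fun k => by
        by_cases hk : k ∈ T <;> simp [hk]
      have a1 : orbitAverage ψ B
          = fun x => orbitAverage (T.indicator ψ) B x + orbitAverage (Tᶜ.indicator ψ) B x := by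
        funext x
        simp only [orbitAverage]
        rw [← integral_add (hB.integrable_mul_smul i1 x) (hB.integrable_mul_smul i2 x)]
        exact integral_congr_ae (Eventually.of_forall fun k => by
          simp only [hsplit k, add_mul])
      have a2 : ∫ k, ψ k ∂(Measure.haar : Measure G)
          = (∫ k, T.indicator ψ k ∂(Measure.haar : Measure G))
            + ∫ k, Tᶜ.indicator ψ k ∂(Measure.haar : Measure G) := by
        rw [← integral_add i1 i2]
        exact integral_congr_ae (Eventually.of_forall hsplit)
      have a3 : ∫ k, |ψ k| ∂(Measure.haar : Measure G)
          = (∫ k, |T.indicator ψ k| ∂(Measure.haar : Measure G))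
            + ∫ k, |Tᶜ.indicator ψ k| ∂(Measure.haar : Measure G) := by
        rw [← integral_add i1.abs i2.abs]
        exact integral_congr_ae (Eventually.of_forall habs)
      rw [a1, a2, a3, M.map_add (isBddMeasurable_orbitAverage m1 i1 hB)
        (isBddMeasurable_orbitAverage m2 i2 hB)]
      rw [abs_le] at e1 e2 ⊢
      constructor <;> nlinarith [e1.1, e1.2, e2.1, e2.2]
    · intro t _
      obtain ⟨U, hU, hUo, htU⟩ := eventually_nhds_iff.1 (hcont ε hε t)
      refine ⟨U, mem_nhdsWithin_of_mem_nhds (hUo.mem_nhds htU), U, hUo.measurableSet, le_rfl,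
        fun ψ hψm hψ h0 => ?_⟩
      rw [← M.map_translate t hB, ← M.map_const_mul _ (hB.translate t)]
      refine M.abs_sub_le (isBddMeasurable_orbitAverage hψm hψ hB) ((hB.translate t).const_mul _)
        fun x => ?_
      rw [orbitAverage, ← integral_mul_const,
        ← integral_sub (hB.integrable_mul_smul hψ x) (hψ.mul_const _), ← integral_mul_const]
      refine abs_integral_le_integral_abs.trans (integral_mono_of_nonneg
        (Eventually.of_forall fun _ => abs_nonneg _) (hψ.abs.mul_const ε)
        (Eventually.of_forall fun k => ?_))
      simp only [← mul_sub, abs_mul]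
      by_cases hk : k ∈ U
      · exact mul_le_mul_of_nonneg_left (hU k hk x) (abs_nonneg _)
      · simp [h0 k hk]
  have hI := hθ.integrable_of_hasCompactSupport hs (μ := (Measure.haar : Measure G))
  set c := ∫ k, |θ k| ∂(Measure.haar : Measure G)
  have hc : 0 ≤ c := integral_nonneg fun _ => abs_nonneg _
  refine eq_of_abs_sub_le_all fun ε hε => ?_
  obtain ⟨T, -, hT, h⟩ := key (ε / (c + 1)) (by positivity)
  refine (h θ hθ.measurable hI fun k hk =>
    image_eq_zero_of_notMem_tsupport fun h => hk (hT h)).trans ?_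
  rw [mul_div_assoc', div_le_iff₀ (by positivity)]
  nlinarith

/-- Topological invariance of invariant means along averages of null integral. -/
theorem InvariantMean.map_orbitAverage_eq_zero {w : X → ℝ} (hw : IsBddMeasurable w) {θ : G → ℝ}
    (hθ : Continuous θ) (hs : HasCompactSupport θ)
    (h0 : ∫ k, θ k ∂(Measure.haar : Measure G) = 0) : M.toFun (orbitAverage θ w) = 0 := by
  obtain ⟨C, hC⟩ := hw.2
  have hI : ∀ {θ : G → ℝ}, Continuous θ → HasCompactSupport θ →
    Integrable θ (Measure.haar : Measure G) := fun h h' => h.integrable_of_hasCompactSupport h'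
  have hθI := hI hθ hs
  refine eq_of_abs_sub_le_all fun ε hε => ?_
  set c := |C| + 1
  have hcC : ∀ x, |w x| ≤ c := fun x => by
    have := hC x
    have := le_abs_self C
    simp only [c]; linarith
  have hc : 0 < c := by positivity
  -- κ is supported where translating θ changes it by less than ε/c in L¹, c being a bound for |w|.
  obtain ⟨κ, hκ, hκs, hκ0, hκ1, hκV⟩ := exists_density_near_one
    ((tendsto_integral_abs_translate_sub hθ hs).eventually (gt_mem_nhds (div_pos hε hc)))
  have hκI := hI hκ hκs
  -- Moving x to lx only translates κ, so B varies continuously along orbits, uniformly in x,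
  -- although w does not.
  let B : X → ℝ := fun x => ∫ k, κ k * w (k⁻¹ • x) ∂(Measure.haar : Measure G)
  have hmul : ∀ (l : G) x, B (l • x)
      = ∫ k, κ (l * k) * w (k⁻¹ • x) ∂(Measure.haar : Measure G) := fun l x => by
    rw [← integral_mul_left_eq_self _ l⁻¹]
    simp [B, mul_smul]
  have hint : ∀ (ψ : G → ℝ), Integrable ψ (Measure.haar : Measure G) → ∀ x,
      Integrable (fun k => ψ k * w (k⁻¹ • x)) (Measure.haar : Measure G) := fun ψ hψ x =>
    hψ.mul_bdd ((hw.1.comp (measurable_smul_const x)).comp measurable_inv).aestronglyMeasurable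
      (Eventually.of_forall fun k => hcC _)
  have hB : IsBddMeasurable B := by
    refine ⟨?_, _, fun x => abs_integral_mul_le hκI fun _ => hcC _⟩
    have : Measurable fun p : X × G => κ p.2 * w (p.2⁻¹ • p.1) :=
      (hκ.measurable.comp measurable_snd).mul
        (hw.1.comp (measurable_snd.inv.smul measurable_fst))
    exact (this.stronglyMeasurable.integral_prod_right
      (ν := (Measure.haar : Measure G))).measurable
  have hcont : ∀ ε : ℝ, 0 < ε → ∀ t : G, ∀ᶠ l in 𝓝 t, ∀ x, |B (l • x) - B (t • x)| ≤ ε := by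
    intro ε hε t
    filter_upwards [eventually_integral_abs_translate_sub_lt hκ hκs t (div_pos hε hc)] with l hl x
    have i1 : ∀ l : G, Integrable (fun k => κ (l * k)) (Measure.haar : Measure G) :=
      fun l => hκI.comp_mul_left l
    rw [hmul, hmul, ← integral_sub (hint _ (i1 l) x) (hint _ (i1 t) x)]
    simp only [← sub_mul]
    refine (abs_integral_mul_le ((i1 l).sub (i1 t)) fun k => hcC (k⁻¹ • x)).trans ?_
    rw [lt_div_iff₀ hc] at hl
    exact hl.le
  have h1 := M.map_orbitAverage_of_continuous hB hcont hθ hs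
  rw [h0, zero_mul] at h1
  rw [← h1]
  refine M.abs_sub_le (isBddMeasurable_orbitAverage hθ.measurable hθI hw)
    (isBddMeasurable_orbitAverage hθ.measurable hθI hB) fun x => ?_
  -- By Fubini, averaging B with weight θ is averaging w with the κ-mean of the translates θ(k·),
  -- which are all close to θ.
  have e1 : orbitAverage θ B x = ∫ k, κ k *
      (∫ l, θ (k * l) * w (l • x) ∂(Measure.haar : Measure G)) ∂(Measure.haar : Measure G) := by
    have hint2 : Integrable (Function.uncurry fun l k => θ l * (κ k * w (k⁻¹ • l • x)))
        ((Measure.haar : Measure G).prod Measure.haar) := by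
      have : Integrable (fun p : G × G => (θ p.1 * κ p.2) * w (p.2⁻¹ • p.1 • x))
          ((Measure.haar : Measure G).prod Measure.haar) :=
        (hθI.mul_prod hκI).mul_bdd (hw.1.comp (measurable_snd.inv.smul
          (measurable_fst.smul_const x))).aestronglyMeasurable
          (Eventually.of_forall fun k => hcC _)
      simpa only [Function.uncurry_def, mul_assoc] using this
    have : orbitAverage θ B x = ∫ l, ∫ k, θ l * (κ k * w (k⁻¹ • l • x)) ∂(Measure.haar : Measure G)
        ∂(Measure.haar : Measure G) := by
      simp only [orbitAverage, B, integral_const_mul]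
    rw [this, integral_integral_swap hint2]
    refine integral_congr_ae (Eventually.of_forall fun k => ?_)
    simp only
    rw [← integral_const_mul, ← integral_mul_left_eq_self _ k]
    refine integral_congr_ae (Eventually.of_forall fun l => ?_)
    simp only [smul_smul, inv_mul_cancel_left]
    ring
  have i2 : ∀ k : G, Integrable (fun l => θ (k * l)) (Measure.haar : Measure G) :=
    fun l => hθI.comp_mul_left l
  have hk : ∀ k, |κ k * orbitAverage θ w x - κ k *
      (∫ l, θ (k * l) * w (l • x) ∂(Measure.haar : Measure G))| ≤ κ k * ε := fun k => by
    rw [← mul_sub, abs_mul, abs_of_nonneg (hκ0 k)]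
    by_cases h : κ k = 0
    · simp [h]
    refine mul_le_mul_of_nonneg_left ?_ (hκ0 k)
    rw [abs_sub_comm, orbitAverage, ← integral_sub (hw.integrable_mul_smul (i2 k) x)
      (hw.integrable_mul_smul hθI x)]
    simp only [← sub_mul]
    refine (abs_integral_mul_le ((i2 k).sub hθI) fun l => hcC (l • x)).trans ?_
    have := hκV k h
    simp only [Set.mem_ofPred_eq, lt_div_iff₀ hc] at this
    exact this.le
  have e2 : orbitAverage θ w x = ∫ k, κ k * orbitAverage θ w x ∂(Measure.haar : Measure G) := by
    rw [integral_mul_const, hκ1, one_mul]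
  have m3 : Measurable fun p : G × G => θ (p.1 * p.2) * w (p.2 • x) :=
    (hθ.measurable.comp (measurable_fst.mul measurable_snd)).mul
      (hw.1.comp (measurable_snd.smul_const x))
  have i3 : Integrable (fun k => κ k * ∫ l, θ (k * l) * w (l • x) ∂(Measure.haar : Measure G))
      (Measure.haar : Measure G) := by
    refine hκI.mul_bdd (c := (∫ k, |θ k| ∂(Measure.haar : Measure G)) * c)
      (m3.stronglyMeasurable.integral_prod_right
        (ν := (Measure.haar : Measure G))).aestronglyMeasurable (Eventually.of_forall fun k => ?_)
    refine (abs_integral_mul_le (i2 k) fun l => hcC (l • x)).trans_eq ?_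
    rw [integral_mul_left_eq_self (fun l => |θ l|) k]
  rw [e1]
  nth_rewrite 1 [e2]
  rw [← integral_sub (hκI.mul_const _) i3]
  refine abs_integral_le_integral_abs.trans ((integral_mono_of_nonneg
        (Eventually.of_forall fun _ => abs_nonneg _) (hκI.mul_const ε)
        (Eventually.of_forall hk)).trans_eq ?_)
  rw [integral_mul_const, hκ1, one_mul]

end Averages

/-! ### The Radon–Nikodym cocycle -/

section RadonNikodym

variable {G X : Type*} [Group G] [MeasurableSpace G] [MulAction G X] [MeasurableSpace X]
  [MeasurableSMul₂ G X] [StandardBorelSpace X]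

open ProbabilityTheory

/-- The kernel `s ↦ s_* μ`. -/
def translateKernel (G : Type*) {X : Type*} [Group G] [MeasurableSpace G] [MulAction G X]
    [MeasurableSpace X] (μ : Measure X) : Kernel G X :=
  (Kernel.id ×ₖ Kernel.const G μ).map (fun p : G × X => p.1 • p.2)

theorem translateKernel_apply (μ : Measure X) [IsProbabilityMeasure μ] (s : G) :
    translateKernel G μ s = μ.map (fun x => s • x) := by
  have hm : Measurable fun p : G × X => p.1 • p.2 := measurable_smul
  rw [translateKernel, Kernel.map_apply _ hm, Kernel.prod_apply, Kernel.id_apply,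
    Kernel.const_apply, Measure.dirac_prod, Measure.map_map hm measurable_prodMk_left]
  rfl

instance (μ : Measure X) [IsProbabilityMeasure μ] : IsFiniteKernel (translateKernel G μ) := by
  unfold translateKernel; infer_instance

/-- A jointly measurable version of the Radon–Nikodym derivative `d(s_* μ)/dμ (y)`. -/
def rnCocycle (μ : Measure X) (s : G) (y : X) : ℝ :=
  ((translateKernel G μ).rnDeriv (Kernel.const G μ) s y).toReal

variable (μ : Measure X)

/-- Joint measurability is the reason for passing through kernels: derivatives chosen separately for
each s would not allow Fubini on G × X. -/
theorem measurable_rnCocycle : Measurable fun p : G × X => rnCocycle μ p.1 p.2 :=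
  (Kernel.measurable_rnDeriv _ _).ennreal_toReal

theorem measurable_rnCocycle_right (s : G) : Measurable (rnCocycle μ s : X → ℝ) :=
  (measurable_rnCocycle μ).comp measurable_prodMk_left

theorem rnCocycle_nonneg (s : G) (y : X) : 0 ≤ rnCocycle μ s y := ENNReal.toReal_nonneg

variable {μ} [IsProbabilityMeasure μ] (hμ : IsMeasureClassPreserving G μ)
include hμ

theorem map_smul_eq_withDensity (s : G) :
    μ.map (fun x => s • x) = μ.withDensity fun y => ENNReal.ofReal (rnCocycle μ s y) := by
  have hac : translateKernel G μ s ≪ Kernel.const G μ s := by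
    rw [translateKernel_apply, Kernel.const_apply]
    exact (hμ s).1
  have h := Kernel.withDensity_rnDeriv_eq hac
  rw [Kernel.withDensity_apply _ (Kernel.measurable_rnDeriv _ _), translateKernel_apply,
    Kernel.const_apply] at h
  rw [← h]
  refine withDensity_congr_ae ?_
  filter_upwards [Kernel.rnDeriv_ne_top (translateKernel G μ) (Kernel.const G μ) (a := s)] with y hy
  rw [rnCocycle, ENNReal.ofReal_toReal hy]

theorem lintegral_comp_smul {w : X → ℝ≥0∞} (hw : Measurable w) (s : G) :
    ∫⁻ x, w (s • x) ∂μ = ∫⁻ y, ENNReal.ofReal (rnCocycle μ s y) * w y ∂μ := by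
  rw [← lintegral_map hw (measurable_const_smul s), map_smul_eq_withDensity hμ,
    lintegral_withDensity_eq_lintegral_mul _ (measurable_rnCocycle_right μ s).ennreal_ofReal hw]
  rfl

theorem integral_comp_smul {E : Type*} [NormedAddCommGroup E] [NormedSpace ℝ E] {w : X → E}
    (hw : StronglyMeasurable w) (s : G) :
    ∫ x, w (s • x) ∂μ = ∫ y, rnCocycle μ s y • w y ∂μ := by
  rw [← integral_map (measurable_const_smul s).aemeasurable hw.aestronglyMeasurable,
    map_smul_eq_withDensity hμ, integral_withDensity_eq_integral_toReal_smul
    (measurable_rnCocycle_right μ s).ennreal_ofReal (Eventually.of_forall fun _ =>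
    ENNReal.ofReal_lt_top)]
  refine integral_congr_ae (Eventually.of_forall fun y => ?_)
  simp only [ENNReal.toReal_ofReal (rnCocycle_nonneg μ s y)]

/-- Both sides are densities of (rs)_*μ = r_*(s_*μ), and the density of a finite measure is unique
almost everywhere. The exceptional null set may depend on r and s. -/
theorem rnCocycle_mul (r s : G) :
    ∀ᵐ y ∂μ, rnCocycle μ (r * s) y = rnCocycle μ s (r⁻¹ • y) * rnCocycle μ r y := by
  have hm : Measurable fun y : X => rnCocycle μ s (r⁻¹ • y) * rnCocycle μ r y :=
    ((measurable_rnCocycle_right μ s).comp (measurable_const_smul _)).mul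
      (measurable_rnCocycle_right μ r)
  have h : μ.withDensity (fun y => ENNReal.ofReal (rnCocycle μ (r * s) y))
      = μ.withDensity (fun y => ENNReal.ofReal (rnCocycle μ s (r⁻¹ • y) * rnCocycle μ r y)) := by
    rw [← map_smul_eq_withDensity hμ]
    ext S hS
    have h1 := lintegral_comp_smul hμ (w := S.indicator 1) (measurable_one.indicator hS) (r * s)
    have h2 := lintegral_comp_smul hμ (w := fun x => S.indicator 1 (r • x))
      ((measurable_one.indicator hS).comp (measurable_const_smul r)) s
    have h3 := lintegral_comp_smul hμ
      (w := fun y => ENNReal.ofReal (rnCocycle μ s (r⁻¹ • y)) * S.indicator 1 y)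
      (((measurable_rnCocycle_right μ s).comp (measurable_const_smul _)).ennreal_ofReal.mul
        (measurable_one.indicator hS)) r
    simp only [inv_smul_smul] at h3
    rw [← lintegral_indicator_one hS, lintegral_map (measurable_one.indicator hS)
      (measurable_const_smul _)]
    simp only [mul_smul]
    rw [h2, h3, withDensity_apply _ hS, ← lintegral_indicator hS]
    refine lintegral_congr fun y => ?_
    by_cases hy : y ∈ S
    · rw [Set.indicator_of_mem hy, Set.indicator_of_mem hy,
        ENNReal.ofReal_mul (rnCocycle_nonneg μ s (r⁻¹ • y)), Pi.one_apply, mul_one, mul_comm]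
    · simp [hy]
  have hfin : ∫⁻ y, ENNReal.ofReal (rnCocycle μ (r * s) y) ∂μ ≠ ∞ := by
    have := lintegral_comp_smul hμ (w := 1) measurable_one (r * s)
    simp at this
    simp [← this]
  have := (withDensity_eq_iff (measurable_rnCocycle_right μ _).ennreal_ofReal.aemeasurable
    hm.ennreal_ofReal.aemeasurable hfin).1 h
  filter_upwards [this] with y hy
  rwa [ENNReal.ofReal_eq_ofReal_iff (rnCocycle_nonneg μ _ _)
    (mul_nonneg (rnCocycle_nonneg μ _ _) (rnCocycle_nonneg μ _ _))] at hy

end RadonNikodym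

/-! ### Translating densities -/

section Densities

variable {G X : Type*} [Group G] [MeasurableSpace G] [MulAction G X] [MeasurableSpace X]
  [MeasurableSMul₂ G X] [StandardBorelSpace X]

/-- The density of `s_* (f μ)` with respect to `μ`. -/
def translateDensity (μ : Measure X) (s : G) (f : X → ℝ) (y : X) : ℝ :=
  f (s⁻¹ • y) * rnCocycle μ s y

theorem measurable_translateDensity [MeasurableInv G] (μ : Measure X) {f : X → ℝ}
    (hf : Measurable f) : Measurable fun p : G × X => translateDensity μ p.1 f p.2 :=
  (hf.comp (measurable_fst.inv.smul measurable_snd)).mul (measurable_rnCocycle μ)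

theorem measurable_translateDensity_right (μ : Measure X) {f : X → ℝ} (hf : Measurable f) (s : G) :
    Measurable (translateDensity μ s f) :=
  (hf.comp (measurable_const_smul _)).mul (measurable_rnCocycle_right μ s)

variable {μ : Measure X} [IsProbabilityMeasure μ]

theorem integral_translateDensity_mul (hμ : IsMeasureClassPreserving G μ) {f w : X → ℝ}
    (hf : Measurable f) (hw : Measurable w) (s : G) :
    ∫ y, translateDensity μ s f y * w y ∂μ = ∫ x, f x * w (s • x) ∂μ := by
  have h := integral_comp_smul hμ (w := fun y => f (s⁻¹ • y) * w y)
    ((hf.comp (measurable_const_smul _)).mul hw).stronglyMeasurable s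
  simp only [inv_smul_smul] at h
  rw [h]
  refine integral_congr_ae (Eventually.of_forall fun y => ?_)
  simp only [translateDensity, smul_eq_mul]
  ring

theorem lintegral_enorm_translateDensity (hμ : IsMeasureClassPreserving G μ) {f : X → ℝ}
    (hf : Measurable f) (s : G) : ∫⁻ y, ‖translateDensity μ s f y‖ₑ ∂μ = ∫⁻ x, ‖f x‖ₑ ∂μ := by
  have h := lintegral_comp_smul hμ (w := fun y => ‖f (s⁻¹ • y)‖ₑ)
    ((hf.comp (measurable_const_smul _)).enorm) s
  simp only [inv_smul_smul] at h
  rw [h]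
  refine lintegral_congr fun y => ?_
  rw [translateDensity, enorm_mul, Real.enorm_of_nonneg (rnCocycle_nonneg μ s y), mul_comm]

theorem integrable_translateDensity (hμ : IsMeasureClassPreserving G μ) {f : X → ℝ}
    (hf : Measurable f) (hfi : Integrable f μ) (s : G) : Integrable (translateDensity μ s f) μ := by
  refine ⟨(measurable_translateDensity_right μ hf s).aestronglyMeasurable, ?_⟩
  rw [hasFiniteIntegral_iff_enorm, lintegral_enorm_translateDensity hμ hf]
  exact hfi.2

theorem integral_abs_translateDensity (hμ : IsMeasureClassPreserving G μ) {f : X → ℝ}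
    (hf : Measurable f) (s : G) : ∫ y, |translateDensity μ s f y| ∂μ = ∫ x, |f x| ∂μ := by
  have h := integral_translateDensity_mul hμ hf.abs measurable_one s
  simp only [Pi.one_apply, mul_one] at h
  rw [← h]
  refine integral_congr_ae (Eventually.of_forall fun y => ?_)
  simp only [translateDensity, abs_mul, abs_of_nonneg (rnCocycle_nonneg μ s y)]

theorem translateDensity_mul (hμ : IsMeasureClassPreserving G μ) (f : X → ℝ) (r s : G) :
    ∀ᵐ y ∂μ, translateDensity μ (r * s) f y
      = translateDensity μ r (translateDensity μ s f) y := by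
  filter_upwards [rnCocycle_mul hμ r s] with y hy
  simp only [translateDensity, hy, mul_inv_rev, mul_smul]
  ring

end Densities

/-! ### Smoothing densities over the group -/

section Smoothing

variable {G X : Type*} [Group G] [TopologicalSpace G] [IsTopologicalGroup G] [LocallyCompactSpace G]
  [SecondCountableTopology G] [MeasurableSpace G] [BorelSpace G] [MulAction G X]
  [MeasurableSpace X] [MeasurableSMul₂ G X] [StandardBorelSpace X]
  {μ : Measure X} [IsProbabilityMeasure μ]

/-- The density `∫ θ(k) k_* f dk`. -/
def smoothDensity (μ : Measure X) (θ : G → ℝ) (f : X → ℝ) (y : X) : ℝ :=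
  ∫ k, θ k * translateDensity μ k f y ∂(Measure.haar : Measure G)

theorem measurable_smoothDensity {θ : G → ℝ} (hθ : Measurable θ) {f : X → ℝ} (hf : Measurable f) :
    Measurable (smoothDensity μ θ f) := by
  have : Measurable fun p : X × G => θ p.2 * translateDensity μ p.2 f p.1 :=
    (hθ.comp measurable_snd).mul ((measurable_translateDensity μ hf).comp measurable_swap)
  exact (this.stronglyMeasurable.integral_prod_right (ν := (Measure.haar : Measure G))).measurable

theorem integrable_mul_translateDensity (hμ : IsMeasureClassPreserving G μ) {θ : G → ℝ}
    (hθm : Measurable θ) (hθ : Integrable θ (Measure.haar : Measure G)) {f : X → ℝ}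
    (hf : Measurable f) (hfi : Integrable f μ) :
    Integrable (fun p : G × X => θ p.1 * translateDensity μ p.1 f p.2)
      ((Measure.haar : Measure G).prod μ) := by
  have hm : Measurable fun p : G × X => θ p.1 * translateDensity μ p.1 f p.2 :=
    (hθm.comp measurable_fst).mul (measurable_translateDensity μ hf)
  rw [integrable_prod_iff hm.aestronglyMeasurable]
  refine ⟨Eventually.of_forall fun k =>
    (integrable_translateDensity hμ hf hfi k).const_mul (θ k), ?_⟩
  simp only [norm_mul, integral_const_mul, Real.norm_eq_abs, integral_abs_translateDensity hμ hf]
  exact hθ.abs.mul_const _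

theorem ae_integrable_mul_translateDensity (hμ : IsMeasureClassPreserving G μ) {θ : G → ℝ}
    (hθm : Measurable θ) (hθ : Integrable θ (Measure.haar : Measure G)) {f : X → ℝ}
    (hf : Measurable f) (hfi : Integrable f μ) :
    ∀ᵐ y ∂μ, Integrable (fun k => θ k * translateDensity μ k f y) (Measure.haar : Measure G) :=
  (integrable_mul_translateDensity hμ hθm hθ hf hfi).prod_left_ae

theorem integrable_smoothDensity (hμ : IsMeasureClassPreserving G μ) {θ : G → ℝ}
    (hθm : Measurable θ) (hθ : Integrable θ (Measure.haar : Measure G)) {f : X → ℝ}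
    (hf : Measurable f) (hfi : Integrable f μ) : Integrable (smoothDensity μ θ f) μ :=
  (integrable_mul_translateDensity hμ hθm hθ hf hfi).integral_prod_right

/-- By Fubini and the change of variables for each k, smoothing densities is the pre-adjoint of
averaging bounded functions along orbits. This lets separating functionals on L¹ be evaluated by
means. -/
theorem integral_smoothDensity_mul (hμ : IsMeasureClassPreserving G μ) {θ : G → ℝ}
    (hθm : Measurable θ) (hθ : Integrable θ (Measure.haar : Measure G)) {f : X → ℝ}
    (hf : Measurable f) (hfi : Integrable f μ) {w : X → ℝ} (hw : IsBddMeasurable w) :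
    ∫ y, smoothDensity μ θ f y * w y ∂μ = ∫ x, f x * orbitAverage θ w x ∂μ := by
  obtain ⟨hwm, C, hC⟩ := hw
  have hI := integrable_mul_translateDensity hμ hθm hθ hf hfi
  have hI1 : Integrable (Function.uncurry fun (k : G) (y : X) =>
      θ k * translateDensity μ k f y * w y) ((Measure.haar : Measure G).prod μ) :=
    hI.mul_bdd (hwm.comp measurable_snd).aestronglyMeasurable (Eventually.of_forall fun _ => hC _)
  have hI2 : Integrable (Function.uncurry fun (k : G) (x : X) => θ k * (f x * w (k • x)))
      ((Measure.haar : Measure G).prod μ) := by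
    have := (hθ.mul_prod hfi).mul_bdd (g := fun p : G × X => w (p.1 • p.2)) (c := C)
      (hwm.comp measurable_smul).aestronglyMeasurable (Eventually.of_forall fun _ => hC _)
    simpa only [Function.uncurry_def, mul_assoc] using this
  calc ∫ y, smoothDensity μ θ f y * w y ∂μ
      = ∫ y, ∫ k, θ k * translateDensity μ k f y * w y ∂(Measure.haar : Measure G) ∂μ := by
        simp only [smoothDensity, integral_mul_const]
    _ = ∫ k, ∫ y, θ k * translateDensity μ k f y * w y ∂μ ∂(Measure.haar : Measure G) :=
        (integral_integral_swap hI1).symm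
    _ = ∫ k, ∫ x, θ k * (f x * w (k • x)) ∂μ ∂(Measure.haar : Measure G) := by
        refine integral_congr_ae (Eventually.of_forall fun k => ?_)
        simp only [mul_assoc, integral_const_mul, integral_translateDensity_mul hμ hf hwm]
    _ = ∫ x, ∫ k, θ k * (f x * w (k • x)) ∂(Measure.haar : Measure G) ∂μ :=
        integral_integral_swap hI2
    _ = ∫ x, f x * orbitAverage θ w x ∂μ := by
        refine integral_congr_ae (Eventually.of_forall fun x => ?_)
        simp only [orbitAverage, ← integral_const_mul]
        refine integral_congr_ae (Eventually.of_forall fun k => ?_)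
        simp only
        ring

theorem integral_abs_smoothDensity_le (hμ : IsMeasureClassPreserving G μ) {θ : G → ℝ}
    (hθm : Measurable θ) (hθ : Integrable θ (Measure.haar : Measure G)) {f : X → ℝ}
    (hf : Measurable f) (hfi : Integrable f μ) :
    ∫ y, |smoothDensity μ θ f y| ∂μ
      ≤ (∫ k, |θ k| ∂(Measure.haar : Measure G)) * ∫ x, |f x| ∂μ := by
  have hI := integrable_mul_translateDensity hμ hθm hθ hf hfi
  calc ∫ y, |smoothDensity μ θ f y| ∂μ
      ≤ ∫ y, ∫ k, |θ k * translateDensity μ k f y| ∂(Measure.haar : Measure G) ∂μ :=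
        integral_mono (integrable_smoothDensity hμ hθm hθ hf hfi).abs hI.abs.integral_prod_right
          fun y => abs_integral_le_integral_abs
    _ = ∫ k, ∫ y, |θ k * translateDensity μ k f y| ∂μ ∂(Measure.haar : Measure G) :=
        (integral_integral_swap hI.abs).symm
    _ = (∫ k, |θ k| ∂(Measure.haar : Measure G)) * ∫ x, |f x| ∂μ := by
        simp only [abs_mul, integral_const_mul, integral_abs_translateDensity hμ hf,
          integral_mul_const]

theorem smoothDensity_sub (hμ : IsMeasureClassPreserving G μ) {θ θ' : G → ℝ}
    (hθm : Measurable θ) (hθ : Integrable θ (Measure.haar : Measure G)) (hθm' : Measurable θ')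
    (hθ' : Integrable θ' (Measure.haar : Measure G)) {f : X → ℝ}
    (hf : Measurable f) (hfi : Integrable f μ) :
    ∀ᵐ y ∂μ, smoothDensity μ (fun k => θ k - θ' k) f y
      = smoothDensity μ θ f y - smoothDensity μ θ' f y := by
  filter_upwards [ae_integrable_mul_translateDensity hμ hθm hθ hf hfi,
    ae_integrable_mul_translateDensity hμ hθm' hθ' hf hfi] with y h h'
  simp only [smoothDensity, sub_mul]
  exact integral_sub h h'

theorem smoothDensity_comb (hμ : IsMeasureClassPreserving G μ) {θ : G → ℝ}
    (hθm : Measurable θ) (hθ : Integrable θ (Measure.haar : Measure G)) {f f' : X → ℝ}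
    (hf : Measurable f) (hfi : Integrable f μ) (hf' : Measurable f') (hfi' : Integrable f' μ)
    (a b : ℝ) :
    ∀ᵐ y ∂μ, smoothDensity μ θ (fun x => a * f x + b * f' x) y
      = a * smoothDensity μ θ f y + b * smoothDensity μ θ f' y := by
  filter_upwards [ae_integrable_mul_translateDensity hμ hθm hθ hf hfi,
    ae_integrable_mul_translateDensity hμ hθm hθ hf' hfi'] with y h h'
  simp only [smoothDensity]
  rw [← integral_const_mul, ← integral_const_mul, ← integral_add (h.const_mul a) (h'.const_mul b)]
  refine integral_congr_ae (Eventually.of_forall fun k => ?_)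
  simp only [translateDensity]
  ring

/-- The chain rule moves the translation from the density on X to the weight on `G`, where
L¹-continuity of translation is available. -/
theorem translateDensity_smoothDensity (hμ : IsMeasureClassPreserving G μ) {θ : G → ℝ}
    {f : X → ℝ} (hf : Measurable f) (s : G) :
    ∀ᵐ y ∂μ, translateDensity μ s (smoothDensity μ θ f) y
      = smoothDensity μ (fun k => θ (s⁻¹ * k)) f y := by
  have hset : MeasurableSet {p : G × X | translateDensity μ (s * p.1) f p.2
      = translateDensity μ s (translateDensity μ p.1 f) p.2} := by
    have hm := measurable_translateDensity (G := G) μ hf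
    have h1 : Measurable fun p : G × X => translateDensity μ (s * p.1) f p.2 :=
      hm.comp ((measurable_fst.const_mul s).prodMk measurable_snd)
    have h2 : Measurable fun p : G × X => translateDensity μ s (translateDensity μ p.1 f) p.2 :=
      (hm.comp (measurable_fst.prodMk (measurable_snd.const_smul s⁻¹))).mul
        ((measurable_rnCocycle_right μ s).comp measurable_snd)
    exact measurableSet_eq_fun h1 h2
  -- The chain rule holds for each k off a null set depending on k; joint measurability allows the
  -- quantifiers to be exchanged.
  have hae : ∀ᵐ y ∂μ, ∀ᵐ k ∂(Measure.haar : Measure G), translateDensity μ (s * k) f y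
      = translateDensity μ s (translateDensity μ k f) y :=
    (Measure.ae_ae_comm hset).1 (Eventually.of_forall fun k => translateDensity_mul hμ f s k)
  filter_upwards [hae] with y hy
  rw [translateDensity, smoothDensity, smoothDensity, ← integral_mul_const,
    ← integral_mul_left_eq_self (fun k => θ (s⁻¹ * k) * translateDensity μ k f y) s]
  refine integral_congr_ae ?_
  filter_upwards [hy] with k hk
  simp only [inv_mul_cancel_left, hk, mul_assoc]
  rfl

end Smoothing

/-! ### The dual of L¹ of a finite measure -/

section DualOfL1

variable {X : Type*} [MeasurableSpace X] {μ : Measure X}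

/-- Bounded functionals on `L¹` of a finite measure are given by bounded measurable functions. -/
theorem exists_isBddMeasurable_repr [IsFiniteMeasure μ] (Λ : Lp ℝ 1 μ →L[ℝ] ℝ) :
    ∃ w : X → ℝ, IsBddMeasurable w ∧ ∀ F : Lp ℝ 1 μ, Λ F = ∫ x, F x * w x ∂μ := by
  have hone : MemLp (fun _ : X => (1 : ℝ)) 2 μ := memLp_const 1
  -- For a finite measure L² embeds into L¹, here as multiplication by the constant 1; the Riesz
  -- theorem on L² then produces a candidate v.
  let incl : Lp ℝ 2 μ →L[ℝ] Lp ℝ 1 μ :=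
    (ContinuousLinearMap.mul ℝ ℝ).holderL μ 2 2 1 (hone.toLp _)
  have hincl : ∀ F : Lp ℝ 2 μ, incl F =ᵐ[μ] F := fun F => by
    filter_upwards [(ContinuousLinearMap.mul ℝ ℝ).coeFn_holder (r := 1) (hone.toLp _) F,
      hone.coeFn_toLp] with x h1 h2
    refine h1.trans ?_
    rw [h2]
    simp
  let v : Lp ℝ 2 μ := (InnerProductSpace.toDual ℝ (Lp ℝ 2 μ)).symm (Λ.comp incl)
  have hv : ∀ F : Lp ℝ 2 μ, Λ (incl F) = ∫ x, F x * v x ∂μ := fun F => by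
    have : inner ℝ v F = Λ (incl F) := by
      simp [v, InnerProductSpace.toDual_symm_apply]
    rw [← this, L2.inner_def]
    simp
  have hvi : Integrable v μ := (Lp.memLp v).integrable (by norm_num)
  have hset : ∀ (c : ℝ) (S : Set X) (hS : MeasurableSet S),
      Λ (indicatorConstLp 1 hS (measure_ne_top μ S) c) = c * ∫ x in S, v x ∂μ := by
    intro c S hS
    have h1 : incl (indicatorConstLp 2 hS (measure_ne_top μ S) c)
        = indicatorConstLp 1 hS (measure_ne_top μ S) c := by
      refine Lp.ext ((hincl _).trans ?_)
      exact indicatorConstLp_coeFn.trans indicatorConstLp_coeFn.symm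
    rw [← h1, hv, ← integral_indicator hS, ← integral_const_mul]
    refine integral_congr_ae ?_
    filter_upwards [indicatorConstLp_coeFn (p := 2) (hs := hS) (hμs := measure_ne_top μ S) (c := c)]
      with x hx
    rw [hx]
    by_cases h : x ∈ S <;> simp [h]
  have hbd : ∀ (S : Set X), MeasurableSet S → |∫ x in S, v x ∂μ| ≤ ‖Λ‖ * μ.real S := by
    intro S hS
    have := Λ.le_opNorm (indicatorConstLp 1 hS (measure_ne_top μ S) 1)
    rw [hset, one_mul, norm_indicatorConstLp (by norm_num) (by norm_num)] at this
    simpa using this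
  have hle : ∀ᵐ x ∂μ, v x ≤ ‖Λ‖ :=
    ae_le_of_forall_setIntegral_le hvi (integrable_const _) fun S hS _ => by
      have := (abs_le.1 (hbd S hS)).2
      simpa [mul_comm] using this
  have hge : ∀ᵐ x ∂μ, -‖Λ‖ ≤ v x :=
    ae_le_of_forall_setIntegral_le (integrable_const _) hvi fun S hS _ => by
      have := (abs_le.1 (hbd S hS)).1
      simpa [mul_comm] using this
  -- Truncation makes the bound, known for v only almost everywhere, hold at every point.
  let w : X → ℝ := fun x => max (-‖Λ‖) (min ‖Λ‖ (v x))
  have hwv : w =ᵐ[μ] v := by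
    filter_upwards [hle, hge] with x h1 h2
    simp [w, h1, h2]
  have hw : IsBddMeasurable w := by
    refine ⟨measurable_const.max (measurable_const.min (Lp.stronglyMeasurable v).measurable), ‖Λ‖,
      fun x => abs_le.2 ⟨le_max_left _ _, max_le ?_ (min_le_left _ _)⟩⟩
    linarith [norm_nonneg Λ]
  obtain ⟨C, hC⟩ := hw.2
  have hwL : MemLp w ∞ μ := memLp_top_of_bound hw.1.aestronglyMeasurable C
    (Eventually.of_forall hC)
  let Ψ : Lp ℝ 1 μ →L[ℝ] ℝ := (ContinuousLinearMap.mul ℝ ℝ).lpPairing μ ∞ 1 (hwL.toLp w)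
  have hΨ : ∀ F : Lp ℝ 1 μ, Ψ F = ∫ x, F x * w x ∂μ := fun F => by
    rw [ContinuousLinearMap.lpPairing_eq_integral]
    refine integral_congr_ae ?_
    filter_upwards [hwL.coeFn_toLp] with x hx
    simp [hx, mul_comm]
  refine ⟨w, hw, fun F => ?_⟩
  rw [← hΨ]
  refine Lp.induction (by norm_num) (motive := fun F => Λ F = Ψ F) (fun c S hS hμS => ?_)
    (fun f g hf hg _ h1 h2 => by rw [map_add, map_add, h1, h2]) (isClosed_eq Λ.continuous
    Ψ.continuous) F
  rw [Lp.simpleFunc.coe_indicatorConst, hset, hΨ, ← integral_indicator hS, ← integral_const_mul]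
  refine integral_congr_ae ?_
  filter_upwards [hwv, indicatorConstLp_coeFn (p := 1) (hs := hS) (hμs := hμS.ne) (c := c)]
    with x hx hx'
  rw [hx', hx]
  by_cases h : x ∈ S <;> simp [h]

end DualOfL1

/-! ### From an invariant mean to almost invariant densities -/

section AlmostInvariantDensities

variable {G X : Type*} [Group G] [TopologicalSpace G] [IsTopologicalGroup G] [LocallyCompactSpace G]
  [SecondCountableTopology G] [MeasurableSpace G] [BorelSpace G] [MulAction G X]
  [MeasurableSpace X] [MeasurableSMul₂ G X] [StandardBorelSpace X]
  {μ : Measure X} [IsProbabilityMeasure μ]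

/-- Measurable probability densities with respect to `μ`. -/
structure IsDensity (μ : Measure X) (f : X → ℝ) : Prop where
  measurable : Measurable f
  nonneg : ∀ x, 0 ≤ f x
  integrable : Integrable f μ
  integral_eq_one : ∫ x, f x ∂μ = 1

/-- This is Hahn–Banach separation in a finite power of L¹. If the convex set of smoothed tuples
missed a ball around 0, a separating functional (wᵢ) would give a sum of averages of the wᵢ that is
at least some c > 0 almost everywhere, while an invariant mean gives this sum the value 0. -/
theorem exists_density_smoothDensity_le (hμ : IsMeasureClassPreserving G μ) (M : InvariantMean G μ)
    {n : ℕ} {θ : Fin n → G → ℝ} (hθ : ∀ i, Continuous (θ i)) (hs : ∀ i, HasCompactSupport (θ i))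
    (h0 : ∀ i, ∫ k, θ i k ∂(Measure.haar : Measure G) = 0) {ε : ℝ} (hε : 0 < ε) :
    ∃ f, IsDensity μ f ∧ ∀ i, ∫ y, |smoothDensity μ (θ i) f y| ∂μ ≤ ε := by
  by_contra! hcon
  have hθI : ∀ i, Integrable (θ i) (Measure.haar : Measure G) :=
    fun i => (hθ i).integrable_of_hasCompactSupport (hs i)
  let 𝒞 : Set (Fin n → Lp ℝ 1 μ) :=
    {v | ∃ f, IsDensity μ f ∧ ∀ i, v i =ᵐ[μ] smoothDensity μ (θ i) f}
  have hconv : Convex ℝ 𝒞 := by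
    rintro v ⟨f, hf, hv⟩ v' ⟨f', hf', hv'⟩ a b ha hb hab
    refine ⟨fun x => a * f x + b * f' x, ⟨(hf.measurable.const_mul a).add
      (hf'.measurable.const_mul b), fun x => add_nonneg (mul_nonneg ha (hf.nonneg x))
      (mul_nonneg hb (hf'.nonneg x)), (hf.integrable.const_mul a).add (hf'.integrable.const_mul b),
      ?_⟩, fun i => ?_⟩
    · rw [integral_add (hf.integrable.const_mul a) (hf'.integrable.const_mul b),
        integral_const_mul, integral_const_mul, hf.integral_eq_one, hf'.integral_eq_one]
      linarith
    · filter_upwards [Lp.coeFn_add (a • v i) (b • v' i), Lp.coeFn_smul a (v i),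
        Lp.coeFn_smul b (v' i), hv i, hv' i, smoothDensity_comb hμ (hθ i).measurable (hθI i)
          hf.measurable hf.integrable hf'.measurable hf'.integrable a b] with x h1 h2 h3 h4 h5 h6
      rw [h6, ← h4, ← h5]
      simp only [Pi.add_apply, Pi.smul_apply] at h1 h2 h3 ⊢
      rw [h1, h2, h3]
      rfl
  have hdisj : Disjoint (Metric.ball (0 : Fin n → Lp ℝ 1 μ) ε) 𝒞 := by
    rw [Set.disjoint_left]
    rintro v hv ⟨f, hf, hvf⟩
    obtain ⟨i, hi⟩ := hcon f hf
    have h1 : ‖v i‖ < ε := (norm_le_pi_norm v i).trans_lt (by simpa using hv)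
    have h2 : ‖v i‖ = ∫ y, |smoothDensity μ (θ i) f y| ∂μ := by
      rw [L1.norm_eq_integral_norm]
      refine integral_congr_ae ?_
      filter_upwards [hvf i] with x hx
      rw [hx]; rfl
    linarith
  obtain ⟨Λ, c, hΛball, hΛC⟩ :=
    geometric_hahn_banach_open (convex_ball _ _) Metric.isOpen_ball hconv hdisj
  have hc : 0 < c := by simpa using hΛball 0 (Metric.mem_ball_self hε)
  choose w hw hΛw using fun i => exists_isBddMeasurable_repr
    (Λ.comp (ContinuousLinearMap.single ℝ (fun _ : Fin n => Lp ℝ 1 μ) i))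
  have hΛ : ∀ v, Λ v = ∑ i, ∫ x, v i x * w i x ∂μ := fun v => by
    conv_lhs => rw [← Finset.univ_sum_single v, map_sum]
    refine Finset.sum_congr rfl fun i _ => ?_
    rw [← hΛw]; rfl
  have hW : ∀ i, IsBddMeasurable (orbitAverage (θ i) (w i)) := fun i =>
    isBddMeasurable_orbitAverage (hθ i).measurable (hθI i) (hw i)
  obtain ⟨hWb, hWM⟩ := M.map_sum Finset.univ hW
  have hge : ∀ f, IsDensity μ f → c ≤ ∫ x, f x * ∑ i, orbitAverage (θ i) (w i) x ∂μ := by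
    intro f hf
    have hI : ∀ i, Integrable (smoothDensity μ (θ i) f) μ := fun i =>
      integrable_smoothDensity hμ (hθ i).measurable (hθI i) hf.measurable hf.integrable
    refine (hΛC (fun i => (hI i).toL1 _) ⟨f, hf, fun i => (hI i).coeFn_toL1⟩).trans_eq ?_
    have : ∀ x, f x * ∑ i, orbitAverage (θ i) (w i) x
        = ∑ i, f x * orbitAverage (θ i) (w i) x := fun x => Finset.mul_sum _ _ _
    simp only [this]
    rw [hΛ, integral_finsetSum]
    · refine Finset.sum_congr rfl fun i _ => ?_
      rw [← integral_smoothDensity_mul hμ (hθ i).measurable (hθI i) hf.measurable hf.integrable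
        (hw i)]
      refine integral_congr_ae ?_
      filter_upwards [(hI i).coeFn_toL1] with x hx
      rw [hx]
    · intro i _
      obtain ⟨C, hC⟩ := (hW i).2
      exact hf.integrable.mul_bdd (hW i).1.aestronglyMeasurable (Eventually.of_forall hC)
  obtain ⟨C, hC⟩ := hWb.2
  have hWi : Integrable (fun x => ∑ i, orbitAverage (θ i) (w i) x) μ :=
    (integrable_const C).mono' hWb.1.aestronglyMeasurable (Eventually.of_forall hC)
  -- Testing against normalized indicators, which are densities, turns the integrated bound into a
  -- pointwise one.
  have hae : (fun _ => c) ≤ᵐ[μ] fun x => ∑ i, orbitAverage (θ i) (w i) x := by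
    refine ae_le_of_forall_setIntegral_le (integrable_const c) hWi fun S hS _ => ?_
    by_cases hS0 : μ S = 0
    · simp [Measure.restrict_eq_zero.2 hS0]
    have hpos : 0 < μ.real S := ENNReal.toReal_pos hS0 (measure_ne_top _ _)
    have h := hge (S.indicator fun _ => (μ.real S)⁻¹) ⟨measurable_const.indicator hS, fun x =>
      Set.indicator_nonneg (fun _ _ => (inv_pos.2 hpos).le) x,
      (integrable_const _).indicator hS, by
        rw [integral_indicator hS, setIntegral_const, smul_eq_mul, mul_inv_cancel₀ hpos.ne']⟩
    have heq : ∫ x, S.indicator (fun _ => (μ.real S)⁻¹) x * ∑ i, orbitAverage (θ i) (w i) x ∂μ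
        = (μ.real S)⁻¹ * ∫ x in S, ∑ i, orbitAverage (θ i) (w i) x ∂μ := by
      rw [← integral_const_mul, ← integral_indicator hS]
      refine integral_congr_ae (Eventually.of_forall fun x => ?_)
      by_cases hx : x ∈ S <;> simp [hx]
    rw [heq, ← div_eq_inv_mul, le_div_iff₀ hpos] at h
    rw [setIntegral_const, smul_eq_mul]
    linarith
  have hfin := M.mono (isBddMeasurable_const c) hWb hae
  rw [M.map_const, hWM, Finset.sum_eq_zero fun i _ =>
    M.map_orbitAverage_eq_zero (hw i) (hθ i) (hs i) (h0 i)] at hfin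
  linarith

/-- Reiter's property: there are densities that are almost invariant on compact sets. -/
theorem exists_density_almost_invariant (hμ : IsMeasureClassPreserving G μ)
    (M : InvariantMean G μ) {Q : Set G} (hQ : IsCompact Q) {ε : ℝ} (hε : 0 < ε) :
    ∃ f, IsDensity μ f ∧ ∀ s ∈ Q, ∫ y, |translateDensity μ s f y - f y| ∂μ ≤ ε := by
  obtain ⟨ψ, hψ, hψs, hψ0, hψ1, -⟩ := exists_density_near_one (G := G) univ_mem
  have hψI : Integrable ψ (Measure.haar : Measure G) := hψ.integrable_of_hasCompactSupport hψs
  have hL : ∀ s : G, Continuous fun k => ψ (s⁻¹ * k) := fun s => by fun_prop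
  have hLI : ∀ s : G, Integrable (fun k => ψ (s⁻¹ * k)) (Measure.haar : Measure G) :=
    fun s => hψI.comp_mul_left s⁻¹
  have hLs : ∀ s : G, HasCompactSupport fun k => ψ (s⁻¹ * k) := fun s =>
    hψs.comp_homeomorph (Homeomorph.mulLeft s⁻¹)
  -- The translates of ψ by `Q` form a compact set in L¹(G), so a finite net reduces to finitely
  -- many weights.
  have hnet : ∃ t : Finset G, ∀ s ∈ Q, ∃ r ∈ t,
      ∫ k, |ψ (s⁻¹ * k) - ψ (r⁻¹ * k)| ∂(Measure.haar : Measure G) ≤ ε / 2 := by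
    obtain ⟨t, -, ht⟩ := hQ.elim_nhds_subcover
      (fun r => {s : G | ∫ k, |ψ (s⁻¹ * k) - ψ (r⁻¹ * k)| ∂(Measure.haar : Measure G) < ε / 2})
      fun r _ => continuous_inv.continuousAt.eventually
        (eventually_integral_abs_translate_sub_lt hψ hψs r⁻¹ (half_pos hε))
    refine ⟨t, fun s hs => ?_⟩
    obtain ⟨r, hr, hsr⟩ := Set.mem_iUnion₂.1 (ht hs)
    exact ⟨r, hr, le_of_lt hsr⟩
  obtain ⟨t, ht⟩ := hnet
  let e := t.equivFin.symm
  -- A translate of ψ minus ψ has null integral, as the separation argument requires.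
  obtain ⟨f, hf, hfθ⟩ := exists_density_smoothDensity_le hμ M
    (θ := fun i k => ψ ((e i : G)⁻¹ * k) - ψ k) (fun i => (hL _).sub hψ)
    (fun i => (hLs _).sub hψs)
    (fun i => by
      rw [integral_sub (hLI _) hψI, integral_mul_left_eq_self ψ, sub_self]) (half_pos hε)
  have hfm := hf.measurable
  have hfi := hf.integrable
  have hI : Integrable (smoothDensity μ ψ f) μ := integrable_smoothDensity hμ hψ.measurable hψI hfm hfi
  refine ⟨smoothDensity μ ψ f, ⟨measurable_smoothDensity hψ.measurable hfm, fun y =>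
    integral_nonneg fun k => mul_nonneg (hψ0 k) (mul_nonneg (hf.nonneg _)
      (rnCocycle_nonneg μ k y)), hI, ?_⟩, fun s hs => ?_⟩
  · have h := integral_smoothDensity_mul hμ hψ.measurable hψI hfm hfi (isBddMeasurable_const 1)
    have h1 : ∀ x, orbitAverage ψ (fun _ : X => (1 : ℝ)) x = 1 := fun x => by
      simp [orbitAverage, hψ1]
    simp only [h1, mul_one] at h
    rw [h, hf.integral_eq_one]
  · obtain ⟨r, hr, hsr⟩ := ht s hs
    obtain ⟨i, hi⟩ := e.surjective ⟨r, hr⟩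
    have hfi' := hfθ i
    simp only [hi] at hfi'
    have hI2 : Integrable (smoothDensity μ (fun k => ψ (s⁻¹ * k) - ψ (r⁻¹ * k)) f) μ :=
      integrable_smoothDensity hμ ((hL s).sub (hL r)).measurable
      ((hLI s).sub (hLI r)) hfm hfi
    have hI3 : Integrable (smoothDensity μ (fun k => ψ (r⁻¹ * k) - ψ k) f) μ :=
      integrable_smoothDensity hμ ((hL r).sub hψ).measurable
      ((hLI r).sub hψI) hfm hfi
    calc ∫ y, |translateDensity μ s (smoothDensity μ ψ f) y - smoothDensity μ ψ f y| ∂μ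
        ≤ ∫ y, (|smoothDensity μ (fun k => ψ (s⁻¹ * k) - ψ (r⁻¹ * k)) f y|
            + |smoothDensity μ (fun k => ψ (r⁻¹ * k) - ψ k) f y|) ∂μ := by
          refine integral_mono_ae ((integrable_translateDensity hμ
            (measurable_smoothDensity hψ.measurable hfm) hI s).sub hI).abs
            (hI2.abs.add hI3.abs) ?_
          filter_upwards [translateDensity_smoothDensity hμ (θ := ψ) hfm s,
            smoothDensity_sub hμ (hL s).measurable (hLI s) (hL r).measurable (hLI r) hfm hfi,
            smoothDensity_sub hμ (hL r).measurable (hLI r) hψ.measurable hψI hfm hfi]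
            with y h1 h2 h3
          simp only [h1, h2, h3]
          exact abs_sub_le _ _ _
      _ ≤ ε / 2 * 1 + ε / 2 := by
          rw [integral_add hI2.abs hI3.abs]
          refine add_le_add ?_ hfi'
          refine (integral_abs_smoothDensity_le hμ ((hL s).sub (hL r)).measurable
            ((hLI s).sub (hLI r)) hfm hfi).trans ?_
          simp only [abs_of_nonneg (hf.nonneg _), hf.integral_eq_one]
          exact mul_le_mul_of_nonneg_right hsr zero_le_one
      _ = ε := by ring

end AlmostInvariantDensities

/-! ### The kernel on the group obtained from a function on `H` -/

section TwistedKernel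

variable {G H X : Type*} [Group G] [MeasurableSpace G] [MulAction G X] [MeasurableSpace X]
  [StandardBorelSpace X]

/-- The square root of the density of `s_* (F μ)`. -/
def amplitude (μ : Measure X) (F : X → ℝ) (s : G) (y : X) : ℝ := √(translateDensity μ s F y)

/-- The cocycle evaluated on the arrow from `s⁻¹ y` to `y`. -/
def cocycleTo (α : G × X → H) (s : G) (y : X) : H := α (s, s⁻¹ • y)

variable [Group H]

/-- The integrand of `twistedKernel`. -/
def twistedIntegrand (μ : Measure X) (F : X → ℝ) (α : G × X → H) (u : H → ℂ) (s t : G) (y : X) :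
    ℂ :=
  ((amplitude μ F s y * amplitude μ F t y : ℝ) : ℂ) * u ((cocycleTo α t y)⁻¹ * cocycleTo α s y)

/-- The kernel obtained by integrating `u` along the cocycle against the geometric mean of the
measures `s_* (F μ)` and `t_* (F μ)`. -/
def twistedKernel (μ : Measure X) (F : X → ℝ) (α : G × X → H) (u : H → ℂ) (s t : G) : ℂ :=
  ∫ y, twistedIntegrand μ F α u s t y ∂μ

theorem amplitude_nonneg (μ : Measure X) (F : X → ℝ) (s : G) (y : X) : 0 ≤ amplitude μ F s y :=
  Real.sqrt_nonneg _

variable [MeasurableSMul₂ G X]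

theorem translateDensity_nonneg (μ : Measure X)
    {F : X → ℝ} (hF : ∀ x, 0 ≤ F x) (s : G) (y : X) : 0 ≤ translateDensity μ s F y :=
  mul_nonneg (hF _) (rnCocycle_nonneg μ s y)

theorem amplitude_sq (μ : Measure X)
    {F : X → ℝ} (hF : ∀ x, 0 ≤ F x) (s : G) (y : X) :
    amplitude μ F s y ^ 2 = translateDensity μ s F y :=
  Real.sq_sqrt (translateDensity_nonneg μ hF s y)

theorem amplitude_mul_le (μ : Measure X)
    {F : X → ℝ} (hF : ∀ x, 0 ≤ F x) (s t : G) (y : X) :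
    amplitude μ F s y * amplitude μ F t y
      ≤ (translateDensity μ s F y + translateDensity μ t F y) / 2 := by
  have := sq_nonneg (amplitude μ F s y - amplitude μ F t y)
  rw [← amplitude_sq μ hF, ← amplitude_sq μ hF]
  nlinarith

variable [MeasurableInv G]

theorem measurable_amplitude (μ : Measure X) {F : X → ℝ} (hF : Measurable F) :
    Measurable fun p : G × X => amplitude μ F p.1 p.2 :=
  (measurable_translateDensity μ hF).sqrt

theorem measurable_cocycleTo [MeasurableSpace H] {α : G × X → H} (hα : Measurable α) :
    Measurable fun p : G × X => cocycleTo α p.1 p.2 :=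
  hα.comp (measurable_fst.prodMk (measurable_fst.inv.smul measurable_snd))

variable [MeasurableSpace H] [MeasurableMul₂ H] [MeasurableInv H]

theorem measurable_twistedIntegrand (μ : Measure X) {F : X → ℝ} (hF : Measurable F)
    {α : G × X → H} (hα : Measurable α) {u : H → ℂ} (hu : Measurable u) :
    Measurable fun p : (G × G) × X => twistedIntegrand μ F α u p.1.1 p.1.2 p.2 := by
  have h1 : Measurable fun p : (G × G) × X => (p.1.1, p.2) :=
    (measurable_fst.comp measurable_fst).prodMk measurable_snd
  have h2 : Measurable fun p : (G × G) × X => (p.1.2, p.2) :=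
    (measurable_snd.comp measurable_fst).prodMk measurable_snd
  have a1 := (measurable_amplitude (G := G) μ hF).comp h1
  have a2 := (measurable_amplitude (G := G) μ hF).comp h2
  have c1 := (measurable_cocycleTo hα).comp h1
  have c2 := (measurable_cocycleTo hα).comp h2
  exact (Complex.measurable_ofReal.comp (a1.mul a2)).mul (hu.comp (c2.inv.mul c1))

variable {μ : Measure X}

/-- This is the cocycle identity at the point (rs)⁻¹y; invariance of the measure class pulls its
null set back to a null set. -/
theorem cocycleTo_mul (hμ : IsMeasureClassPreserving G μ) {α : G × X → H}
    (hα : IsBorelCocycle μ α) (r s : G) :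
    ∀ᵐ y ∂μ, cocycleTo α (r * s) y = cocycleTo α r y * cocycleTo α s (r⁻¹ • y) := by
  have h := (quasiMeasurePreserving_smul hμ (r * s)⁻¹).ae (hα.cocycle r s)
  filter_upwards [h] with y hy
  simp only [cocycleTo]
  rw [hy, mul_inv_rev, mul_smul, smul_inv_smul]

theorem cocycleTo_one {α : G × X → H} (hα : IsBorelCocycle μ α) :
    ∀ᵐ y ∂μ, cocycleTo α (1 : G) y = 1 := by
  filter_upwards [hα.cocycle 1 1] with y hy
  simpa [cocycleTo] using hy

variable [IsProbabilityMeasure μ]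

theorem amplitude_mul (hμ : IsMeasureClassPreserving G μ) (F : X → ℝ) (r s : G) :
    ∀ᵐ y ∂μ, amplitude μ F (r * s) y = amplitude μ F s (r⁻¹ • y) * √(rnCocycle μ r y) := by
  filter_upwards [translateDensity_mul hμ F r s] with y hy
  rw [amplitude, hy, translateDensity, Real.sqrt_mul' _ (rnCocycle_nonneg μ r y)]
  rfl

/-- The common left factor α(r, r⁻¹y) cancels in the argument of u. The two square roots of the
derivative of r_*μ multiply to the Jacobian of the substitution by r. -/
theorem twistedKernel_mul_mul (hμ : IsMeasureClassPreserving G μ) {F : X → ℝ} (hF : Measurable F)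
    {α : G × X → H} (hα : IsBorelCocycle μ α) {u : H → ℂ} (hu : Measurable u) (r s t : G) :
    twistedKernel μ F α u (r * s) (r * t) = twistedKernel μ F α u s t := by
  have hm : Measurable fun y => twistedIntegrand μ F α u s t y :=
    (measurable_twistedIntegrand μ hF hα.measurable hu).comp (measurable_prodMk_left (x := (s, t)))
  have h := integral_comp_smul hμ (w := fun y => twistedIntegrand μ F α u s t (r⁻¹ • y))
    (hm.comp (measurable_const_smul _)).stronglyMeasurable r
  simp only [inv_smul_smul] at h
  rw [twistedKernel, twistedKernel, h]
  refine integral_congr_ae ?_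
  filter_upwards [amplitude_mul hμ F r s, amplitude_mul hμ F r t, cocycleTo_mul hμ hα r s,
    cocycleTo_mul hμ hα r t] with y h1 h2 h3 h4
  have hD : ((√(rnCocycle μ r y) : ℝ) : ℂ) * (√(rnCocycle μ r y) : ℝ) = (rnCocycle μ r y : ℂ) := by
    rw [← Complex.ofReal_mul, Real.mul_self_sqrt (rnCocycle_nonneg μ r y)]
  simp only [twistedIntegrand, h1, h2, h3, h4, mul_inv_rev, mul_assoc, inv_mul_cancel_left,
    Complex.real_smul, ← hD, Complex.ofReal_mul]
  ring

theorem twistedKernel_eq (hμ : IsMeasureClassPreserving G μ) {F : X → ℝ} (hF : Measurable F)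
    {α : G × X → H} (hα : IsBorelCocycle μ α) {u : H → ℂ} (hu : Measurable u) (s t : G) :
    twistedKernel μ F α u s t = twistedKernel μ F α u (t⁻¹ * s) 1 := by
  simpa using twistedKernel_mul_mul hμ hF hα hu t (t⁻¹ * s) 1

theorem integral_translateDensity (hμ : IsMeasureClassPreserving G μ) {F : X → ℝ}
    (hF : Measurable F) (s : G) : ∫ y, translateDensity μ s F y ∂μ = ∫ x, F x ∂μ := by
  simpa using integral_translateDensity_mul hμ hF measurable_one s

theorem norm_twistedIntegrand_le {F : X → ℝ} (hF0 : ∀ x, 0 ≤ F x) {α : G × X → H}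
    {u : H → ℂ} {s t : G} {y : X} {C : ℝ}
    (hu : ‖u ((cocycleTo α t y)⁻¹ * cocycleTo α s y)‖ ≤ C) :
    ‖twistedIntegrand μ F α u s t y‖
      ≤ (translateDensity μ s F y + translateDensity μ t F y) / 2 * C := by
  have hp := mul_nonneg (amplitude_nonneg μ F s y) (amplitude_nonneg μ F t y)
  rw [twistedIntegrand, norm_mul, Complex.norm_real, Real.norm_of_nonneg hp]
  exact mul_le_mul (amplitude_mul_le μ hF0 s t y) hu (norm_nonneg _)
    (hp.trans (amplitude_mul_le μ hF0 s t y))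

theorem integrable_twistedIntegrand (hμ : IsMeasureClassPreserving G μ) {F : X → ℝ}
    (hF : Measurable F) (hF0 : ∀ x, 0 ≤ F x) (hFi : Integrable F μ) {α : G × X → H}
    (hα : Measurable α) {u : H → ℂ} (hu : Measurable u) {C : ℝ} (huC : ∀ x, ‖u x‖ ≤ C) (s t : G) :
    Integrable (fun y => twistedIntegrand μ F α u s t y) μ := by
  have i1 := integrable_translateDensity hμ hF hFi s
  have i2 := integrable_translateDensity hμ hF hFi t
  have i3 : Integrable
      (fun y => (translateDensity μ s F y + translateDensity μ t F y) / 2 * C) μ :=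
    ((i1.add i2).div_const 2).mul_const C
  have hsm : Measurable fun y => twistedIntegrand μ F α u s t y :=
    (measurable_twistedIntegrand μ hF hα hu).comp (measurable_prodMk_left (x := (s, t)))
  exact i3.mono' hsm.aestronglyMeasurable
    (Eventually.of_forall fun y => norm_twistedIntegrand_le hF0 (huC _))

/-- By the inequality of the means, the weight has total mass at most 1. The bound on u is only
needed where the weight is nonzero. -/
theorem norm_twistedKernel_le (hμ : IsMeasureClassPreserving G μ) {F : X → ℝ} (hF : Measurable F)
    (hF0 : ∀ x, 0 ≤ F x) (hFi : Integrable F μ) (hF1 : ∫ x, F x ∂μ ≤ 1) {α : G × X → H}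
    {u : H → ℂ} {s t : G} {δ : ℝ} (hδ0 : 0 ≤ δ)
    (hδ : ∀ᵐ y ∂μ, amplitude μ F s y * amplitude μ F t y ≠ 0 →
      ‖u ((cocycleTo α t y)⁻¹ * cocycleTo α s y)‖ ≤ δ) :
    ‖twistedKernel μ F α u s t‖ ≤ δ := by
  have i1 := integrable_translateDensity hμ hF hFi s
  have i2 := integrable_translateDensity hμ hF hFi t
  have hb : ∀ᵐ y ∂μ, ‖twistedIntegrand μ F α u s t y‖
      ≤ (translateDensity μ s F y + translateDensity μ t F y) / 2 * δ := by
    filter_upwards [hδ] with y hy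
    have hp := mul_nonneg (amplitude_nonneg μ F s y) (amplitude_nonneg μ F t y)
    by_cases h0 : amplitude μ F s y * amplitude μ F t y = 0
    · rw [twistedIntegrand, h0, Complex.ofReal_zero, zero_mul, norm_zero]
      exact mul_nonneg (hp.trans (amplitude_mul_le μ hF0 s t y)) hδ0
    · exact norm_twistedIntegrand_le hF0 (hy h0)
  refine (norm_integral_le_of_norm_le (((i1.add i2).div_const 2).mul_const δ) hb).trans ?_
  rw [integral_mul_const, integral_div]
  simp only [Pi.add_apply]
  rw [integral_add i1 i2, integral_translateDensity hμ hF, integral_translateDensity hμ hF]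
  nlinarith

/-- The twisted kernel is small outside the return set. -/
theorem norm_twistedKernel_le_of_notMem_returnSet (hμ : IsMeasureClassPreserving G μ) {F : X → ℝ}
    (hF : Measurable F) (hF0 : ∀ x, 0 ≤ F x) (hFi : Integrable F μ) (hF1 : ∫ x, F x ∂μ ≤ 1)
    {α : G × X → H} (hα : IsBorelCocycle μ α) {u : H → ℂ} (hu : Measurable u) {A : Set X}
    (hFA : ∀ x ∉ A, F x = 0) {L : Set H} {δ : ℝ} (hδ0 : 0 ≤ δ) (hδ : ∀ x ∉ L, ‖u x‖ ≤ δ) {s t : G}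
    (hst : t⁻¹ * s ∉ returnSet μ α A L) : ‖twistedKernel μ F α u s t‖ ≤ δ := by
  rw [twistedKernel_eq hμ hF hα hu]
  set g := t⁻¹ * s
  refine norm_twistedKernel_le hμ hF hF0 hFi hF1 hδ0 ?_
  -- At x = g⁻¹y, nonvanishing amplitudes put both x and gx = y in A, so α(g, x) ∈ L is excluded for
  -- almost every such point.
  have hnull : ∀ᵐ x ∂μ, ¬ (x ∈ A ∧ g • x ∈ A ∧ α (g, x) ∈ L) := by
    rw [ae_iff]
    simpa [returnSet] using hst
  filter_upwards [cocycleTo_one (G := G) hα, (quasiMeasurePreserving_smul hμ g⁻¹).ae hnull]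
    with y h1 hy hne
  rw [h1, inv_one, one_mul]
  refine hδ _ fun hL => hy ⟨?_, ?_, hL⟩
  · by_contra hA
    exact hne (by simp [amplitude, translateDensity, hFA _ hA])
  · rw [smul_inv_smul]
    by_contra hA
    exact hne (by simp [amplitude, translateDensity, hFA _ hA])

/-- The product pq lies between min(p², q²) and (p² + q²)/2, and both are controlled by a up to the
stated error. -/
theorem abs_mul_sub_le {p q a b a' b' : ℝ} (hp : 0 ≤ p) (hq : 0 ≤ q) (ha : p ^ 2 = a - a')
    (hb : q ^ 2 = b - b') (ha' : 0 ≤ a') (hb' : 0 ≤ b') : |p * q - a| ≤ |a - b| + a' + b' := by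
  have h1 := le_abs_self (a - b)
  have h2 := neg_abs_le (a - b)
  rw [abs_le]
  constructor
  · rcases le_total p q with h | h
    · nlinarith
    · nlinarith
  · nlinarith [sq_nonneg (p - q)]

/-- Write pqv − a = pq(v − 1) + (pq − a). Where v is not close to 1, p² or q² is bounded by the
small quantity m or n, and a weighted Young inequality bounds pq. -/
theorem norm_mul_sub_le_of_error {p q a b a' b' m n δ C : ℝ} {v : ℂ} (hp : 0 ≤ p) (hq : 0 ≤ q)
    (ha : p ^ 2 = a - a') (hb : q ^ 2 = b - b') (ha' : 0 ≤ a') (hb' : 0 ≤ b') (hm : 0 ≤ m)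
    (hn : 0 ≤ n) (hδ : 0 < δ) (hC : 0 ≤ C) (hv : ‖v - 1‖ ≤ C + 1)
    (h : ‖v - 1‖ ≤ δ ∨ p ^ 2 ≤ m ∨ q ^ 2 ≤ n) :
    ‖((p * q : ℝ) : ℂ) * v - (a : ℂ)‖ ≤ (δ + (C + 1) * δ) * ((p ^ 2 + q ^ 2) / 2)
      + (C + 1) * δ⁻¹ * ((m + n) / 2) + |a - b| + a' + b' := by
  have hδi : 0 < δ⁻¹ := inv_pos.2 hδ
  have hpq0 : 0 ≤ p * q := mul_nonneg hp hq
  have hpq : p * q ≤ (p ^ 2 + q ^ 2) / 2 := by nlinarith [sq_nonneg (p - q)]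
  have he1 : 0 ≤ (p ^ 2 + q ^ 2) / 2 := by positivity
  have he2 : 0 ≤ (m + n) / 2 := by positivity
  have hsplit : ((p * q : ℝ) : ℂ) * v - (a : ℂ)
      = ((p * q : ℝ) : ℂ) * (v - 1) + ((p * q - a : ℝ) : ℂ) := by
    push_cast
    ring
  have h1 : ‖((p * q - a : ℝ) : ℂ)‖ ≤ |a - b| + a' + b' := by
    rw [Complex.norm_real, Real.norm_eq_abs]
    exact abs_mul_sub_le hp hq ha hb ha' hb'
  -- The small factor carries the weight δ⁻¹. This is why the f-mass off A' is later required to be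
  -- at most δ² and not only δ.
  have key : ∀ {c d : ℝ}, c * d ≤ δ * (c ^ 2 / 2) + δ⁻¹ * (d ^ 2 / 2) := by
    intro c d
    have h0 := mul_nonneg hδi.le (sq_nonneg (δ * c - d))
    have h4 : δ⁻¹ * (δ * c - d) ^ 2 = δ * c ^ 2 - 2 * (c * d) + δ⁻¹ * d ^ 2 := by
      field_simp
      ring
    linarith
  have h2 : p * q * ‖v - 1‖ ≤ (δ + (C + 1) * δ) * ((p ^ 2 + q ^ 2) / 2)
      + (C + 1) * δ⁻¹ * ((m + n) / 2) := by
    have hbad : p * q ≤ δ * ((p ^ 2 + q ^ 2) / 2) + δ⁻¹ * ((m + n) / 2) →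
        p * q * ‖v - 1‖ ≤ (δ + (C + 1) * δ) * ((p ^ 2 + q ^ 2) / 2)
          + (C + 1) * δ⁻¹ * ((m + n) / 2) := by
      intro h
      have h5 := mul_le_mul h hv (norm_nonneg _) (by positivity)
      have h6 := mul_nonneg hδ.le he1
      linarith
    have hp' : 0 ≤ δ * (p ^ 2 / 2) := by positivity
    have hq' : 0 ≤ δ * (q ^ 2 / 2) := by positivity
    have hm' : 0 ≤ δ⁻¹ * (m / 2) := by positivity
    have hn' : 0 ≤ δ⁻¹ * (n / 2) := by positivity
    rcases h with h | h | h
    · have h5 := mul_le_mul hpq h (norm_nonneg _) he1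
      have h6 : 0 ≤ (C + 1) * δ * ((p ^ 2 + q ^ 2) / 2) := by positivity
      have h7 : 0 ≤ (C + 1) * δ⁻¹ * ((m + n) / 2) := by positivity
      linarith
    · refine hbad ?_
      have h6 := key (c := q) (d := p)
      have h7 : δ⁻¹ * (p ^ 2 / 2) ≤ δ⁻¹ * (m / 2) := by gcongr
      linarith
    · refine hbad ?_
      have h6 := key (c := p) (d := q)
      have h7 : δ⁻¹ * (q ^ 2 / 2) ≤ δ⁻¹ * (n / 2) := by gcongr
      linarith
  rw [hsplit]
  refine (norm_add_le _ _).trans ?_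
  rw [norm_mul, Complex.norm_real, Real.norm_of_nonneg hpq0]
  linarith

/-- The twisted kernel is close to `1` for almost invariant densities. -/
theorem norm_twistedKernel_sub_one_le (hμ : IsMeasureClassPreserving G μ) {f : X → ℝ}
    (hf : IsDensity μ f) {α : G × X → H} (hα : Measurable α) {u : H → ℂ} (hu : Measurable u)
    {A A' : Set X} (hA : MeasurableSet A) (hA' : MeasurableSet A') {δ C : ℝ} (hδ : 0 < δ)
    (hC : 0 ≤ C) (huC : ∀ x, ‖u x‖ ≤ C) (hfA : ∫ x in Aᶜ, f x ∂μ ≤ δ)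
    (hfA' : ∫ x in A'ᶜ, f x ∂μ ≤ δ ^ 2) {s t : G}
    (hs : ∫ y, |translateDensity μ s f y - f y| ∂μ ≤ δ)
    (ht : ∫ y, |translateDensity μ t f y - f y| ∂μ ≤ δ)
    (hst : ∀ x ∈ A', ∀ x' ∈ A', ‖u ((α (t, x))⁻¹ * α (s, x')) - 1‖ ≤ δ) :
    ‖twistedKernel μ (A.indicator f) α u s t - 1‖ ≤ (2 * C + 7) * δ := by
  set F := A.indicator f
  have hfm := hf.measurable
  have hfi := hf.integrable
  have hFm : Measurable F := hfm.indicator hA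
  have hF0 : ∀ x, 0 ≤ F x := fun x => Set.indicator_nonneg (fun x _ => hf.nonneg x) x
  have hFi : Integrable F μ := hfi.indicator hA
  have hF1 : ∫ x, F x ∂μ ≤ 1 := by
    rw [← hf.integral_eq_one]
    exact integral_mono hFi hfi fun x => Set.indicator_le_self' (fun x _ => hf.nonneg x) x
  -- Here a is the part of f lost by restricting to A, and n is the part sitting where the cocycle
  -- is not controlled.
  let a : X → ℝ := Aᶜ.indicator f
  let n : X → ℝ := A'ᶜ.indicator f
  have ham : Measurable a := hfm.indicator hA.compl
  have hai : Integrable a μ := hfi.indicator hA.compl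
  have ha0 : ∀ x, 0 ≤ a x := fun x => Set.indicator_nonneg (fun x _ => hf.nonneg x) x
  have ha1 : ∫ x, a x ∂μ ≤ δ := by rwa [integral_indicator hA.compl]
  have hnm : Measurable n := hfm.indicator hA'.compl
  have hni : Integrable n μ := hfi.indicator hA'.compl
  have hn0 : ∀ x, 0 ≤ n x := fun x => Set.indicator_nonneg (fun x _ => hf.nonneg x) x
  have hn1 : ∫ x, n x ∂μ ≤ δ ^ 2 := by rwa [integral_indicator hA'.compl]
  let T : G → (X → ℝ) → X → ℝ := translateDensity μ
  have hTF : ∀ r y, T r F y = T r f y - T r a y := fun r y => by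
    simp only [T, translateDensity, F, a]
    by_cases h : r⁻¹ • y ∈ A <;> simp [h]
  have hT0 : ∀ {k : X → ℝ}, (∀ x, 0 ≤ k x) → ∀ (r : G) y, 0 ≤ T r k y := fun hk r y =>
    translateDensity_nonneg μ hk r y
  have hTi : ∀ {k : X → ℝ}, Measurable k → Integrable k μ → ∀ r : G, Integrable (T r k) μ :=
    fun hk hki r => integrable_translateDensity hμ hk hki r
  have hTe : ∀ {k : X → ℝ}, Measurable k → ∀ r : G, ∫ y, T r k y ∂μ = ∫ x, k x ∂μ :=
    fun hk r => integral_translateDensity hμ hk r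
  have hTn : ∀ (r : G) y, r⁻¹ • y ∉ A' → T r F y ≤ T r n y := fun r y h => by
    simp only [T, translateDensity, n]
    refine mul_le_mul_of_nonneg_right ?_ (rnCocycle_nonneg μ r y)
    rw [Set.indicator_of_mem (by simpa using h)]
    exact Set.indicator_le_self' (fun x _ => hf.nonneg x) _
  -- the four contributions to the error
  let e1 : X → ℝ := fun y => (T s F y + T t F y) / 2
  let e2 : X → ℝ := fun y => (T s n y + T t n y) / 2
  let e3 : X → ℝ := fun y => |T s f y - f y| + |T t f y - f y|
  let e4 : X → ℝ := fun y => T s a y + T t a y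
  have hb : ∀ y, ‖twistedIntegrand μ F α u s t y - (T s f y : ℂ)‖
      ≤ (δ + (C + 1) * δ) * e1 y + (C + 1) * δ⁻¹ * e2 y + e3 y + e4 y := by
    intro y
    set p := amplitude μ F s y
    set q := amplitude μ F t y
    have hp : 0 ≤ p := amplitude_nonneg μ F s y
    have hq : 0 ≤ q := amplitude_nonneg μ F t y
    have hp2 : p ^ 2 = T s F y := amplitude_sq μ hF0 s y
    have hq2 : q ^ 2 = T t F y := amplitude_sq μ hF0 t y
    set v := u ((cocycleTo α t y)⁻¹ * cocycleTo α s y)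
    have hv1 : ‖v - 1‖ ≤ C + 1 := (norm_sub_le _ _).trans (by simpa using huC _)
    have h := norm_mul_sub_le_of_error hp hq (hp2.trans (hTF s y)) (hq2.trans (hTF t y))
      (hT0 ha0 s y) (hT0 ha0 t y) (hT0 hn0 s y) (hT0 hn0 t y) hδ hC hv1 (by
        by_cases h1 : s⁻¹ • y ∈ A'
        · by_cases h2 : t⁻¹ • y ∈ A'
          · exact Or.inl (hst _ h2 _ h1)
          · exact Or.inr (Or.inr (hq2.trans_le (hTn t y h2)))
        · exact Or.inr (Or.inl (hp2.trans_le (hTn s y h1))))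
    have h3 : |T s f y - T t f y| ≤ |T s f y - f y| + |T t f y - f y| := by
      rw [abs_sub_comm (T t f y)]
      exact abs_sub_le _ _ _
    rw [hp2, hq2] at h
    rw [twistedIntegrand]
    simp only [e1, e2, e3, e4]
    linarith
  have i1 : Integrable e1 μ := ((hTi hFm hFi s).add (hTi hFm hFi t)).div_const 2
  have i2 : Integrable e2 μ := ((hTi hnm hni s).add (hTi hnm hni t)).div_const 2
  have i3 : Integrable e3 μ := ((hTi hfm hfi s).sub hfi).abs.add ((hTi hfm hfi t).sub hfi).abs
  have i4 : Integrable e4 μ := (hTi ham hai s).add (hTi ham hai t)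
  have j1 : ∫ y, e1 y ∂μ ≤ 1 := by
    simp only [e1]
    rw [integral_div, integral_add (hTi hFm hFi s) (hTi hFm hFi t), hTe hFm, hTe hFm]
    linarith
  have j2 : ∫ y, e2 y ∂μ ≤ δ ^ 2 := by
    simp only [e2]
    rw [integral_div, integral_add (hTi hnm hni s) (hTi hnm hni t), hTe hnm, hTe hnm]
    linarith
  have j3 : ∫ y, e3 y ∂μ ≤ 2 * δ := by
    have h3 : ∀ r : G, Integrable (fun y => |T r f y - f y|) μ :=
      fun r => ((hTi hfm hfi r).sub hfi).abs
    simp only [e3]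
    rw [integral_add (h3 s) (h3 t)]
    simp only [T]
    linarith
  have j4 : ∫ y, e4 y ∂μ ≤ 2 * δ := by
    simp only [e4]
    rw [integral_add (hTi ham hai s) (hTi ham hai t), hTe ham, hTe ham]
    linarith
  have hint := integrable_twistedIntegrand hμ hFm hF0 hFi hα hu huC s t
  -- The constant 1 is written as the mass of s_*f, so that the two sides can be compared under the
  -- integral.
  have hone : (1 : ℂ) = ∫ y, (T s f y : ℂ) ∂μ := by
    rw [integral_complex_ofReal, hTe hfm, hf.integral_eq_one, Complex.ofReal_one]
  have hre : Integrable (fun y => (T s f y : ℂ)) μ := (hTi hfm hfi s).ofReal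
  rw [hone, twistedKernel, ← integral_sub hint hre]
  have m1 : Integrable (fun y => (δ + (C + 1) * δ) * e1 y) μ := i1.const_mul _
  have m2 : Integrable (fun y => (C + 1) * δ⁻¹ * e2 y) μ := i2.const_mul _
  have m12 : Integrable (fun y => (δ + (C + 1) * δ) * e1 y + (C + 1) * δ⁻¹ * e2 y) μ := m1.add m2
  have m123 : Integrable (fun y => (δ + (C + 1) * δ) * e1 y + (C + 1) * δ⁻¹ * e2 y + e3 y) μ :=
    m12.add i3
  have m1234 : Integrable
      (fun y => (δ + (C + 1) * δ) * e1 y + (C + 1) * δ⁻¹ * e2 y + e3 y + e4 y) μ := m123.add i4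
  have hle := norm_integral_le_of_norm_le m1234 (Eventually.of_forall hb)
  rw [integral_add m123 i4, integral_add m12 i3, integral_add m1 m2, integral_const_mul,
    integral_const_mul] at hle
  refine hle.trans ?_
  have k1 : (δ + (C + 1) * δ) * ∫ y, e1 y ∂μ ≤ (δ + (C + 1) * δ) * 1 :=
    mul_le_mul_of_nonneg_left j1 (by positivity)
  have k2 : (C + 1) * δ⁻¹ * ∫ y, e2 y ∂μ ≤ (C + 1) * δ := by
    refine (mul_le_mul_of_nonneg_left j2 (by positivity)).trans_eq ?_
    field_simp
  -- The sum is (1 + (C + 1)) + (C + 1) + 2 + 2 = 2C + 7 times δ.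
  linarith

end TwistedKernel

/-- The quadratic polynomial t ↦ ∫ θ(p − t)² is nonnegative, so its discriminant is at most 0. -/
theorem sq_integral_mul_le {Y : Type*} [MeasurableSpace Y] {ν : Measure Y} {θ p : Y → ℝ}
    (hθ : Integrable θ ν) (h1 : Integrable (fun y => θ y * p y) ν)
    (h2 : Integrable (fun y => θ y * p y ^ 2) ν) (h0 : ∀ y, 0 ≤ θ y) :
    (∫ y, θ y * p y ∂ν) ^ 2 ≤ (∫ y, θ y ∂ν) * ∫ y, θ y * p y ^ 2 ∂ν := by
  have key : ∀ t : ℝ, 0 ≤ (∫ y, θ y ∂ν) * (t * t) + (-2 * ∫ y, θ y * p y ∂ν) * t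
      + ∫ y, θ y * p y ^ 2 ∂ν := by
    intro t
    have hpos : 0 ≤ ∫ y, θ y * (p y - t) ^ 2 ∂ν :=
      integral_nonneg fun y => mul_nonneg (h0 y) (sq_nonneg _)
    have he : ∀ y, θ y * (p y - t) ^ 2
        = t * t * θ y + (-2 * t) * (θ y * p y) + θ y * p y ^ 2 := fun y => by ring
    have i1 : Integrable (fun y => t * t * θ y) ν := hθ.const_mul _
    have i2 : Integrable (fun y => (-2 * t) * (θ y * p y)) ν := h1.const_mul _
    have i12 : Integrable (fun y => t * t * θ y + (-2 * t) * (θ y * p y)) ν := i1.add i2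
    simp only [he] at hpos
    rw [integral_add i12 h2, integral_add i1 i2, integral_const_mul, integral_const_mul] at hpos
    linarith
  have := discrim_le_zero key
  rw [discrim] at this
  linarith

/-! ### Norm continuous maps into L²(X, E) -/

section AveragedVectors

variable {G H X : Type*} [Group G] [TopologicalSpace G] [IsTopologicalGroup G]
  [LocallyCompactSpace G] [SecondCountableTopology G] [MeasurableSpace G] [BorelSpace G]
  [MulAction G X] [MeasurableSpace X] [MeasurableSMul₂ G X] [StandardBorelSpace X]
  [Group H] [TopologicalSpace H] [IsTopologicalGroup H] [SecondCountableTopology H]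
  [MeasurableSpace H] [BorelSpace H]
  {E : Type*} [NormedAddCommGroup E] [InnerProductSpace ℂ E] [CompleteSpace E]
  {μ : Measure X} {F : X → ℝ} {α : G × X → H}

/-- The vector field `∫ θ(l) √(d(l_* Fμ)/dμ) ξ(α(l, l⁻¹ y)) dl`. -/
def averagedVector (μ : Measure X) (F : X → ℝ) (α : G × X → H) (θ : G → ℝ) (ξ : H → E) (y : X) :
    E :=
  ∫ l, ((θ l * amplitude μ F l y : ℝ) : ℂ) • ξ (cocycleTo α l y) ∂(Measure.haar : Measure G)

theorem stronglyMeasurable_smul_amplitude (hF : Measurable F) (hα : Measurable α) {θ : G → ℝ}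
    (hθ : Measurable θ) {ξ : H → E} (hξ : Continuous ξ) :
    StronglyMeasurable fun p : G × X =>
      ((θ p.1 * amplitude μ F p.1 p.2 : ℝ) : ℂ) • ξ (cocycleTo α p.1 p.2) := by
  have h1 : Measurable fun p : G × X => ((θ p.1 * amplitude μ F p.1 p.2 : ℝ) : ℂ) :=
    Complex.measurable_ofReal.comp ((hθ.comp measurable_fst).mul (measurable_amplitude μ hF))
  exact h1.stronglyMeasurable.smul
    (hξ.stronglyMeasurable.comp_measurable (measurable_cocycleTo hα))

theorem stronglyMeasurable_averagedVector (hF : Measurable F) (hα : Measurable α) {θ : G → ℝ}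
    (hθ : Measurable θ) {ξ : H → E} (hξ : Continuous ξ) :
    StronglyMeasurable (averagedVector μ F α θ ξ) :=
  ((stronglyMeasurable_smul_amplitude hF hα hθ hξ).comp_measurable
    measurable_swap).integral_prod_right' (ν := (Measure.haar : Measure G))

variable [IsProbabilityMeasure μ]

/-- The amplitude is at most 1 plus its square, the translated density, which is integrable against
|θ|. -/
theorem integrable_mul_amplitude (hμ : IsMeasureClassPreserving G μ) (hF : Measurable F)
    (hF0 : ∀ x, 0 ≤ F x) (hFi : Integrable F μ) {θ : G → ℝ} (hθm : Measurable θ)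
    (hθ : Integrable θ (Measure.haar : Measure G)) :
    Integrable (fun p : G × X => θ p.1 * amplitude μ F p.1 p.2)
      ((Measure.haar : Measure G).prod μ) := by
  have h1 : Integrable (fun p : G × X => |θ p.1| * (1 : ℝ)) ((Measure.haar : Measure G).prod μ) :=
    hθ.abs.mul_prod (integrable_const 1)
  have h2 := integrable_mul_translateDensity hμ hθm.abs hθ.abs hF hFi
  refine (h1.add h2).mono' ((hθm.comp measurable_fst).mul
    (measurable_amplitude μ hF)).aestronglyMeasurable (Eventually.of_forall fun p => ?_)
  rw [norm_mul, Real.norm_eq_abs, Real.norm_of_nonneg (amplitude_nonneg μ F p.1 p.2)]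
  simp only [Pi.add_apply, ← mul_add]
  refine mul_le_mul_of_nonneg_left ?_ (abs_nonneg _)
  rw [← amplitude_sq μ hF0]
  nlinarith [sq_nonneg (amplitude μ F p.1 p.2 - 1), sq_nonneg (amplitude μ F p.1 p.2 + 1)]

theorem ae_integrable_smul_amplitude (hμ : IsMeasureClassPreserving G μ) (hF : Measurable F)
    (hF0 : ∀ x, 0 ≤ F x) (hFi : Integrable F μ) (hα : Measurable α) {θ : G → ℝ}
    (hθm : Measurable θ) (hθ : Integrable θ (Measure.haar : Measure G)) {ξ : H → E}
    (hξ : Continuous ξ) {c : ℝ} (hξc : ∀ x, ‖ξ x‖ ≤ c) :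
    ∀ᵐ y ∂μ, Integrable (fun l => ((θ l * amplitude μ F l y : ℝ) : ℂ) • ξ (cocycleTo α l y))
      (Measure.haar : Measure G) := by
  filter_upwards [(integrable_mul_amplitude hμ hF hF0 hFi hθm hθ).prod_left_ae] with y hy
  refine (hy.abs.mul_const c).mono' ((stronglyMeasurable_smul_amplitude hF hα hθm
    hξ).comp_measurable measurable_prodMk_right).aestronglyMeasurable
    (Eventually.of_forall fun l => ?_)
  rw [norm_smul, Complex.norm_real, Real.norm_eq_abs]
  exact mul_le_mul_of_nonneg_left (hξc _) (abs_nonneg _)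

theorem averagedVector_sub (hμ : IsMeasureClassPreserving G μ) (hF : Measurable F)
    (hF0 : ∀ x, 0 ≤ F x) (hFi : Integrable F μ) (hα : Measurable α) {θ θ' : G → ℝ}
    (hθm : Measurable θ) (hθ : Integrable θ (Measure.haar : Measure G)) (hθm' : Measurable θ')
    (hθ' : Integrable θ' (Measure.haar : Measure G)) {ξ : H → E}
    (hξ : Continuous ξ) {c : ℝ} (hξc : ∀ x, ‖ξ x‖ ≤ c) :
    ∀ᵐ y ∂μ, averagedVector μ F α (fun l => θ l - θ' l) ξ y
      = averagedVector μ F α θ ξ y - averagedVector μ F α θ' ξ y := by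
  filter_upwards [ae_integrable_smul_amplitude hμ hF hF0 hFi hα hθm hθ hξ hξc,
    ae_integrable_smul_amplitude hμ hF hF0 hFi hα hθm' hθ' hξ hξc] with y h1 h2
  simp only [averagedVector]
  rw [← integral_sub h1 h2]
  refine integral_congr_ae (Eventually.of_forall fun l => ?_)
  simp only
  rw [← sub_smul, sub_mul, Complex.ofReal_sub]

/-- This is the Cauchy–Schwarz inequality for the weight |θ|, which replaces amplitudes by their
squares, the densities. -/
theorem norm_averagedVector_sq_le (hμ : IsMeasureClassPreserving G μ) (hF : Measurable F)
    (hF0 : ∀ x, 0 ≤ F x) (hFi : Integrable F μ) {θ : G → ℝ}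
    (hθm : Measurable θ) (hθ : Integrable θ (Measure.haar : Measure G)) {ξ : H → E}
    {c : ℝ} (hξc : ∀ x, ‖ξ x‖ ≤ c) :
    ∀ᵐ y ∂μ, ‖averagedVector μ F α θ ξ y‖ ^ 2
      ≤ c ^ 2 * (∫ k, |θ k| ∂(Measure.haar : Measure G)) * smoothDensity μ (fun k => |θ k|) F y := by
  filter_upwards [(integrable_mul_amplitude hμ hF hF0 hFi hθm.abs hθ.abs).prod_left_ae,
    ae_integrable_mul_translateDensity hμ hθm.abs hθ.abs hF hFi] with y h1 h2
  have hn : ‖averagedVector μ F α θ ξ y‖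
      ≤ (∫ l, |θ l| * amplitude μ F l y ∂(Measure.haar : Measure G)) * c := by
    rw [← integral_mul_const]
    refine norm_integral_le_of_norm_le (h1.mul_const c) (Eventually.of_forall fun l => ?_)
    rw [norm_smul, Complex.norm_real, norm_mul, Real.norm_eq_abs,
      Real.norm_of_nonneg (amplitude_nonneg μ F l y)]
    exact mul_le_mul_of_nonneg_left (hξc _) (mul_nonneg (abs_nonneg _) (amplitude_nonneg μ F l y))
  have hcs := sq_integral_mul_le (p := fun l => amplitude μ F l y) hθ.abs h1
    (by simpa only [amplitude_sq μ hF0] using h2) (fun _ => abs_nonneg _)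
  simp only [amplitude_sq μ hF0] at hcs
  calc ‖averagedVector μ F α θ ξ y‖ ^ 2
      ≤ ((∫ l, |θ l| * amplitude μ F l y ∂(Measure.haar : Measure G)) * c) ^ 2 := by gcongr
    _ = c ^ 2 * (∫ l, |θ l| * amplitude μ F l y ∂(Measure.haar : Measure G)) ^ 2 := by ring
    _ ≤ c ^ 2 * ((∫ k, |θ k| ∂(Measure.haar : Measure G)) * smoothDensity μ (fun k => |θ k|) F y) :=
        mul_le_mul_of_nonneg_left hcs (sq_nonneg c)
    _ = _ := by ring

theorem integral_smoothDensity (hμ : IsMeasureClassPreserving G μ) {θ : G → ℝ}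
    (hθm : Measurable θ) (hθ : Integrable θ (Measure.haar : Measure G)) (hF : Measurable F)
    (hFi : Integrable F μ) :
    ∫ y, smoothDensity μ θ F y ∂μ = (∫ k, θ k ∂(Measure.haar : Measure G)) * ∫ x, F x ∂μ := by
  have h := integral_smoothDensity_mul hμ hθm hθ hF hFi (isBddMeasurable_const 1)
  simp only [orbitAverage, mul_one, integral_mul_const] at h
  rw [h, mul_comm]

/-- Integrating the pointwise bound costs no constant, since F has mass at most 1. Linearity of the
estimate in the L¹-norm of θ later gives both the norm bound and the continuity of the transferred
vectors. -/
theorem memLp_averagedVector (hμ : IsMeasureClassPreserving G μ) (hF : Measurable F)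
    (hF0 : ∀ x, 0 ≤ F x) (hFi : Integrable F μ) (hF1 : ∫ x, F x ∂μ ≤ 1) (hα : Measurable α)
    {θ : G → ℝ} (hθm : Measurable θ) (hθ : Integrable θ (Measure.haar : Measure G)) {ξ : H → E}
    (hξ : Continuous ξ) {c : ℝ} (hξc : ∀ x, ‖ξ x‖ ≤ c) :
    ∃ h : MemLp (averagedVector μ F α θ ξ) 2 μ,
      ‖h.toLp _‖ ≤ c * ∫ k, |θ k| ∂(Measure.haar : Measure G) := by
  have hc : 0 ≤ c := (norm_nonneg _).trans (hξc 1)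
  have hN : 0 ≤ ∫ k, |θ k| ∂(Measure.haar : Measure G) := integral_nonneg fun _ => abs_nonneg _
  have hm := stronglyMeasurable_averagedVector (μ := μ) hF hα hθm hξ
  have hb := norm_averagedVector_sq_le (α := α) hμ hF hF0 hFi hθm hθ hξc
  have hsi : Integrable (fun y => c ^ 2 * (∫ k, |θ k| ∂(Measure.haar : Measure G))
      * smoothDensity μ (fun k => |θ k|) F y) μ :=
    (integrable_smoothDensity hμ hθm.abs hθ.abs hF hFi).const_mul _
  have hsq : Integrable (fun y => ‖averagedVector μ F α θ ξ y‖ ^ 2) μ := by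
    refine hsi.mono' (hm.norm.pow 2).aestronglyMeasurable ?_
    filter_upwards [hb] with y hy
    rwa [Real.norm_of_nonneg (sq_nonneg _)]
  have hL : MemLp (averagedVector μ F α θ ξ) 2 μ :=
    (memLp_two_iff_integrable_sq_norm hm.aestronglyMeasurable).2 hsq
  refine ⟨hL, ?_⟩
  have hnorm : ‖hL.toLp _‖ ^ 2 = ∫ y, ‖averagedVector μ F α θ ξ y‖ ^ 2 ∂μ := by
    have h := L2.inner_def (𝕜 := ℂ) (hL.toLp _) (hL.toLp _)
    rw [inner_self_eq_norm_sq_to_K] at h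
    have h' : ∫ y, inner ℂ (hL.toLp _ y) (hL.toLp _ y) ∂μ
        = ∫ y, ((‖averagedVector μ F α θ ξ y‖ ^ 2 : ℝ) : ℂ) ∂μ := by
      refine integral_congr_ae ?_
      filter_upwards [hL.coeFn_toLp] with y hy
      rw [hy, inner_self_eq_norm_sq_to_K]
      simp
    rw [h', integral_complex_ofReal] at h
    have h2 : ((‖hL.toLp _‖ ^ 2 : ℝ) : ℂ)
        = ((∫ y, ‖averagedVector μ F α θ ξ y‖ ^ 2 ∂μ : ℝ) : ℂ) := by
      rw [← h]; simp
    exact_mod_cast h2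
  refine le_of_sq_le_sq ?_ (mul_nonneg hc hN)
  rw [hnorm]
  refine (integral_mono_ae hsq hsi hb).trans ?_
  rw [integral_const_mul, integral_smoothDensity hμ hθm.abs hθ.abs hF hFi]
  have hF1' : 0 ≤ ∫ x, F x ∂μ := integral_nonneg hF0
  calc c ^ 2 * (∫ k, |θ k| ∂(Measure.haar : Measure G))
        * ((∫ k, |θ k| ∂(Measure.haar : Measure G)) * ∫ x, F x ∂μ)
      = (c * ∫ k, |θ k| ∂(Measure.haar : Measure G)) ^ 2 * ∫ x, F x ∂μ := by ring
    _ ≤ (c * ∫ k, |θ k| ∂(Measure.haar : Measure G)) ^ 2 * 1 :=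
        mul_le_mul_of_nonneg_left hF1 (sq_nonneg _)
    _ = _ := mul_one _

/-- Expanding both averages, the inner products of ξ with η reassemble into u along the cocycle;
Fubini then carries out the integration over X first. -/
theorem integral_inner_averagedVector (hμ : IsMeasureClassPreserving G μ) (hF : Measurable F)
    (hF0 : ∀ x, 0 ≤ F x) (hFi : Integrable F μ) (hα : Measurable α)
    {θ θ' : G → ℝ} (hθm : Measurable θ) (hθ : Integrable θ (Measure.haar : Measure G))
    (hθm' : Measurable θ') (hθ' : Integrable θ' (Measure.haar : Measure G)) {ξ η : H → E}
    (hξ : Continuous ξ) (hη : Continuous η) {c d : ℝ} (hξc : ∀ x, ‖ξ x‖ ≤ c)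
    (hηd : ∀ x, ‖η x‖ ≤ d) {u : H → ℂ} (hum : Measurable u) {C : ℝ} (huC : ∀ x, ‖u x‖ ≤ C)
    (hu : ∀ x x' : H, u (x'⁻¹ * x) = inner ℂ (η x') (ξ x)) :
    ∫ y, inner ℂ (averagedVector μ F α θ' η y) (averagedVector μ F α θ ξ y) ∂μ
      = ∫ p : G × G, ((θ' p.1 * θ p.2 : ℝ) : ℂ) * twistedKernel μ F α u p.2 p.1
        ∂((Measure.haar : Measure G).prod Measure.haar) := by
  let T : (G × G) × X → ℂ := fun q =>
    ((θ' q.1.1 * θ q.1.2 : ℝ) : ℂ) * twistedIntegrand μ F α u q.1.2 q.1.1 q.2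
  have hTm : Measurable T := by
    have h1 : Measurable fun q : (G × G) × X => ((θ' q.1.1 * θ q.1.2 : ℝ) : ℂ) :=
      Complex.measurable_ofReal.comp ((hθm'.comp (measurable_fst.comp measurable_fst)).mul
        (hθm.comp (measurable_snd.comp measurable_fst)))
    have h2 := (measurable_twistedIntegrand (G := G) μ hF hα hum).comp
      (((measurable_snd.comp measurable_fst).prodMk (measurable_fst.comp measurable_fst)).prodMk
        measurable_snd : Measurable fun q : (G × G) × X => ((q.1.2, q.1.1), q.2))
    exact h1.mul h2
  have hTI : Integrable T (((Measure.haar : Measure G).prod Measure.haar).prod μ) := by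
    rw [integrable_prod_iff hTm.aestronglyMeasurable]
    refine ⟨Eventually.of_forall fun p =>
      (integrable_twistedIntegrand hμ hF hF0 hFi hα hum huC p.2 p.1).const_mul
        ((θ' p.1 * θ p.2 : ℝ) : ℂ), ?_⟩
    have hB : Integrable (fun p : G × G => |θ' p.1| * |θ p.2| * ((∫ x, F x ∂μ) * C))
        ((Measure.haar : Measure G).prod Measure.haar) := (hθ'.abs.mul_prod hθ.abs).mul_const _
    refine hB.mono' hTm.stronglyMeasurable.norm.integral_prod_right'.aestronglyMeasurable
      (Eventually.of_forall fun p => ?_)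
    rw [Real.norm_of_nonneg (integral_nonneg fun _ => norm_nonneg _)]
    simp only [T, norm_mul, Complex.norm_real, Real.norm_eq_abs, integral_const_mul]
    refine mul_le_mul_of_nonneg_left ?_ (mul_nonneg (abs_nonneg _) (abs_nonneg _))
    have i1 := integrable_translateDensity hμ hF hFi p.1
    have i2 := integrable_translateDensity hμ hF hFi p.2
    have i3 : Integrable (fun y => (translateDensity μ p.2 F y + translateDensity μ p.1 F y) / 2
      * C) μ := ((i2.add i1).div_const 2).mul_const C
    refine (integral_mono (integrable_twistedIntegrand hμ hF hF0 hFi hα hum huC p.2 p.1).norm i3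
      fun y => norm_twistedIntegrand_le hF0 (huC _)).trans_eq ?_
    rw [integral_mul_const, integral_div, integral_add i2 i1, integral_translateDensity hμ hF,
      integral_translateDensity hμ hF]
    ring
  have hpt : ∀ᵐ y ∂μ, inner ℂ (averagedVector μ F α θ' η y) (averagedVector μ F α θ ξ y)
      = ∫ p, T (p, y) ∂((Measure.haar : Measure G).prod Measure.haar) := by
    filter_upwards [hTI.prod_left_ae, ae_integrable_smul_amplitude hμ hF hF0 hFi hα hθm hθ hξ hξc,
      ae_integrable_smul_amplitude hμ hF hF0 hFi hα hθm' hθ' hη hηd] with y h1 h2 h3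
    have hη' : averagedVector μ F α θ' η y = ∫ l, ((θ' l * amplitude μ F l y : ℝ) : ℂ) •
      η (cocycleTo α l y) ∂(Measure.haar : Measure G) := rfl
    rw [integral_prod _ h1, ← inner_conj_symm, hη', ← integral_inner h3, ← integral_conj]
    refine integral_congr_ae (Eventually.of_forall fun k => ?_)
    simp only
    rw [inner_conj_symm, averagedVector, ← integral_inner h2]
    refine integral_congr_ae (Eventually.of_forall fun l => ?_)
    simp only [T, twistedIntegrand, inner_smul_left, inner_smul_right, hu, Complex.conj_ofReal]
    push_cast
    ring
  rw [integral_congr_ae hpt]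
  rw [← integral_integral_swap (f := fun p y => T (p, y)) hTI]
  refine integral_congr_ae (Eventually.of_forall fun p => ?_)
  simp only [T, integral_const_mul, twistedKernel]

/-- The function on `G` obtained by transferring `u` along the cocycle and regularizing by `ψ`. -/
def transferredFun (μ : Measure X) (F : X → ℝ) (α : G × X → H) (ψ : G → ℝ) (u : H → ℂ) (g : G) :
    ℂ :=
  ∫ p : G × G, ((ψ p.1 * ψ p.2 : ℝ) : ℂ) * twistedKernel μ F α u (g * p.2) p.1
    ∂((Measure.haar : Measure G).prod Measure.haar)

open Classical in
/-- The map `g ↦ averagedVector (ψ (g⁻¹ ·)) ξ` into `L²(X, E)`. -/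
def transferredMap (μ : Measure X) (F : X → ℝ) (α : G × X → H) (ψ : G → ℝ) (ξ : H → E) (g : G) :
    Lp E 2 μ :=
  if h : MemLp (averagedVector μ F α (fun l => ψ (g⁻¹ * l)) ξ) 2 μ then h.toLp _ else 0

theorem transferredMap_coe (hμ : IsMeasureClassPreserving G μ) (hF : Measurable F)
    (hF0 : ∀ x, 0 ≤ F x) (hFi : Integrable F μ) (hF1 : ∫ x, F x ∂μ ≤ 1) (hα : Measurable α)
    {ψ : G → ℝ} (hψ : Continuous ψ) (hψs : HasCompactSupport ψ) {ξ : H → E}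
    (hξ : Continuous ξ) {c : ℝ} (hξc : ∀ x, ‖ξ x‖ ≤ c) (g : G) :
    transferredMap μ F α ψ ξ g =ᵐ[μ] averagedVector μ F α (fun l => ψ (g⁻¹ * l)) ξ := by
  have hψI : Integrable ψ (Measure.haar : Measure G) := hψ.integrable_of_hasCompactSupport hψs
  have hm : Measurable fun l => ψ (g⁻¹ * l) := (hψ.comp (continuous_const_mul g⁻¹)).measurable
  obtain ⟨h, -⟩ := memLp_averagedVector hμ hF hF0 hFi hF1 hα hm (hψI.comp_mul_left g⁻¹) hξ hξc
  rw [transferredMap, dif_pos h]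
  exact h.coeFn_toLp

theorem norm_transferredMap_le (hμ : IsMeasureClassPreserving G μ) (hF : Measurable F)
    (hF0 : ∀ x, 0 ≤ F x) (hFi : Integrable F μ) (hF1 : ∫ x, F x ∂μ ≤ 1) (hα : Measurable α)
    {ψ : G → ℝ} (hψ : Continuous ψ) (hψs : HasCompactSupport ψ) (hψ0 : ∀ k, 0 ≤ ψ k)
    (hψ1 : ∫ k, ψ k ∂(Measure.haar : Measure G) = 1) {ξ : H → E}
    (hξ : Continuous ξ) {c : ℝ} (hξc : ∀ x, ‖ξ x‖ ≤ c) (g : G) :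
    ‖transferredMap μ F α ψ ξ g‖ ≤ c := by
  have hψI : Integrable ψ (Measure.haar : Measure G) := hψ.integrable_of_hasCompactSupport hψs
  have hm : Measurable fun l => ψ (g⁻¹ * l) := (hψ.comp (continuous_const_mul g⁻¹)).measurable
  obtain ⟨h, hle⟩ := memLp_averagedVector hμ hF hF0 hFi hF1 hα hm (hψI.comp_mul_left g⁻¹) hξ hξc
  rw [transferredMap, dif_pos h]
  refine hle.trans_eq ?_
  simp only [abs_of_nonneg (hψ0 _)]
  rw [integral_mul_left_eq_self, hψ1, mul_one]

/-- The difference of two values is the averaged vector for a difference of translates of ψ, which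
is small in L¹(G). This continuity is the purpose of averaging over `G`. -/
theorem continuous_transferredMap (hμ : IsMeasureClassPreserving G μ) (hF : Measurable F)
    (hF0 : ∀ x, 0 ≤ F x) (hFi : Integrable F μ) (hF1 : ∫ x, F x ∂μ ≤ 1) (hα : Measurable α)
    {ψ : G → ℝ} (hψ : Continuous ψ) (hψs : HasCompactSupport ψ) {ξ : H → E}
    (hξ : Continuous ξ) {c : ℝ} (hξc : ∀ x, ‖ξ x‖ ≤ c) :
    Continuous (transferredMap μ F α ψ ξ) := by
  have hψI : Integrable ψ (Measure.haar : Measure G) := hψ.integrable_of_hasCompactSupport hψs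
  have hm : ∀ g : G, Measurable fun l => ψ (g⁻¹ * l) := fun g =>
    (hψ.comp (continuous_const_mul g⁻¹)).measurable
  have hI : ∀ g : G, Integrable (fun l => ψ (g⁻¹ * l)) (Measure.haar : Measure G) := fun g =>
    hψI.comp_mul_left g⁻¹
  have hc : 0 ≤ c := (norm_nonneg _).trans (hξc 1)
  rw [Metric.continuous_iff']
  intro g ε hε
  have hc1 : 0 < c + 1 := by linarith
  filter_upwards [continuous_inv.continuousAt.eventually
    (eventually_integral_abs_translate_sub_lt hψ hψs g⁻¹ (div_pos hε hc1))] with g' hg'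
  obtain ⟨h, hle⟩ := memLp_averagedVector (ξ := ξ) hμ hF hF0 hFi hF1 hα ((hm g').sub (hm g))
    ((hI g').sub (hI g)) hξ hξc
  have heq : transferredMap μ F α ψ ξ g' - transferredMap μ F α ψ ξ g = h.toLp _ := by
    refine Lp.ext ?_
    filter_upwards [Lp.coeFn_sub (transferredMap μ F α ψ ξ g') (transferredMap μ F α ψ ξ g),
      transferredMap_coe hμ hF hF0 hFi hF1 hα hψ hψs hξ hξc g',
      transferredMap_coe hμ hF hF0 hFi hF1 hα hψ hψs hξ hξc g, h.coeFn_toLp,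
      averagedVector_sub hμ hF hF0 hFi hα (hm g') (hI g') (hm g) (hI g) hξ hξc]
      with y h1 h2 h3 h4 h5
    rw [h1, h4, Pi.sub_apply, h2, h3]
    exact h5.symm
  rw [dist_eq_norm, heq]
  refine hle.trans_lt ?_
  rw [lt_div_iff₀ hc1] at hg'
  refine lt_of_le_of_lt ?_ hg'
  rw [mul_comm]
  exact mul_le_mul_of_nonneg_left (by linarith) (integral_nonneg fun _ => abs_nonneg _)

/-- The substitution (k, l) ↦ (hk, gl) and the left invariance of the kernel turn dependence on g
and h into dependence on h⁻¹g. -/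
theorem transferredFun_eq_inner (hμ : IsMeasureClassPreserving G μ) (hF : Measurable F)
    (hF0 : ∀ x, 0 ≤ F x) (hFi : Integrable F μ) (hF1 : ∫ x, F x ∂μ ≤ 1) (hα : IsBorelCocycle μ α)
    {ψ : G → ℝ} (hψ : Continuous ψ) (hψs : HasCompactSupport ψ) {ξ η : H → E}
    (hξ : Continuous ξ) (hη : Continuous η) {c d : ℝ} (hξc : ∀ x, ‖ξ x‖ ≤ c)
    (hηd : ∀ x, ‖η x‖ ≤ d) {u : H → ℂ} (hum : Measurable u) {C : ℝ} (huC : ∀ x, ‖u x‖ ≤ C)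
    (hu : ∀ x x' : H, u (x'⁻¹ * x) = inner ℂ (η x') (ξ x)) (g h : G) :
    transferredFun μ F α ψ u (h⁻¹ * g)
      = inner ℂ (transferredMap μ F α ψ η h) (transferredMap μ F α ψ ξ g) := by
  have hψI : Integrable ψ (Measure.haar : Measure G) := hψ.integrable_of_hasCompactSupport hψs
  have hm : ∀ g : G, Measurable fun l => ψ (g⁻¹ * l) := fun g =>
    (hψ.comp (continuous_const_mul g⁻¹)).measurable
  have hI : ∀ g : G, Integrable (fun l => ψ (g⁻¹ * l)) (Measure.haar : Measure G) := fun g =>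
    hψI.comp_mul_left g⁻¹
  have h1 : inner ℂ (transferredMap μ F α ψ η h) (transferredMap μ F α ψ ξ g)
      = ∫ y, inner ℂ (averagedVector μ F α (fun l => ψ (h⁻¹ * l)) η y)
        (averagedVector μ F α (fun l => ψ (g⁻¹ * l)) ξ y) ∂μ := by
    rw [L2.inner_def]
    refine integral_congr_ae ?_
    filter_upwards [transferredMap_coe hμ hF hF0 hFi hF1 hα.measurable hψ hψs hη hηd h,
      transferredMap_coe hμ hF hF0 hFi hF1 hα.measurable hψ hψs hξ hξc g] with y h1 h2
    rw [h1, h2]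
  rw [h1, integral_inner_averagedVector hμ hF hF0 hFi hα.measurable (hm g) (hI g) (hm h) (hI h) hξ
    hη hξc hηd hum huC hu, transferredFun, ← integral_mul_left_eq_self (fun p : G × G =>
      ((ψ (h⁻¹ * p.1) * ψ (g⁻¹ * p.2) : ℝ) : ℂ) * twistedKernel μ F α u p.2 p.1) (h, g)]
  refine integral_congr_ae (Eventually.of_forall fun p => ?_)
  simp only [Prod.fst_mul, Prod.snd_mul, inv_mul_cancel_left]
  rw [← twistedKernel_mul_mul hμ hF hα hum h (h⁻¹ * g * p.2) p.1]
  simp only [mul_assoc, mul_inv_cancel_left]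

end AveragedVectors

/-! ### Averaging against a bump function -/

section Bump

variable {G : Type*} [Group G] [TopologicalSpace G] [IsTopologicalGroup G]
  [LocallyCompactSpace G] [MeasurableSpace G] [BorelSpace G]

/-- Continuous compactly supported probability densities with respect to Haar measure. -/
structure IsBump (ψ : G → ℝ) : Prop where
  continuous : Continuous ψ
  hasCompactSupport : HasCompactSupport ψ
  nonneg : ∀ k, 0 ≤ ψ k
  integral_eq_one : ∫ k, ψ k ∂(Measure.haar : Measure G) = 1

theorem IsBump.integrable {ψ : G → ℝ} (h : IsBump ψ) : Integrable ψ (Measure.haar : Measure G) :=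
  h.continuous.integrable_of_hasCompactSupport h.hasCompactSupport

theorem IsBump.norm_integral_mul_sub_le [SecondCountableTopology G] {ψ : G → ℝ} (h : IsBump ψ)
    {k : G × G → ℂ} (hk : AEStronglyMeasurable k ((Measure.haar : Measure G).prod Measure.haar))
    {z : ℂ} {ε C : ℝ} (hC : ∀ p, ‖k p‖ ≤ C)
    (hε : ∀ p : G × G, p.1 ∈ tsupport ψ → p.2 ∈ tsupport ψ → ‖k p - z‖ ≤ ε) :
    ‖(∫ p : G × G, ((ψ p.1 * ψ p.2 : ℝ) : ℂ) * k p ∂((Measure.haar : Measure G).prod Measure.haar))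
      - z‖ ≤ ε := by
  have hI : Integrable (fun p : G × G => ψ p.1 * ψ p.2)
      ((Measure.haar : Measure G).prod Measure.haar) := h.integrable.mul_prod h.integrable
  have hIC : Integrable (fun p : G × G => ((ψ p.1 * ψ p.2 : ℝ) : ℂ))
      ((Measure.haar : Measure G).prod Measure.haar) := hI.ofReal
  have h1 : ∫ p : G × G, ψ p.1 * ψ p.2 ∂((Measure.haar : Measure G).prod Measure.haar) = 1 := by
    rw [integral_prod_mul, h.integral_eq_one, mul_one]
  have hz : ∫ p : G × G, ((ψ p.1 * ψ p.2 : ℝ) : ℂ) * z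
      ∂((Measure.haar : Measure G).prod Measure.haar) = z := by
    rw [integral_mul_const, integral_complex_ofReal, h1, Complex.ofReal_one, one_mul]
  have hIk : Integrable (fun p : G × G => ((ψ p.1 * ψ p.2 : ℝ) : ℂ) * k p)
      ((Measure.haar : Measure G).prod Measure.haar) :=
    hIC.mul_bdd hk (Eventually.of_forall hC)
  rw [← congrArg (_ - ·) hz, ← integral_sub hIk (hIC.mul_const z)]
  refine (norm_integral_le_of_norm_le (hI.mul_const ε) (Eventually.of_forall fun p => ?_)).trans_eq
    (by rw [integral_mul_const, h1, one_mul])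
  rw [← mul_sub, norm_mul, Complex.norm_real,
    Real.norm_of_nonneg (mul_nonneg (h.nonneg _) (h.nonneg _))]
  by_cases h1 : ψ p.1 = 0
  · simp [h1]
  by_cases h2 : ψ p.2 = 0
  · simp [h2]
  exact mul_le_mul_of_nonneg_left (hε p (subset_tsupport _ h1) (subset_tsupport _ h2))
    (mul_nonneg (h.nonneg _) (h.nonneg _))

end Bump

/-- Nonnegative measurable functions with integral at most `1`. -/
structure IsSubdensity {X : Type*} [MeasurableSpace X] (μ : Measure X) (F : X → ℝ) : Prop where
  measurable : Measurable F
  nonneg : ∀ x, 0 ≤ F x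
  integrable : Integrable F μ
  integral_le_one : ∫ x, F x ∂μ ≤ 1

theorem IsDensity.indicator {X : Type*} [MeasurableSpace X] {μ : Measure X} {f : X → ℝ}
    (hf : IsDensity μ f) {A : Set X} (hA : MeasurableSet A) :
    IsSubdensity μ (A.indicator f) where
  measurable := hf.measurable.indicator hA
  nonneg := fun x => Set.indicator_nonneg (fun x _ => hf.nonneg x) x
  integrable := hf.integrable.indicator hA
  integral_le_one := by
    rw [← hf.integral_eq_one]
    exact integral_mono (hf.integrable.indicator hA) hf.integrable
      (Set.indicator_le_self' fun x _ => hf.nonneg x)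

/-! ### Properties preserved by the transfer -/

section TransferredFunctions

open scoped Pointwise

variable {G H X : Type*} [Group G] [TopologicalSpace G] [IsTopologicalGroup G]
  [LocallyCompactSpace G] [SecondCountableTopology G] [MeasurableSpace G] [BorelSpace G]
  [MulAction G X] [MeasurableSpace X] [MeasurableSMul₂ G X] [StandardBorelSpace X]
  [Group H] [TopologicalSpace H] [IsTopologicalGroup H] [SecondCountableTopology H]
  [MeasurableSpace H] [BorelSpace H]
  {μ : Measure X} [IsProbabilityMeasure μ] {F : X → ℝ} {α : G × X → H} {ψ : G → ℝ} {u : H → ℂ}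

theorem stronglyMeasurable_twistedKernel (hF : Measurable F) (hα : Measurable α)
    (hu : Measurable u) :
    StronglyMeasurable fun p : G × G => twistedKernel μ F α u p.1 p.2 :=
  (measurable_twistedIntegrand μ hF hα hu).stronglyMeasurable.integral_prod_right' (ν := μ)

theorem IsSubdensity.norm_twistedKernel_le (hμ : IsMeasureClassPreserving G μ)
    (hF : IsSubdensity μ F) {C : ℝ} (huC : ∀ x, ‖u x‖ ≤ C) (s t : G) :
    ‖twistedKernel μ F α u s t‖ ≤ C :=
  ProperCocycle.norm_twistedKernel_le hμ hF.measurable hF.nonneg hF.integrable hF.integral_le_one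
    ((norm_nonneg _).trans (huC 1)) (Eventually.of_forall fun _ _ => huC _)

theorem IsBump.norm_transferredFun_sub_le (hψ : IsBump ψ) (hμ : IsMeasureClassPreserving G μ)
    (hF : IsSubdensity μ F) (hα : Measurable α) (hu : Measurable u) {C : ℝ}
    (huC : ∀ x, ‖u x‖ ≤ C) {g : G} {z : ℂ} {ε : ℝ}
    (hε : ∀ k ∈ tsupport ψ, ∀ l ∈ tsupport ψ, ‖twistedKernel μ F α u (g * l) k - z‖ ≤ ε) :
    ‖transferredFun μ F α ψ u g - z‖ ≤ ε := by
  have hm : Measurable fun p : G × G => (g * p.2, p.1) :=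
    (measurable_snd.const_mul g).prodMk measurable_fst
  exact hψ.norm_integral_mul_sub_le
    ((stronglyMeasurable_twistedKernel hF.measurable hα hu).comp_measurable hm).aestronglyMeasurable
    (fun p => hF.norm_twistedKernel_le hμ huC _ _) fun p h1 h2 => hε _ h1 _ h2

theorem HasSchurRep.transferredFun {c : ℝ} (hu : HasSchurRep u c)
    (hμ : IsMeasureClassPreserving G μ) (hF : IsSubdensity μ F) (hα : IsBorelCocycle μ α)
    (hψ : IsBump ψ) : HasSchurRep (transferredFun μ F α ψ u) c := by
  have huC := hu.norm_le
  have hum := hu.continuous.measurable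
  obtain ⟨E, _, _, _, _, ξ, η, hξ, hη, hξc, hηc, hu⟩ := hu
  have hξ' : ∀ x, ‖ξ x‖ ≤ √c := fun x => Real.le_sqrt_of_sq_le (hξc x)
  have hη' : ∀ x, ‖η x‖ ≤ √c := fun x => Real.le_sqrt_of_sq_le (hηc x)
  have hc : 0 ≤ c := (sq_nonneg _).trans (hξc 1)
  have hn : ∀ {ζ : H → E}, Continuous ζ → (∀ x, ‖ζ x‖ ≤ √c) → ∀ g : G,
      ‖transferredMap μ F α ψ ζ g‖ ^ 2 ≤ c := fun hζ hζ' g =>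
    (pow_le_pow_left₀ (norm_nonneg _) (norm_transferredMap_le hμ hF.measurable hF.nonneg
      hF.integrable hF.integral_le_one hα.measurable hψ.continuous hψ.hasCompactSupport hψ.nonneg
      hψ.integral_eq_one hζ hζ' g) 2).trans_eq (Real.sq_sqrt hc)
  have hcont : ∀ {ζ : H → E}, Continuous ζ → (∀ x, ‖ζ x‖ ≤ √c) →
      Continuous (transferredMap μ F α ψ ζ) := fun hζ hζ' =>
    continuous_transferredMap hμ hF.measurable hF.nonneg hF.integrable hF.integral_le_one
      hα.measurable hψ.continuous hψ.hasCompactSupport hζ hζ'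
  exact HasSchurRep.of_inner (hcont hξ hξ') (hcont hη hη') (hn hξ hξ') (hn hη hη')
    (transferredFun_eq_inner hμ hF.measurable hF.nonneg hF.integrable hF.integral_le_one hα
      hψ.continuous hψ.hasCompactSupport hξ hη hξ' hη' hum huC hu)

/-- A GNS representation of u has η = ξ, so the two transferred maps coincide as well. -/
theorem IsPosDefFun.transferredFun (hu : IsPosDefFun u) (huc : Continuous u)
    (hμ : IsMeasureClassPreserving G μ) (hF : IsSubdensity μ F) (hα : IsBorelCocycle μ α)
    (hψ : IsBump ψ) : IsPosDefFun (transferredFun μ F α ψ u) := by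
  obtain ⟨E, _, _, _, ξ, hξ, hu⟩ := hu.exists_inner huc
  have hn : ∀ x, ‖ξ x‖ ^ 2 = ‖u 1‖ := fun x => by
    have := hu x x
    rw [inv_mul_cancel, inner_self_eq_norm_sq_to_K] at this
    rw [this]; simp
  have hξc : ∀ x, ‖ξ x‖ ≤ √‖u 1‖ := fun x => Real.le_sqrt_of_sq_le (hn x).le
  have huC : ∀ x, ‖u x‖ ≤ ‖u 1‖ := fun x => by
    have h := hu x 1
    rw [inv_one, one_mul] at h
    rw [h]
    refine (norm_inner_le_norm _ _).trans ?_
    nlinarith [sq_nonneg (‖ξ 1‖ - ‖ξ x‖), hn x, hn 1]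
  exact isPosDefFun_of_inner (transferredFun_eq_inner hμ hF.measurable hF.nonneg hF.integrable
    hF.integral_le_one hα hψ.continuous hψ.hasCompactSupport hξ hξ hξc hξc huc.measurable huC hu)

/-- `F` vanishes off a set `A` whose return sets are precompact. -/
def HasPrecompactReturns (μ : Measure X) (α : G × X → H) (F : X → ℝ) : Prop :=
  ∃ A : Set X, (∀ x ∉ A, F x = 0) ∧
    ∀ L : Set H, IsCompact L → IsCompact (closure (returnSet μ α A L))

/-- Take L compact with |u| < ε/2 off L. For g outside S · closure K(A,L) · S⁻¹, with S the support
of ψ, every k⁻¹gl with k, l in S avoids the return set, so all kernel values being averaged are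
small. -/
theorem IsC0.transferredFun {c : ℝ} (hu : HasSchurRep u c) (hu0 : IsC0 u)
    (hμ : IsMeasureClassPreserving G μ) (hF : IsSubdensity μ F) (hα : IsBorelCocycle μ α)
    (hψ : IsBump ψ) (hret : HasPrecompactReturns μ α F) : IsC0 (transferredFun μ F α ψ u) := by
  refine ⟨(hu.transferredFun hμ hF hα hψ).continuous, ?_⟩
  obtain ⟨A, hFA, hA⟩ := hret
  rw [Metric.tendsto_nhds]
  intro ε hε
  obtain ⟨L, hL, hLu⟩ := mem_cocompact.1 ((Metric.tendsto_nhds.1 hu0.2) (ε / 2) (by positivity))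
  have hS : IsCompact (tsupport ψ) := hψ.hasCompactSupport
  refine mem_cocompact.2 ⟨tsupport ψ * closure (returnSet μ α A L) * (tsupport ψ)⁻¹,
    (hS.mul (hA L hL)).mul hS.inv, fun g hg => ?_⟩
  have h := hψ.norm_transferredFun_sub_le (g := g) (z := 0) (ε := ε / 2) hμ hF hα.measurable
    hu.continuous.measurable hu.norm_le fun k hk l hl => by
      rw [sub_zero]
      refine norm_twistedKernel_le_of_notMem_returnSet hμ hF.measurable hF.nonneg hF.integrable
        hF.integral_le_one hα hu.continuous.measurable hFA (L := L) (by positivity)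
        (fun x hx => ?_) fun hmem => hg ?_
      · have h : dist (u x) 0 < ε / 2 := hLu hx
        exact (dist_zero_right (u x)).symm.trans_le h.le
      · exact ⟨k * (k⁻¹ * (g * l)), ⟨k, hk, _, subset_closure hmem, rfl⟩, l⁻¹,
          Set.inv_mem_inv.2 hl, by group⟩
  show dist _ _ < ε
  rw [dist_eq_norm]
  linarith

/-- Carrying out only the average over l gives a bounded function ω, and the transferred function is
g ↦ ∫ ψ(k) ω(k⁻¹g) dk. This is the coefficient of ψ and x ↦ ω(x⁻¹). The latter is in L², because the
kernel vanishes off a precompact return set. -/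
theorem isFourierAlgebra_transferredFun {c : ℝ} (hu : HasSchurRep u c) (hus : HasCompactSupport u)
    (hμ : IsMeasureClassPreserving G μ) (hF : IsSubdensity μ F) (hα : IsBorelCocycle μ α)
    (hψ : IsBump ψ) (hret : HasPrecompactReturns μ α F) :
    IsFourierAlgebra (transferredFun μ F α ψ u) := by
  obtain ⟨A, hFA, hA⟩ := hret
  have hS : IsCompact (tsupport ψ) := hψ.hasCompactSupport
  have hum := hu.continuous.measurable
  have hc : 0 ≤ c := (norm_nonneg _).trans (hu.norm_le 1)
  let T : G → ℂ := fun x => twistedKernel μ F α u x 1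
  have hTm : StronglyMeasurable T :=
    (stronglyMeasurable_twistedKernel (μ := μ) hF.measurable hα.measurable hum).comp_measurable
      measurable_prodMk_right
  have hTc : ∀ x, ‖T x‖ ≤ c := fun x => hF.norm_twistedKernel_le hμ hu.norm_le _ _
  let ω : G → ℂ := fun x => ∫ l, (ψ l : ℂ) * T (x * l) ∂(Measure.haar : Measure G)
  have hm : StronglyMeasurable fun p : G × G => (ψ p.2 : ℂ) * T (p.1 * p.2) :=
    (Complex.measurable_ofReal.comp (hψ.continuous.measurable.comp
      measurable_snd)).stronglyMeasurable.mul
      (hTm.comp_measurable (measurable_fst.mul measurable_snd))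
  have hωm : StronglyMeasurable ω := hm.integral_prod_right'
  have hωc : ∀ x, ‖ω x‖ ≤ c := fun x => by
    refine (norm_integral_le_of_norm_le (hψ.integrable.mul_const c)
      (Eventually.of_forall fun l => ?_)).trans_eq
      (by rw [integral_mul_const, hψ.integral_eq_one, one_mul])
    rw [norm_mul, Complex.norm_real, Real.norm_of_nonneg (hψ.nonneg l)]
    exact mul_le_mul_of_nonneg_left (hTc _) (hψ.nonneg l)
  -- With L the support of u, the bound off the return set is 0.
  have hω0 : ∀ x, ω x⁻¹ ≠ 0 → x ∈ tsupport ψ * (closure (returnSet μ α A (tsupport u)))⁻¹ := by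
    intro x hx
    by_contra hmem
    refine hx (integral_eq_zero_of_ae (Eventually.of_forall fun l => ?_))
    simp only [Pi.zero_apply]
    by_cases hl : ψ l = 0
    · simp [hl]
    have hT0 : T (x⁻¹ * l) = 0 := by
      rw [← norm_le_zero_iff]
      refine norm_twistedKernel_le_of_notMem_returnSet hμ hF.measurable hF.nonneg hF.integrable
        hF.integral_le_one hα hum hFA (L := tsupport u) le_rfl
        (fun x hx => by rw [image_eq_zero_of_notMem_tsupport hx, norm_zero]) fun h => hmem ?_
      rw [inv_one, one_mul] at h
      exact ⟨l, subset_tsupport _ hl, (x⁻¹ * l)⁻¹, Set.inv_mem_inv.2 (subset_closure h), by group⟩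
    rw [hT0, mul_zero]
  have hKc : IsCompact (tsupport ψ * (closure (returnSet μ α A (tsupport u)))⁻¹) :=
    hS.mul (hA _ hus).inv
  refine ⟨fun x => ω x⁻¹, fun k => (ψ k : ℂ), ?_, ?_, fun g => ?_⟩
  · obtain ⟨K, hK, hKs⟩ : ∃ K : Set G, IsCompact K ∧ MeasurableSet K ∧
        tsupport ψ * (closure (returnSet μ α A (tsupport u)))⁻¹ ⊆ K :=
      ⟨_, hKc.closure, isClosed_closure.measurableSet, subset_closure⟩
    have hind : (fun x => ω x⁻¹) = K.indicator fun x => ω x⁻¹ := by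
      refine (Set.indicator_eq_self.2 fun x hx => hKs.2 (hω0 x hx)).symm
    rw [hind, memLp_indicator_iff_restrict hKs.1]
    have : IsFiniteMeasure ((Measure.haar : Measure G).restrict K) :=
      isFiniteMeasure_restrict.2 hK.measure_lt_top.ne
    exact MemLp.of_bound (hωm.comp_measurable measurable_inv).aestronglyMeasurable c
      (Eventually.of_forall fun x => hωc _)
  · exact (Complex.continuous_ofReal.comp hψ.continuous).memLp_of_hasCompactSupport
      (hψ.hasCompactSupport.comp_left Complex.ofReal_zero)
  · have hI : Integrable (fun p : G × G => ((ψ p.1 * ψ p.2 : ℝ) : ℂ) * T (p.1⁻¹ * (g * p.2)))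
        ((Measure.haar : Measure G).prod Measure.haar) := by
      have hb : Integrable (fun p : G × G => ((ψ p.1 * ψ p.2 : ℝ) : ℂ))
        ((Measure.haar : Measure G).prod Measure.haar) :=
          (hψ.integrable.mul_prod hψ.integrable).ofReal
      exact hb.mul_bdd (hTm.comp_measurable
        (measurable_fst.inv.mul (measurable_snd.const_mul g))).aestronglyMeasurable
        (Eventually.of_forall fun p => hTc _)
    have hk : ∀ p : G × G, twistedKernel μ F α u (g * p.2) p.1 = T (p.1⁻¹ * (g * p.2)) :=
      fun p => twistedKernel_eq hμ hF.measurable hα hum _ _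
    simp only [ProperCocycle.transferredFun, hk]
    rw [integral_prod _ hI]
    refine integral_congr_ae (Eventually.of_forall fun k => ?_)
    simp only [ω, Complex.conj_ofReal]
    rw [← integral_mul_const]
    refine integral_congr_ae (Eventually.of_forall fun l => ?_)
    simp only [Complex.ofReal_mul, mul_inv_rev, inv_inv, mul_assoc]
    ring

end TransferredFunctions

/-- Absolute continuity of the integral, in the form in which properness supplies small sets. -/
theorem exists_setIntegral_le_of_measure_le {X : Type*} [MeasurableSpace X] {μ : Measure X}
    {f : X → ℝ} (hf : Integrable f μ) (hf0 : ∀ x, 0 ≤ f x) {ε : ℝ} (hε : 0 < ε) :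
    ∃ η : ℝ, 0 < η ∧ ∀ s : Set X, μ s ≤ ENNReal.ofReal η → ∫ x in s, f x ∂μ ≤ ε := by
  have hfin : ∫⁻ x, ENNReal.ofReal (f x) ∂μ ≠ ∞ :=
    (hasFiniteIntegral_iff_ofReal (Eventually.of_forall hf0)).1 hf.2 |>.ne
  obtain ⟨δ, hδ, hs⟩ := exists_pos_setLIntegral_lt_of_measure_lt hfin
    (ENNReal.ofReal_pos.2 hε).ne'
  obtain ⟨η, hη0, hηδ⟩ := ENNReal.lt_iff_exists_nnreal_btwn.1 hδ
  refine ⟨(η : ℝ), by exact_mod_cast hη0, fun s hμs => ?_⟩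
  rw [ENNReal.ofReal_coe_nnreal] at hμs
  rw [integral_eq_lintegral_of_nonneg_ae (Eventually.of_forall hf0)
    hf.aestronglyMeasurable.restrict]
  exact ENNReal.toReal_le_of_le_ofReal hε.le (hs s (hμs.trans_lt hηδ)).le

theorem returnSet_mono {G H X : Type*} [Group G] [MulAction G X] [MeasurableSpace X]
    {μ : Measure X} {α : G × X → H} {A B : Set X} {L M : Set H} (hAB : A ⊆ B) (hLM : L ⊆ M) :
    returnSet μ α A L ⊆ returnSet μ α B M := by
  intro g (hg : 0 < μ {x | x ∈ A ∧ g • x ∈ A ∧ α (g, x) ∈ L})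
  have h : {x | x ∈ A ∧ g • x ∈ A ∧ α (g, x) ∈ L} ⊆ {x | x ∈ B ∧ g • x ∈ B ∧ α (g, x) ∈ M} :=
    fun x hx => ⟨hAB hx.1, hAB hx.2.1, hLM hx.2.2⟩
  exact hg.trans_le (measure_mono h)

/-! ### From compact sets to sequences -/

section Sequences

variable {G : Type*} [Group G] [TopologicalSpace G] [LocallyCompactSpace G]
  [SecondCountableTopology G]

theorem TendstoOneOnCompacts.exists_norm_sub_one_le {u : ℕ → G → ℂ} (hu : TendstoOneOnCompacts u)
    {K : Set G} (hK : IsCompact K) {ε : ℝ} (hε : 0 < ε) : ∃ n, ∀ g ∈ K, ‖u n g - 1‖ ≤ ε := by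
  obtain ⟨n, hn⟩ := (Metric.tendstoUniformlyOn_iff.1 (hu K hK) ε hε).exists
  refine ⟨n, fun g hg => ?_⟩
  rw [← dist_eq_norm, dist_comm]
  exact (hn g hg).le

/-- Along a compact exhaustion with errors 1/(n+1), every compact set is eventually contained in the
n-th one. -/
theorem exists_seq_tendstoOneOnCompacts {P : (G → ℂ) → Prop}
    (h : ∀ K : Set G, IsCompact K → ∀ ε : ℝ, 0 < ε → ∃ u, P u ∧ ∀ g ∈ K, ‖u g - 1‖ ≤ ε) :
    ∃ u : ℕ → G → ℂ, (∀ n, P (u n)) ∧ TendstoOneOnCompacts u := by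
  let K : CompactExhaustion G := default
  choose u hP hu using fun n : ℕ => h (K n) (K.isCompact n) (1 / (n + 1)) Nat.one_div_pos_of_nat
  refine ⟨u, hP, fun L hL => ?_⟩
  obtain ⟨m, hm⟩ := K.exists_superset_of_isCompact hL
  rw [Metric.tendstoUniformlyOn_iff]
  intro ε hε
  obtain ⟨N, hN⟩ := exists_nat_one_div_lt hε
  filter_upwards [eventually_ge_atTop (max m N)] with n hn g hg
  rw [dist_comm, dist_eq_norm]
  refine ((hu n g (K.subset ((le_max_left _ _).trans hn) (hm hg))).trans ?_).trans_lt hN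
  exact Nat.one_div_le_one_div ((le_max_right _ _).trans hn)

end Sequences

/-! ### Transfer of the approximation properties -/

section Transfer

open scoped Pointwise

variable {G H X : Type*} [Group G] [TopologicalSpace G] [IsTopologicalGroup G]
  [LocallyCompactSpace G] [SecondCountableTopology G] [MeasurableSpace G] [BorelSpace G]
  [MulAction G X] [MeasurableSpace X] [MeasurableSMul₂ G X] [StandardBorelSpace X]
  [Group H] [TopologicalSpace H] [IsTopologicalGroup H] [LocallyCompactSpace H]
  [SecondCountableTopology H] [MeasurableSpace H] [BorelSpace H]
  {μ : Measure X} [IsProbabilityMeasure μ] {α : G × X → H}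

/-- Properness allows A to depend on L. Intersecting the sets for an exhaustion of `H`, with
summable deficits, gives a single A, because return sets are monotone in both arguments. -/
theorem IsProperCocycle.exists_precompact_returnSets (hα : IsProperCocycle μ α) {ε : ℝ}
    (hε : 0 < ε) : ∃ A : Set X, MeasurableSet A ∧ μ Aᶜ ≤ ENNReal.ofReal ε ∧
      ∀ L : Set H, IsCompact L → IsCompact (closure (returnSet μ α A L)) := by
  let K : CompactExhaustion H := default
  obtain ⟨δ, hδ, hsum⟩ := ENNReal.exists_pos_sum_of_countable (ENNReal.ofReal_pos.2 hε).ne' ℕ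
  choose A hA hAδ hAc using fun n => hα.precompact_returnSet (K n) (K.isCompact n) (δ n) (hδ n)
  refine ⟨⋂ n, A n, MeasurableSet.iInter hA, ?_, fun L hL => ?_⟩
  · rw [Set.compl_iInter]
    refine (measure_iUnion_le _).trans ((ENNReal.tsum_le_tsum fun n => ?_).trans hsum.le)
    exact (hAδ n).trans_eq (ENNReal.ofReal_coe_nnreal)
  · obtain ⟨n, hn⟩ := K.exists_superset_of_isCompact hL
    exact (hAc n).of_isClosed_subset isClosed_closure
      (closure_mono (returnSet_mono (Set.iInter_subset A n) hn))

/-- The data needed to transfer functions from `H` to `G` along a proper cocycle, almost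
preserving closeness to `1` on a given compact set. -/
theorem IsProperCocycle.exists_transfer (hα : IsProperCocycle μ α)
    (hμ : IsMeasureClassPreserving G μ) (hamen : IsAmenablePair G μ) {K : Set G}
    (hK : IsCompact K) {ε : ℝ} (hε : 0 < ε) {C : ℝ} (hC : 0 ≤ C) :
    ∃ (F : X → ℝ) (ψ : G → ℝ), IsSubdensity μ F ∧ IsBump ψ ∧ HasPrecompactReturns μ α F ∧
      ∃ (L : Set H) (δ : ℝ), IsCompact L ∧ 0 < δ ∧ ∀ u : H → ℂ, Measurable u →
        (∀ x, ‖u x‖ ≤ C) → (∀ x ∈ L, ‖u x - 1‖ ≤ δ) →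
        ∀ g ∈ K, ‖transferredFun μ F α ψ u g - 1‖ ≤ ε := by
  obtain ⟨ψ, hψ, hψs, hψ0, hψ1, -⟩ := exists_density_near_one (G := G) univ_mem
  have hψ : IsBump ψ := ⟨hψ, hψs, hψ0, hψ1⟩
  have hS : IsCompact (tsupport ψ) := hψs
  have hQ : IsCompact (K * tsupport ψ ∪ tsupport ψ) := (hK.mul hS).union hS
  -- `Q` contains every gl and every k at which the averaged kernel is evaluated.
  set Q := K * tsupport ψ ∪ tsupport ψ
  set δ := ε / (2 * C + 7)
  have hδ : 0 < δ := by positivity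
  obtain ⟨M⟩ := hamen.nonempty_invariantMean hμ
  obtain ⟨f, hf, hfQ⟩ := exists_density_almost_invariant hμ M hQ hδ
  obtain ⟨η, hη, hfη⟩ := exists_setIntegral_le_of_measure_le hf.integrable hf.nonneg hδ
  obtain ⟨η', hη', hfη'⟩ := exists_setIntegral_le_of_measure_le hf.integrable hf.nonneg
    (pow_pos hδ 2)
  obtain ⟨A, hA, hAη, hAL⟩ := hα.exists_precompact_returnSets hη
  obtain ⟨A', hA', -, hAη', hAc'⟩ := hα.precompact_image Set.univ MeasurableSet.univ η' hη' Q hQ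
  rw [← Set.compl_eq_univ_sdiff] at hAη'
  refine ⟨A.indicator f, ψ, hf.indicator hA, hψ,
    ⟨A, fun x hx => Set.indicator_of_notMem hx f, hAL⟩,
    -- This compact set contains all quotients α(t,x)⁻¹ α(s,x') with s, t in `Q` and x, x' in A'.
    (closure (α '' (Q ×ˢ A')))⁻¹ * closure (α '' (Q ×ˢ A')), δ, hAc'.inv.mul hAc', hδ,
    fun u hu huC huL g hg => ?_⟩
  refine hψ.norm_transferredFun_sub_le hμ (hf.indicator hA) hα.measurable hu huC
    fun k hk l hl => ?_
  have hk' : k ∈ Q := Or.inr hk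
  have hl' : g * l ∈ Q := Or.inl (Set.mul_mem_mul hg hl)
  refine (norm_twistedKernel_sub_one_le hμ hf hα.measurable hu hA hA' hδ hC huC (hfη _ hAη)
    (hfη' _ hAη'.le) (hfQ _ hl') (hfQ _ hk') fun x hx x' hx' => huL _ ?_).trans_eq
    (mul_div_cancel₀ _ (by positivity))
  exact Set.mul_mem_mul (Set.inv_mem_inv.2 (subset_closure ⟨(k, x), ⟨hk', hx⟩, rfl⟩))
    (subset_closure ⟨(g * l, x'), ⟨hl', hx'⟩, rfl⟩)

theorem IsPosDefFun.apply_one_nonneg {u : G → ℂ} (hu : IsPosDefFun u) : 0 ≤ u 1 := by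
  simpa using hu 1 (fun _ => 1) fun _ => 1

theorem IsPosDefFun.const_mul {u : G → ℂ} (hu : IsPosDefFun u) {c : ℂ} (hc : 0 ≤ c) :
    IsPosDefFun fun g => c * u g := by
  intro n g z
  have : ∑ i, ∑ j, conj (z i) * z j * (c * u ((g i)⁻¹ * g j))
      = c * ∑ i, ∑ j, conj (z i) * z j * u ((g i)⁻¹ * g j) := by
    simp only [Finset.mul_sum]
    exact Finset.sum_congr rfl fun i _ => Finset.sum_congr rfl fun j _ => by ring
  rw [this]
  exact mul_nonneg hc (hu n g z)

theorem IsPosDefFun.hasSchurRep {u : H → ℂ} (hu : IsPosDefFun u) (hc : Continuous u)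
    (h1 : u 1 = 1) : HasSchurRep u 1 := by
  obtain ⟨E, _, _, _, ξ, hξ, h⟩ := hu.exists_inner hc
  have hn : ∀ x, ‖ξ x‖ ^ 2 ≤ 1 := fun x => by
    have := h x x
    rw [inv_mul_cancel, inner_self_eq_norm_sq_to_K, h1] at this
    have h' : ((‖ξ x‖ ^ 2 : ℝ) : ℂ) = ((1 : ℝ) : ℂ) := by rw [Complex.ofReal_one, this]; simp
    exact (Complex.ofReal_injective h').le
  exact HasSchurRep.of_inner hξ hξ hn hn h

theorem IsProperCocycle.haagerupProperty (hα : IsProperCocycle μ α)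
    (hμ : IsMeasureClassPreserving G μ) (hamen : IsAmenablePair G μ) (hH : HaagerupProperty H) :
    HaagerupProperty G := by
  obtain ⟨u, hu, hu1⟩ := hH
  refine exists_seq_tendstoOneOnCompacts (P := fun u => IsPosDefFun u ∧ u 1 = 1 ∧ IsC0 u)
    fun K hK ε hε => ?_
  -- Restricting f to A may make v(1) differ from 1, so v is divided by v(1). The bound 1/2 keeps
  -- v(1) ≥ 1/2, and ε/4 absorbs the factor 2 and the two error terms.
  have hε' : 0 < min (ε / 4) (1 / 2) := by positivity
  obtain ⟨F, ψ, hF, hψ, hret, L, δ, hL, hδ, htr⟩ :=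
    hα.exists_transfer hμ hamen (hK.insert 1) hε' zero_le_one
  obtain ⟨n, hn⟩ := hu1.exists_norm_sub_one_le hL hδ
  obtain ⟨hpd, hone, hc0⟩ := hu n
  have hrep := hpd.hasSchurRep hc0.1 hone
  set v := transferredFun μ F α ψ (u n)
  have hv : ∀ g ∈ insert 1 K, ‖v g - 1‖ ≤ min (ε / 4) (1 / 2) :=
    htr (u n) hc0.1.measurable hrep.norm_le hn
  have hvpd : IsPosDefFun v := hpd.transferredFun hc0.1 hμ hF hα.toIsBorelCocycle hψ
  have hvc0 : IsC0 v := hc0.transferredFun hrep hμ hF hα.toIsBorelCocycle hψ hret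
  have hv1 := hv 1 (Set.mem_insert _ _)
  obtain ⟨r, hr0, hr⟩ : ∃ r : ℝ, 0 ≤ r ∧ v 1 = r :=
    ⟨(v 1).re, (Complex.nonneg_iff.1 hvpd.apply_one_nonneg).1,
      Complex.eq_re_of_ofReal_le (r := 0) (by simpa using hvpd.apply_one_nonneg)⟩
  have hr2 : 1 / 2 ≤ r := by
    have h := hv1.trans (min_le_right _ _)
    rw [hr, ← Complex.ofReal_one, ← Complex.ofReal_sub, Complex.norm_real, Real.norm_eq_abs] at h
    linarith [(abs_le.1 h).1]
  have hrpos : 0 < r := by linarith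
  have hrne : (r : ℂ) ≠ 0 := Complex.ofReal_ne_zero.2 hrpos.ne'
  refine ⟨fun g => ((r⁻¹ : ℝ) : ℂ) * v g, ⟨hvpd.const_mul
    (Complex.zero_le_real.2 (inv_nonneg.2 hr0)), ?_, continuous_const.mul hvc0.1, ?_⟩,
    fun g hg => ?_⟩
  · simp only
    rw [hr, Complex.ofReal_inv, inv_mul_cancel₀ hrne]
  · simpa using hvc0.2.const_mul ((r⁻¹ : ℝ) : ℂ)
  · have hg := hv g (Set.mem_insert_of_mem _ hg)
    have he : ((r⁻¹ : ℝ) : ℂ) * v g - 1 = ((r⁻¹ : ℝ) : ℂ) * ((v g - 1) - (v 1 - 1)) := by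
      rw [hr, Complex.ofReal_inv]
      field_simp
      ring
    have hri : r⁻¹ ≤ 2 := by
      rw [inv_le_comm₀ hrpos two_pos]
      linarith
    rw [he, norm_mul, Complex.norm_real, Real.norm_of_nonneg (inv_nonneg.2 hr0)]
    have h4 := min_le_left (ε / 4) (1 / 2)
    have hd := norm_sub_le (v g - 1) (v 1 - 1)
    calc r⁻¹ * ‖v g - 1 - (v 1 - 1)‖ ≤ 2 * (ε / 4 + ε / 4) :=
          mul_le_mul hri (by linarith) (norm_nonneg _) zero_le_two
      _ = ε := by ring

theorem hasSchurRep_of_herzSchurNorm_le {u : H → ℂ} {C ε : ℝ≥0} (hu : herzSchurNorm u ≤ C)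
    (hε : 0 < ε) : HasSchurRep u (C + ε : ℝ≥0) := by
  refine hasSchurRep_of_herzSchurNorm_lt (hu.trans_lt ?_)
  rw [ENNReal.ofReal_coe_nnreal]
  exact_mod_cast lt_add_of_pos_right C hε

theorem HasSchurRep.herzSchurNorm_le_coe {u : G → ℂ} {C : ℝ≥0} (h : HasSchurRep u C) :
    herzSchurNorm u ≤ C :=
  h.isHerzSchurMultiplier.2.trans_eq ENNReal.ofReal_coe_nnreal

/-- The slack ε is split in two: one half buys an actual representation, the other half pays for
replacing the function by a compactly supported one, which has an L² coefficient as its transfer. -/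
theorem IsProperCocycle.cowlingHaagerupConstant_le (hα : IsProperCocycle μ α)
    (hμ : IsMeasureClassPreserving G μ) (hamen : IsAmenablePair G μ) :
    cowlingHaagerupConstant G ≤ cowlingHaagerupConstant H := by
  refine le_iInf₂ fun C ⟨hC1, u, hu, hu1⟩ => ENNReal.le_of_forall_pos_le_add fun ε hε _ => ?_
  rw [← ENNReal.coe_add]
  refine iInf₂_le (C + ε) ⟨hC1.trans le_self_add, exists_seq_tendstoOneOnCompacts
    (P := fun u => IsFourierAlgebra u ∧ herzSchurNorm u ≤ (C + ε : ℝ≥0)) fun K hK ε' hε' => ?_⟩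
  obtain ⟨F, ψ, hF, hψ, hret, L, δ, hL, hδ, htr⟩ :=
    hα.exists_transfer hμ hamen hK hε' (C + ε : ℝ≥0).2
  obtain ⟨n, hn⟩ := hu1.exists_norm_sub_one_le hL (half_pos hδ)
  have hrep := hasSchurRep_of_herzSchurNorm_le (hu n).2 (half_pos hε)
  have hε2 : (0 : ℝ) < ε / 2 := half_pos (by exact_mod_cast hε)
  obtain ⟨v, hvs, hvrep, hvu⟩ := (hu n).1.exists_hasCompactSupport
    (lt_min (half_pos hδ) hε2) hrep
  have hvrep' : HasSchurRep v (C + ε : ℝ≥0) := hvrep.mono (by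
    push_cast
    linarith [min_le_right (δ / 2) ((ε : ℝ) / 2)])
  have htrep := hvrep'.transferredFun hμ hF hα.toIsBorelCocycle hψ
  refine ⟨_, ⟨isFourierAlgebra_transferredFun hvrep' hvs hμ hF hα.toIsBorelCocycle hψ hret,
    htrep.herzSchurNorm_le_coe⟩, htr v hvrep'.continuous.measurable hvrep'.norm_le fun x hx => ?_⟩
  have h := norm_add_le (v x - u n x) (u n x - 1)
  rw [sub_add_sub_cancel] at h
  linarith [hvu x, hn x hx, min_le_left (δ / 2) ((ε : ℝ) / 2)]

/-- Decay passes directly to the transferred function, so no truncation is needed; ε is spent only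
on choosing a representation. -/
theorem IsProperCocycle.weakHaagerupConstant_le (hα : IsProperCocycle μ α)
    (hμ : IsMeasureClassPreserving G μ) (hamen : IsAmenablePair G μ) :
    weakHaagerupConstant G ≤ weakHaagerupConstant H := by
  refine le_iInf₂ fun C ⟨hC1, u, hu, hu1⟩ => ENNReal.le_of_forall_pos_le_add fun ε hε _ => ?_
  rw [← ENNReal.coe_add]
  refine iInf₂_le (C + ε) ⟨hC1.trans le_self_add, exists_seq_tendstoOneOnCompacts
    (P := fun u => IsHerzSchurMultiplier u ∧ IsC0 u ∧ herzSchurNorm u ≤ (C + ε : ℝ≥0))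
    fun K hK ε' hε' => ?_⟩
  obtain ⟨F, ψ, hF, hψ, hret, L, δ, hL, hδ, htr⟩ :=
    hα.exists_transfer hμ hamen hK hε' (C + ε : ℝ≥0).2
  obtain ⟨n, hn⟩ := hu1.exists_norm_sub_one_le hL hδ
  have hrep := hasSchurRep_of_herzSchurNorm_le (hu n).2.2 hε
  have htrep := hrep.transferredFun hμ hF hα.toIsBorelCocycle hψ
  exact ⟨_, ⟨htrep.isHerzSchurMultiplier.1,
    (hu n).2.1.transferredFun hrep hμ hF hα.toIsBorelCocycle hψ hret,
    htrep.herzSchurNorm_le_coe⟩, htr (u n) hrep.continuous.measurable hrep.norm_le hn⟩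

end Transfer

end

end ProperCocycle

theorem theorem1p4
    {G H X : Type*}
    [Group G] [TopologicalSpace G] [IsTopologicalGroup G] [T2Space G] [LocallyCompactSpace G]
    [SecondCountableTopology G] [MeasurableSpace G] [BorelSpace G]
    [Group H] [TopologicalSpace H] [IsTopologicalGroup H] [T2Space H] [LocallyCompactSpace H]
    [SecondCountableTopology H] [MeasurableSpace H] [BorelSpace H]
    [MeasurableSpace X] [StandardBorelSpace X] [MulAction G X] [MeasurableSMul₂ G X]
    (μ : Measure X) [IsProbabilityMeasure μ]
    (hμ : ProperCocycle.IsMeasureClassPreserving G μ)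
    (hamen : ProperCocycle.IsAmenablePair G μ)
    (α : G × X → H) (hα : ProperCocycle.IsProperCocycle μ α) :
    (ProperCocycle.HaagerupProperty H → ProperCocycle.HaagerupProperty G) ∧
    ((ProperCocycle.WeaklyAmenable H → ProperCocycle.WeaklyAmenable G) ∧
      ProperCocycle.cowlingHaagerupConstant G ≤ ProperCocycle.cowlingHaagerupConstant H) ∧
    ((ProperCocycle.WeakHaagerupProperty H → ProperCocycle.WeakHaagerupProperty G) ∧
      ProperCocycle.weakHaagerupConstant G ≤ ProperCocycle.weakHaagerupConstant H) := by
  have h₁ := hα.cowlingHaagerupConstant_le hμ hamen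
  have h₂ := hα.weakHaagerupConstant_le hμ hamen
  exact ⟨hα.haagerupProperty hμ hamen, ⟨fun h => h₁.trans_lt h, h₁⟩, fun h => h₂.trans_lt h, h₂⟩
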